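/- **Setting.** Let $\mathsf F,E$ be number fields, $\rho$ complex conjugation, $\tau:\mathsf F\hookrightarrow\mathbf C$, $\sigma:E\hookrightarrow\mathbf C$ embeddings, $E^\sigma=\sigma(E)$, $\mathsf F^{(\tau,\rho)}=\tau(\mathsf F)\,\rho\tau(\mathsf F)$ and $K=E^\sigma\mathsf F^{(\tau,\rho)}\subset\mathbf C$. A pure motive $\mathcal M$ over $\mathsf F$ with coefficients in $E$, of weight $\mathsf w$ and rank $d\ge 1$, enters through its Betti realizations $H_{\rm B}(\mathcal M_{\tau'})$ ($E$-vector spaces of dimension $d$ for all $\tau':\mathsf F\hookrightarrow\mathbf C$, with Hodge decompositions of weight $\mathsf w$ of $H_{\rm B}(\mathcal M_{\tau'})\otimes_{\mathbf Q}\mathbf C$), the $E$-linear isomorphisms $F_{\infty,\tau'}:H_{\rm B}(\mathcal M_{\tau'})\to H_{\rm B}(\mathcal M_{\rho\tau'})$ (with $F_{\infty,\rho\tau'}=F_{\infty,\tau'}^{-1}$, exchanging $H^{p,q}$ and $H^{q,p}$), its de Rham realization $H_{\rm dR}(\mathcal M)$ (free of rank $d$ over $E\otimes_{\mathbf Q}\mathsf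 F$, with its Hodge filtration), and the comparison isomorphisms $I_{\tau',\sigma'}(\mathcal M):H_{\rm B}(\mathcal M_{\tau'})\otimes_{E,\sigma'}\mathbf C\to H_{\rm dR}(\mathcal M)\otimes_{E\otimes\mathsf F,\sigma'\otimes\tau'}\mathbf C$, which match the Hodge decomposition with the Hodge filtration and $F_\infty\otimes\rho$ with $\mathrm{id}\otimes\rho$. If $\mathsf w$ is even we assume that $F_\infty\otimes \mathrm{id}$ acts on $\bigoplus_{\tau'}H^{\mathsf w/2,\mathsf w/2}(\mathcal M_{\tau'})$ as a scalar. Put $\mathcal B(\mathcal M)=\bigoplus_{\tau'}H_{\rm B}(\mathcal M_{\tau'})\otimes_{E,\sigma}E^\sigma$ and $\mathcal T(\mathcal M)=\bigoplus_{\tau'}H_{\rm dR}(\mathcal M)\otimes_{E\otimes\mathsf F,\sigma\otimes\tau'}K$, where $\tau'$ runs over the set $\{\tau,\rho\tau\}$ (one element if $\tau$ is real, two if $\tau$ is complex). Let $F^{\mathcal M}$ be the involution of $\mathcal B(\mathcal M)$ induced by $F_\infty$, $\mathcal B^\pm(\mathcal M)$ its $(\pm1)$-eigenspaces, $\mathcal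 T^p(\mathcal M)$ the Hodge filtration of $\mathcal T(\mathcal M)$, $I^0(\mathcal M):\mathcal B(\mathcal M)\otimes\mathbf C\to\mathcal T(\mathcal M)\otimes\mathbf C$ the sum of the $I_{\tau',\sigma}(\mathcal M)$, $d_*(\mathcal M)=\dim_K\mathcal T(\mathcal M)$ and $d_*^\pm(\mathcal M)=\dim_{E^\sigma}\mathcal B^\pm(\mathcal M)$. Let $i_1^{\mathcal M}<\dots<i_{t}^{\mathcal M}$, with $t=t^{\mathcal M}$, be the integers $p$ with $\mathcal T^{p+1}(\mathcal M)\ne\mathcal T^p(\mathcal M)$, and let $s_\mu=s_\mu^{\mathcal M}=\dim_K\mathcal T^{p}(\mathcal M)/\mathcal T^{p+1}(\mathcal M)$ for $p=i_\mu^{\mathcal M}$. A period matrix $X=(X^+\;X^-)$ of $\mathcal M$ is the matrix of $I^0(\mathcal M)$ with respect to $E^\sigma$-bases of $\mathcal B^+(\mathcal M)$ and $\mathcal B^-(\mathcal M)$ (in this order) and a $K$-basis $\omega_1,\dots,\omega_{d_*}$ of $\mathcal T(\mathcal M)$ such that $\{\omega_j: j>s_1+\dots+s_{\mu-1}\}$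 is a basis of $\mathcal T^p(\mathcal M)$ with $p=i_\mu^{\mathcal M}$, for every $\mu$. The weight of row $j$ of $X$ is $w^{\mathcal M}(j)=i^{\mathcal M}_\mu$ if $s_1+\dots+s_{\mu-1}<j\le s_1+\dots+s_\mu$. The period $c^\pm_{(\tau,\sigma)}(\mathcal M)$ is the determinant formed by the first $d_*^\pm(\mathcal M)$ rows of $X^\pm$, for any choice of bases. For two motives $\mathcal M,\mathcal N$ as above put $$c^\pm_{(\tau,\sigma)}(\mathcal M,\mathcal N)=\begin{cases}c^\pm_{(\tau,\sigma)}(\mathcal M\otimes_{\mathsf F}\mathcal N)&\tau\text{ real},\\ c^\pm_{(\tau,\sigma)}(\mathcal M\otimes_{\mathsf F}\mathcal N)\;c^\pm_{(\iota_0,\sigma)}(\mathcal M^{[\tau]}\otimes_{\mathsf F^{(\tau,\rho)}}\mathcal N^{[\rho\tau]})&\tau\text{ complex},\end{cases}$$ where $\mathcal M^{[\tau]},\mathcal N^{[\rho\tau]}$ are the extensions of scalars along $\tau,\rho\tau:\mathsf F\to\mathsf F^{(\tau,\rho)}$ and $\iota_0:\mathsf F^{(\tau,\rho)}\hookrightarrow\mathbf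 C$ is the inclusion. Let $(\mathcal B^{\mathcal M,\mathcal N})^\pm$ be the $(\pm1)$-eigenspaces of $F^{\mathcal M}\otimes F^{\mathcal N}$ on $\mathcal B(\mathcal M)\otimes_{E^\sigma}\mathcal B(\mathcal N)$, and $\mathrm{Fil}^p(\mathcal T^{\mathcal M,\mathcal N})=\sum_{m+n=p}\mathcal T^m(\mathcal M)\otimes\mathcal T^n(\mathcal N)$ the filtration of $\mathcal T^{\mathcal M,\mathcal N}=\mathcal T(\mathcal M)\otimes_K\mathcal T(\mathcal N)$. For $a,b\in\mathbf C$ write $a\sim_K b$ if $a=bc$ with $c\in K^\times$. **Types.** Let $\mathsf d=s_1+\dots+s_t=\mathsf d^++\mathsf d^-$ be partitions with $s_\mu\geq 1$, $\mathsf d^\pm\ge0$, and let $a_1,\dots,a_t,k^+,k^-\geq 0$ be integers. A polynomial function $f$ with rational coefficients on ${\rm M}_{\mathsf d}(\mathbf C)$ is of type $\{(a_1,\dots,a_t);(k^+,k^-)\}$ if $$f\left(p\,x\begin{pmatrix}h_+&\\&h_-\end{pmatrix}\right)=\Bigl(\prod_\mu\det(p_{\mu\mu})^{a_\mu}\Bigr)\det(h_+)^{k^+}\det(h_-)^{k^-}f(x)$$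 for all $x$, all invertible lower block triangular $p$ with diagonal blocks $p_{\mu\mu}$ of sizes $s_\mu$, and all $h_\pm\in{\rm GL}_{\mathsf d^\pm}(\mathbf C)$. The type is admissible if there are $0\le t^\pm\le t$ with $s_1+\dots+s_{t^\pm}=\mathsf d^\pm$ such that: $a_1\ge\dots\ge a_t$; $a_i+a_{t+1-i}=k^++k^-$ for $1\le i\le\min\{t^+,t^-\}$; $a_{t^+}\ge k^+$ and $k^-\ge a_{t^++1}$; $a_{\min\{t^+,t^-\}}\ge\max\{k^+,k^-\}$ and $\min\{k^+,k^-\}\ge a_{\max\{t^+,t^-\}+1}$; $a_i=k^+$ for $t^-<i\le t^+$; $a_i=k^-$ for $t^+<i\le t^-$ (inequalities involving $a_0$ or $a_{t+1}$ being omitted). **Proposition 4.1.** Let $\mathcal M,\mathcal N$ be as above, fix a sign $\pm$, and suppose that, for this sign, condition $({\rm Fil}^\mp)_{\tau,\sigma}$ holds: there is an integer $q^\mp$ such that $I^0(\mathcal M)\otimes I^0(\mathcal N)$ induces an isomorphism $$(\mathcal B^{\mathcal M,\mathcal N})^\pm\otimes_{E^\sigma}\mathbf C\;\xrightarrow{\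 \sim\ }\;\bigl(\mathcal T^{\mathcal M,\mathcal N}/\mathrm{Fil}^{q^\mp}(\mathcal T^{\mathcal M,\mathcal N})\bigr)\otimes_K\mathbf C .$$ Let $q^\mp$ be any such integer. Then there exist nonzero polynomial functions with rational coefficients, $\phi^\pm$ on ${\rm M}_{d_*(\mathcal M)}(\mathbf C)$ and $\psi^\pm$ on ${\rm M}_{d_*(\mathcal N)}(\mathbf C)$, such that $$c^\pm_{(\tau,\sigma)}(\mathcal M,\mathcal N)\sim_K\phi^\pm(X)\,\psi^\pm(Y)$$ for all values of $c^\pm_{(\tau,\sigma)}(\mathcal M,\mathcal N)$ and all period matrices $X$ of $\mathcal M$ and $Y$ of $\mathcal N$. With respect to the partitions $(s^{\mathcal M}_\mu)$, $(d^+_*(\mathcal M),d^-_*(\mathcal M))$ and $(s^{\mathcal N}_\nu)$, $(d^+_*(\mathcal N),d^-_*(\mathcal N))$, $\phi^\pm$ is of admissible type $\{(a_\mu^{(\pm)});(k^{(\pm),+},k^{(\pm),-})\}$ and $\psi^\pm$ is of admissible type $\{(b_\nu^{(\pm)});(l^{(\pm),+},l^{(\pm),-})\}$, where $$a_\mu^{(\pm)}=\#\{1\le\lambda\le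 d_*(\mathcal N): i^{\mathcal M}_\mu+w^{\mathcal N}(\lambda)<q^\mp\},\qquad b_\nu^{(\pm)}=\#\{1\le\lambda\le d_*(\mathcal M): i^{\mathcal N}_\nu+w^{\mathcal M}(\lambda)<q^\mp\},$$ $$k^{(\pm),+}=d_*^\pm(\mathcal N),\quad k^{(\pm),-}=d_*^\mp(\mathcal N),\quad l^{(\pm),+}=d_*^\pm(\mathcal M),\quad l^{(\pm),-}=d_*^\mp(\mathcal M),$$ and these types characterize $\phi^\pm$ and $\psi^\pm$ up to constants: every polynomial function with rational coefficients of the same type is a rational multiple of $\phi^\pm$, respectively $\psi^\pm$. -/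

import Mathlib

open scoped TensorProduct
open NumberField

noncomputable section

namespace YoshidaPeriods

universe uR uS uT uV uW uF uE uG uB uD

/-! ### Extension of scalars along a ring homomorphism -/

section BaseChange

variable {R : Type uR} {S : Type uS} {T : Type uT} [CommRing R] [CommRing S] [CommRing T]

/-- `V ⊗_{R, f} S`, the extension of scalars of the `R`-module `V` along `f : R → S`. -/
def BaseChange (f : R →+* S) (V : Type uV) [AddCommGroup V] [Module R V] : Type (max uS uV) :=
  letI := f.toAlgebra
  S ⊗[R] V

variable (f : R →+* S) (g : S →+* T) (h : R →+* T)
variable {V : Type uV} {W : Type uW} [AddCommGroup V] [Module R V] [AddCommGroup W] [Module R W]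

instance : AddCommGroup (BaseChange f V) :=
  letI := f.toAlgebra
  (inferInstance : AddCommGroup (S ⊗[R] V))

instance : Module S (BaseChange f V) :=
  letI := f.toAlgebra
  (inferInstance : Module S (S ⊗[R] V))

namespace BaseChange

/-- The canonical map `v ↦ v ⊗ 1`. -/
def incl : V →ₛₗ[f] BaseChange f V :=
  letI := f.toAlgebra
  { toFun := fun v => (1 : S) ⊗ₜ[R] v
    map_add' := fun v w => TensorProduct.tmul_add _ v w
    map_smul' := fun r v => by
      change (1 : S) ⊗ₜ[R] (r • v) = (f r • (1 : S)) ⊗ₜ[R] v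
      rw [← TensorProduct.smul_tmul]
      rfl }

/-- Functoriality: `φ ⊗ id`. -/
def map (φ : V →ₗ[R] W) : BaseChange f V →ₗ[S] BaseChange f W :=
  letI := f.toAlgebra
  LinearMap.baseChange S φ

/-- `(V ⊗_R W) ⊗_{R, f} S = (V ⊗_{R, f} S) ⊗_S (W ⊗_{R, f} S)`. -/
def tensorEquiv : BaseChange f (V ⊗[R] W) ≃ₗ[S] BaseChange f V ⊗[S] BaseChange f W :=
  letI := f.toAlgebra
  TensorProduct.AlgebraTensorModule.distribBaseChange R S V W

/-- Transitivity: `V ⊗_{R, g ∘ f} T = (V ⊗_{R, f} S) ⊗_{S, g} T`. -/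
def trans (H : h = g.comp f) : BaseChange h V ≃ₗ[T] BaseChange g (BaseChange f V) :=
  letI := f.toAlgebra
  letI := g.toAlgebra
  letI := h.toAlgebra
  haveI : IsScalarTower R S T := IsScalarTower.of_algebraMap_eq' H
  (TensorProduct.AlgebraTensorModule.cancelBaseChange R S T T V).symm

/-- The `g`-semilinear map `v ⊗ s ↦ v ⊗ g s` from `V ⊗_{R, f} S` to `V ⊗_{R, g ∘ f} T`. -/
def push (H : h = g.comp f) : BaseChange f V →ₛₗ[g] BaseChange h V :=
  (trans f g h H).symm.toLinearMap.comp (incl g)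

/-- The image of `P ⊗_{R, f} S` in `V ⊗_{R, f} S` for a submodule `P` of `V`. -/
def sub (P : Submodule R V) : Submodule S (BaseChange f V) :=
  Submodule.span S (incl f '' (P : Set V))

theorem sub_bot : sub f (⊥ : Submodule R V) = ⊥ := by
  rw [sub, Submodule.span_eq_bot]
  rintro _ ⟨v, hv, rfl⟩
  rw [(Submodule.mem_bot R).1 hv, map_zero]

theorem sub_mono {P Q : Submodule R V} (hPQ : P ≤ Q) : sub f P ≤ sub f Q :=
  Submodule.span_mono (Set.image_mono hPQ)

theorem sub_top : sub f (⊤ : Submodule R V) = ⊤ := by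
  let := f.toAlgebra
  rw [eq_top_iff]
  rintro x -
  change S ⊗[R] V at x
  induction x using TensorProduct.induction_on with
  | zero => exact Submodule.zero_mem _
  | tmul s v =>
    have : (s ⊗ₜ[R] v : S ⊗[R] V) = s • ((1 : S) ⊗ₜ[R] v) := by
      rw [TensorProduct.smul_tmul', smul_eq_mul, mul_one]
    rw [this]
    exact Submodule.smul_mem _ s (Submodule.subset_span ⟨v, trivial, rfl⟩)
  | add x y hx hy => exact Submodule.add_mem _ hx hy

end BaseChange

end BaseChange

/-! ### Embeddings -/

section Embeddings

variable {F : Type uF} {E : Type uE} {G : Type uG}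
  [Field F] [CharZero F] [Field E] [CharZero E] [Field G] [CharZero G]

/-- `σ ⊗ τ : E ⊗_ℚ F → L`, `x ⊗ y ↦ σ x * τ y`. -/
def pairing {L : Type uT} [Field L] [CharZero L] (σ : E →+* L) (τ : F →+* L) :
    E ⊗[ℚ] F →+* L :=
  (Algebra.TensorProduct.lift σ.toRatAlgHom τ.toRatAlgHom fun _ _ => Commute.all _ _).toRingHom

theorem pairing_tmul {L : Type uT} [Field L] [CharZero L] (σ : E →+* L) (τ : F →+* L)
    (x : E) (y : F) : pairing σ τ (x ⊗ₜ y) = σ x * τ y :=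
  Algebra.TensorProduct.lift_tmul _ _ _ x y

theorem ringHom_tensor_ext {A : Type uT} [CommRing A] {f g : E ⊗[ℚ] F →+* A}
    (H : ∀ x y, f (x ⊗ₜ y) = g (x ⊗ₜ y)) : f = g := by
  refine RingHom.ext fun z => ?_
  induction z using TensorProduct.induction_on with
  | zero => rw [map_zero, map_zero]
  | tmul x y => exact H x y
  | add x y hx hy => rw [map_add, map_add, hx, hy]

theorem pairing_comp {L : Type uT} {L' : Type uS} [Field L] [CharZero L] [Field L'] [CharZero L']
    (g : L →+* L') (σ : E →+* L) (τ : F →+* L) :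
    pairing (g.comp σ) (g.comp τ) = g.comp (pairing σ τ) :=
  ringHom_tensor_ext fun x y => by
    simp only [pairing_tmul, RingHom.comp_apply, map_mul]

/-- `id ⊗ g : E ⊗_ℚ F → E ⊗_ℚ G`. -/
def idTensor (g : F →+* G) : E ⊗[ℚ] F →+* E ⊗[ℚ] G :=
  (Algebra.TensorProduct.map (AlgHom.id ℚ E) g.toRatAlgHom).toRingHom

theorem pairing_idTensor {L : Type uT} [Field L] [CharZero L] (g : F →+* G)
    (σ : E →+* L) (τ : G →+* L) : pairing σ (τ.comp g) = (pairing σ τ).comp (idTensor g) :=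
  ringHom_tensor_ext fun x y => by
    rw [RingHom.comp_apply, pairing_tmul]
    exact (pairing_tmul σ τ x (g y)).symm

/-- The set `{τ, ρτ}`: one element if `τ` is real and two if `τ` is complex. -/
abbrev Orbit (τ : F →+* ℂ) : Type uF :=
  {τ' : F →+* ℂ // τ' = τ ∨ τ' = ComplexEmbedding.conjugate τ}

/-- Complex conjugation on `{τ, ρτ}`. -/
def Orbit.conj {τ : F →+* ℂ} (τ' : Orbit τ) : Orbit τ :=
  ⟨ComplexEmbedding.conjugate τ'.1, by
    rcases τ'.2 with h | h
    · exact Or.inr (by rw [h])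
    · exact Or.inl (by rw [h]; exact star_star τ)⟩

theorem Orbit.eq_conjugate_conj {F : Type uF} [Field F] {τ : F →+* ℂ} (τ' : Orbit τ) :
    τ'.1 = ComplexEmbedding.conjugate τ'.conj.1 :=
  (star_star τ'.1).symm

/-- The field `F^{(τ, ρ)} = τ(F) ρτ(F)`. -/
abbrev conjField (τ : F →+* ℂ) : Subfield ℂ :=
  τ.fieldRange ⊔ (ComplexEmbedding.conjugate τ).fieldRange

/-- The field `E^σ F^{(τ, ρ)} = σ(E) τ(F) ρτ(F)`. -/
abbrev periodField (τ : F →+* ℂ) (σ : E →+* ℂ) : Subfield ℂ :=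
  σ.fieldRange ⊔ conjField τ

theorem Orbit.mem_conjField {F : Type uF} [Field F] {τ : F →+* ℂ} (τ' : Orbit τ) (y : F) : τ'.1 y ∈ conjField τ := by
  rcases τ' with ⟨τ', rfl | rfl⟩
  · exact (le_sup_left : _ ≤ conjField _) ⟨y, rfl⟩
  · exact (le_sup_right : _ ≤ conjField _) ⟨y, rfl⟩

/-- An element of `{τ, ρτ}` regarded as an embedding of `F` into `τ(F) ρτ(F)`. -/
def Orbit.toConjField {τ : F →+* ℂ} (τ' : Orbit τ) : F →+* conjField τ :=
  τ'.1.codRestrict (conjField τ) τ'.mem_conjField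

/-- `σ ⊗ τ'` with values in `E^σ F^{(τ, ρ)}`, for `τ' ∈ {τ, ρτ}`. -/
def pairingField {τ : F →+* ℂ} (σ : E →+* ℂ) (τ' : Orbit τ) :
    E ⊗[ℚ] F →+* periodField τ σ :=
  pairing
    (σ.codRestrict (periodField τ σ) fun x => (le_sup_left : _ ≤ periodField τ σ) ⟨x, rfl⟩)
    (τ'.1.codRestrict (periodField τ σ) fun y =>
      (le_sup_right : _ ≤ periodField τ σ) (τ'.mem_conjField y))

theorem pairing_eq_pairingField {τ : F →+* ℂ} (σ : E →+* ℂ) (τ' : Orbit τ) :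
    pairing σ τ'.1 = (periodField τ σ).subtype.comp (pairingField σ τ') := by
  rw [pairingField, ← pairing_comp]
  rfl

theorem pairing_conjugate (σ : E →+* ℂ) (τ τ' : F →+* ℂ)
    (h : τ' = ComplexEmbedding.conjugate τ) :
    pairing (ComplexEmbedding.conjugate σ) τ' = (starRingEnd ℂ).comp (pairing σ τ) := by
  rw [h, ← pairing_comp]
  rfl

end Embeddings

/-! ### Realizations of motives -/

/-- Betti and de Rham realizations, over the number field `F` and with coefficients in the number
field `E`, together with the structures from which periods are formed. Since
`E ⊗_ℚ ℂ = ∏_σ ℂ`, the comparison isomorphisms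
`I_τ : H_B(M_τ) ⊗_ℚ ℂ ≃ H_dR(M) ⊗_{F, τ} ℂ` of `E ⊗_ℚ ℂ`-modules are given by their components
`I_{τ, σ}`. -/
structure Realization (F : Type uF) (E : Type uE) [Field F] [CharZero F] [Field E] [CharZero E] where
  /-- The Betti realizations `H_B(M_τ)`. -/
  HB : (F →+* ℂ) → Type uB
  [addCommGroupHB : ∀ τ, AddCommGroup (HB τ)]
  [moduleHB : ∀ τ, Module E (HB τ)]
  /-- The de Rham realization. -/
  HdR : Type uD
  [addCommGroupHdR : AddCommGroup HdR]
  [moduleHdR : Module (E ⊗[ℚ] F) HdR]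
  /-- `F_{∞, τ} : H_B(M_τ) ≃ H_B(M_{ρτ})`. -/
  Finf : ∀ τ τ' : F →+* ℂ, τ' = ComplexEmbedding.conjugate τ → HB τ ≃ₗ[E] HB τ'
  Finf_symm : ∀ τ τ' h h', (Finf τ τ' h).symm = Finf τ' τ h'
  /-- The Hodge filtration. -/
  Fil : ℤ → Submodule (E ⊗[ℚ] F) HdR
  Fil_antitone : Antitone Fil
  Fil_exhaustive : ∃ a, Fil a = ⊤
  Fil_separated : ∃ b, Fil b = ⊥
  /-- The comparison isomorphisms `I_{τ, σ}`. -/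
  comparison : ∀ (τ : F →+* ℂ) (σ : E →+* ℂ),
    BaseChange σ (HB τ) ≃ₗ[ℂ] BaseChange (pairing σ τ) HdR

attribute [instance] Realization.addCommGroupHB Realization.moduleHB
  Realization.addCommGroupHdR Realization.moduleHdR

section Operations

variable {F : Type uF} {E : Type uE} {G : Type uG}
  [Field F] [CharZero F] [Field E] [CharZero E] [Field G] [CharZero G]

/-- The tensor product `M ⊗_F N` (with coefficients in `E`), with the usual tensor product
filtration `Fil^p = ∑_{m + n = p} Fil^m ⊗ Fil^n`. -/
def Realization.tensor (M N : Realization.{uF, uE, uB, uD} F E) :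
    Realization.{uF, uE, uB, uD} F E where
  HB τ := M.HB τ ⊗[E] N.HB τ
  HdR := M.HdR ⊗[E ⊗[ℚ] F] N.HdR
  Finf τ τ' h := TensorProduct.congr (M.Finf τ τ' h) (N.Finf τ τ' h)
  Finf_symm τ τ' h h' := by
    rw [← M.Finf_symm τ τ' h h', ← N.Finf_symm τ τ' h h']
    rfl
  Fil p := ⨆ (m : ℤ) (n : ℤ) (_ : m + n = p),
    Submodule.map₂ (TensorProduct.mk (E ⊗[ℚ] F) M.HdR N.HdR) (M.Fil m) (N.Fil n)
  Fil_antitone p p' hp := by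
    refine iSup_le fun m => iSup_le fun n => iSup_le fun hmn => ?_
    refine le_iSup_of_le (m - (p' - p)) (le_iSup_of_le n (le_iSup_of_le (by omega) ?_))
    exact Submodule.map₂_le_map₂_left (M.Fil_antitone (by omega))
  Fil_exhaustive := by
    obtain ⟨a, ha⟩ := M.Fil_exhaustive
    obtain ⟨b, hb⟩ := N.Fil_exhaustive
    refine ⟨a + b, top_le_iff.1 ?_⟩
    refine le_iSup_of_le a (le_iSup_of_le b (le_iSup_of_le rfl ?_))
    rw [ha, hb, TensorProduct.map₂_mk_top_top_eq_top]
  Fil_separated := by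
    obtain ⟨a, ha⟩ := M.Fil_separated
    obtain ⟨b, hb⟩ := N.Fil_separated
    refine ⟨a + b, le_bot_iff.1 ?_⟩
    refine iSup_le fun m => iSup_le fun n => iSup_le fun hmn => ?_
    rcases le_total a m with h | h
    · have : M.Fil m = ⊥ := le_bot_iff.1 (ha ▸ M.Fil_antitone h)
      rw [this, Submodule.map₂_bot_left]
    · have : N.Fil n = ⊥ := le_bot_iff.1 (hb ▸ N.Fil_antitone (show b ≤ n by omega))
      rw [this, Submodule.map₂_bot_right]
  comparison τ σ := BaseChange.tensorEquiv σ ≪≫ₗ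
    TensorProduct.congr (M.comparison τ σ) (N.comparison τ σ) ≪≫ₗ
    (BaseChange.tensorEquiv (pairing σ τ)).symm

/-- The extension of scalars of `M` from `F` to `G` along `g : F → G`. -/
def Realization.extend (M : Realization.{uF, uE, uB, uD} F E) (g : F →+* G) :
    Realization.{uG, uE, uB, max uE uG uD} G E where
  HB τ := M.HB (τ.comp g)
  HdR := BaseChange (idTensor (E := E) g) M.HdR
  Finf τ τ' h := M.Finf (τ.comp g) (τ'.comp g) (by rw [h, ComplexEmbedding.conjugate_comp])
  Finf_symm _ _ _ _ := M.Finf_symm _ _ _ _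
  Fil p := BaseChange.sub _ (M.Fil p)
  Fil_antitone _ _ h := BaseChange.sub_mono _ (M.Fil_antitone h)
  Fil_exhaustive := by
    obtain ⟨a, ha⟩ := M.Fil_exhaustive
    exact ⟨a, by rw [ha, BaseChange.sub_top]⟩
  Fil_separated := by
    obtain ⟨b, hb⟩ := M.Fil_separated
    exact ⟨b, by rw [hb, BaseChange.sub_bot]⟩
  comparison τ σ := M.comparison (τ.comp g) σ ≪≫ₗ
    BaseChange.trans (idTensor g) (pairing σ τ) (pairing σ (τ.comp g)) (pairing_idTensor g σ τ)

end Operations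

/-- The Hodge-de Rham realization of a pure motive over `F` with coefficients in `E`, of weight
`weight` and rank `rank`. The component in `H_B(M_τ) ⊗_{E, σ} ℂ` of the Hodge summand `H^{p, q}`
with `q = weight - p` is `hodge τ σ p`. -/
structure PureMotive (F : Type uF) (E : Type uE) [Field F] [CharZero F] [Field E] [CharZero E]
    extends Realization.{uF, uE, uB, uD} F E where
  weight : ℤ
  rank : ℕ
  rank_pos : 0 < rank
  finrank_HB : ∀ τ, Module.finrank E (HB τ) = rank
  free_HdR : Module.Free (E ⊗[ℚ] F) HdR
  finrank_HdR : Module.finrank (E ⊗[ℚ] F) HdR = rank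
  /-- The Hodge decomposition. -/
  hodge : ∀ (τ : F →+* ℂ) (σ : E →+* ℂ), ℤ → Submodule ℂ (BaseChange σ (HB τ))
  hodge_internal : ∀ τ σ, DirectSum.IsInternal (hodge τ σ)
  /-- Complex conjugation on the coefficients `ℂ` sends `H^{p, q}` to `H^{q, p}`. -/
  hodge_conj : ∀ τ σ p, ∀ x ∈ hodge τ σ p,
    BaseChange.push σ (starRingEnd ℂ) (ComplexEmbedding.conjugate σ) rfl x ∈
      hodge τ (ComplexEmbedding.conjugate σ) (weight - p)
  /-- `F_{∞, τ} ⊗ id` sends `H^{p, q}(M_τ)` onto `H^{q, p}(M_{ρτ})`. -/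
  hodge_Finf : ∀ τ τ' h σ p,
    (hodge τ σ p).map (BaseChange.map σ (Finf τ τ' h).toLinearMap) = hodge τ' σ (weight - p)
  /-- `Fil^p ⊗ ℂ` is the image of the sum of the `H^{i, weight - i}` with `i ≥ p`. -/
  Fil_eq : ∀ τ σ p, BaseChange.sub (pairing σ τ) (Fil p) =
    (⨆ i ≥ p, hodge τ σ i).map (comparison τ σ).toLinearMap
  /-- `F_∞` combined with complex conjugation of the coefficients corresponds to complex
  conjugation of the coefficients of the de Rham realization. -/
  comparison_conj : ∀ τ τ' h σ x,
    comparison τ' (ComplexEmbedding.conjugate σ)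
        (BaseChange.map (ComplexEmbedding.conjugate σ) (Finf τ τ' h).toLinearMap
          (BaseChange.push σ (starRingEnd ℂ) (ComplexEmbedding.conjugate σ) rfl x)) =
      BaseChange.push (pairing σ τ) (starRingEnd ℂ) (pairing (ComplexEmbedding.conjugate σ) τ')
        (pairing_conjugate σ τ τ' h) (comparison τ σ x)

/-- If the weight `w` is even, `F_∞ ⊗ id` acts on
`⨁_τ H^{w/2, w/2}(M_τ) = H^{w/2, w/2}(Res_{F/ℚ} M)` as multiplication by a scalar. -/
def PureMotive.MiddleScalar {F : Type uF} {E : Type uE} [Field F] [CharZero F] [Field E]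
    [CharZero E] (M : PureMotive.{uF, uE, uB, uD} F E) : Prop :=
  ∀ p : ℤ, 2 * p = M.weight → ∃ c : ℂ, ∀ (σ : E →+* ℂ) (x : ∀ τ, BaseChange σ (M.HB τ)),
    (∀ τ, x τ ∈ M.hodge τ σ p) →
      ∀ τ τ' h, BaseChange.map σ (M.Finf τ τ' h).toLinearMap (x τ) = c • x τ'

/-! ### The rational structures and the period matrix -/

namespace Realization

variable {F : Type uF} {E : Type uE} [Field F] [CharZero F] [Field E] [CharZero E]
variable (M N : Realization.{uF, uE, uB, uD} F E) (τ : F →+* ℂ) (σ : E →+* ℂ)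

/-- The `E^σ`-vector space `B_σ(M_τ)`: the (direct) product over `τ' ∈ {τ, ρτ}` of
`H_B(M_{τ'}) ⊗_{E, σ} E^σ`. -/
def B :=
  ∀ τ' : Orbit τ, BaseChange σ.rangeRestrictField (M.HB τ'.1)

instance : AddCommGroup (M.B τ σ) :=
  inferInstanceAs (AddCommGroup (∀ τ' : Orbit τ, BaseChange σ.rangeRestrictField (M.HB τ'.1)))

instance : Module σ.fieldRange (M.B τ σ) :=
  inferInstanceAs (Module σ.fieldRange (∀ τ' : Orbit τ, BaseChange σ.rangeRestrictField (M.HB τ'.1)))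

/-- `B_σ(M_τ) ⊗ ℂ`. -/
def BC :=
  ∀ τ' : Orbit τ, BaseChange σ (M.HB τ'.1)

instance : AddCommGroup (M.BC τ σ) :=
  inferInstanceAs (AddCommGroup (∀ τ' : Orbit τ, BaseChange σ (M.HB τ'.1)))

instance : Module ℂ (M.BC τ σ) :=
  inferInstanceAs (Module ℂ (∀ τ' : Orbit τ, BaseChange σ (M.HB τ'.1)))

/-- The `E^σ F^{(τ, ρ)}`-vector space `T_{τ, σ}(M)`: the product over `τ' ∈ {τ, ρτ}` of
`H_dR(M) ⊗_{E ⊗ F, σ ⊗ τ'} E^σ F^{(τ, ρ)}`. -/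
def T :=
  ∀ τ' : Orbit τ, BaseChange (pairingField σ τ') M.HdR

instance : AddCommGroup (M.T τ σ) :=
  inferInstanceAs (AddCommGroup (∀ τ' : Orbit τ, BaseChange (pairingField σ τ') M.HdR))

instance : Module (periodField τ σ) (M.T τ σ) :=
  inferInstanceAs (Module (periodField τ σ) (∀ τ' : Orbit τ, BaseChange (pairingField σ τ') M.HdR))

/-- `T_{τ, σ}(M) ⊗ ℂ`. -/
def TC :=
  ∀ τ' : Orbit τ, BaseChange (pairing σ τ'.1) M.HdR

instance : AddCommGroup (M.TC τ σ) :=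
  inferInstanceAs (AddCommGroup (∀ τ' : Orbit τ, BaseChange (pairing σ τ'.1) M.HdR))

instance : Module ℂ (M.TC τ σ) :=
  inferInstanceAs (Module ℂ (∀ τ' : Orbit τ, BaseChange (pairing σ τ'.1) M.HdR))

/-- `B_σ(M_τ) → B_σ(M_τ) ⊗ ℂ`. -/
def inclB : M.B τ σ →ₗ[σ.fieldRange] M.BC τ σ where
  toFun x τ' := BaseChange.push σ.rangeRestrictField σ.fieldRange.subtype σ rfl (x τ')
  map_add' x y := by
    funext τ'
    exact map_add _ _ _
  map_smul' r x := by
    funext τ'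
    exact LinearMap.map_smulₛₗ _ _ _

/-- `T_{τ, σ}(M) → T_{τ, σ}(M) ⊗ ℂ`. -/
def inclT : M.T τ σ →ₗ[periodField τ σ] M.TC τ σ where
  toFun x τ' := BaseChange.push (pairingField σ τ') (periodField τ σ).subtype (pairing σ τ'.1)
    (pairing_eq_pairingField σ τ') (x τ')
  map_add' x y := by
    funext τ'
    exact map_add _ _ _
  map_smul' r x := by
    funext τ'
    exact LinearMap.map_smulₛₗ _ _ _

/-- The involution `F_{τ, σ}^M` on `B_σ(M_τ)`, induced by `F_∞`. -/
def involution : M.B τ σ →ₗ[σ.fieldRange] M.B τ σ where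
  toFun x τ' := BaseChange.map σ.rangeRestrictField
    (M.Finf τ'.conj.1 τ'.1 τ'.eq_conjugate_conj).toLinearMap (x τ'.conj)
  map_add' x y := by
    funext τ'
    exact map_add _ _ _
  map_smul' r x := by
    funext τ'
    exact LinearMap.map_smul _ _ _

/-- The eigenspaces `B_σ^±(M_τ)`; the sign is an element `ε = ±1` of `ℤˣ`. -/
def Bsign (ε : ℤˣ) : Submodule σ.fieldRange (M.B τ σ) :=
  Module.End.eigenspace (M.involution τ σ) ((ε : ℤ) : σ.fieldRange)

/-- The Hodge filtration `T_{τ, σ}^p(M)`. -/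
def TFil (p : ℤ) : Submodule (periodField τ σ) (M.T τ σ) where
  carrier := {x | ∀ τ', x τ' ∈ BaseChange.sub (pairingField σ τ') (M.Fil p)}
  zero_mem' _ := Submodule.zero_mem _
  add_mem' hx hy τ' := Submodule.add_mem _ (hx τ') (hy τ')
  smul_mem' r _ hx τ' := Submodule.smul_mem _ r (hx τ')

theorem TFil_congr {p p' : ℤ} (h : M.Fil p = M.Fil p') : M.TFil τ σ p = M.TFil τ σ p' := by
  ext x
  change (∀ τ', x τ' ∈ BaseChange.sub (pairingField σ τ') (M.Fil p)) ↔
    ∀ τ', x τ' ∈ BaseChange.sub (pairingField σ τ') (M.Fil p')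
  rw [h]

/-- The comparison isomorphism `I^0_{τ, σ}(M)`. -/
def I0 : M.BC τ σ ≃ₗ[ℂ] M.TC τ σ where
  toFun x τ' := M.comparison τ'.1 σ (x τ')
  invFun y τ' := (M.comparison τ'.1 σ).symm (y τ')
  left_inv x := by
    funext τ'
    exact LinearEquiv.symm_apply_apply _ _
  right_inv y := by
    funext τ'
    exact LinearEquiv.apply_symm_apply _ _
  map_add' x y := by
    funext τ'
    exact map_add _ _ _
  map_smul' r x := by
    funext τ'
    exact LinearEquiv.map_smul _ _ _

/-- `d_*(M)`. -/
def dStar : ℕ := Module.finrank (periodField τ σ) (M.T τ σ)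

/-- `d_*^±(M_τ)`. -/
def dSign (ε : ℤˣ) : ℕ := Module.finrank σ.fieldRange (M.Bsign τ σ ε)

/-- The integers at which the Hodge filtration of `T_{τ, σ}(M)` jumps. -/
def jumpSet : Set ℤ := {p | M.TFil τ σ (p + 1) ≠ M.TFil τ σ p}

theorem jumpSet_finite : (M.jumpSet τ σ).Finite := by
  obtain ⟨a, ha⟩ := M.Fil_exhaustive
  obtain ⟨b, hb⟩ := M.Fil_separated
  refine (Set.finite_Icc a b).subset fun p hp => ?_
  by_contra hcon
  apply hp
  rw [Set.mem_Icc, not_and_or, not_le, not_le] at hcon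
  rcases hcon with h | h
  · have h1 : M.Fil p = ⊤ := top_le_iff.1 (ha ▸ M.Fil_antitone h.le)
    have h2 : M.Fil (p + 1) = ⊤ := top_le_iff.1 (ha ▸ M.Fil_antitone (by omega))
    rw [TFil_congr M τ σ (h2.trans h1.symm)]
  · have h1 : M.Fil p = ⊥ := le_bot_iff.1 (hb ▸ M.Fil_antitone h.le)
    have h2 : M.Fil (p + 1) = ⊥ := le_bot_iff.1 (hb ▸ M.Fil_antitone (by omega))
    rw [TFil_congr M τ σ (h2.trans h1.symm)]

/-- The number of jumps of the Hodge filtration of `T_{τ, σ}(M)`. -/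
def numJumps : ℕ := (M.jumpSet_finite τ σ).toFinset.card

/-- The jumps in increasing order (indexed from `0`). -/
def jump (μ : Fin (M.numJumps τ σ)) : ℤ :=
  (M.jumpSet_finite τ σ).toFinset.orderEmbOfFin rfl μ

/-- The dimensions of the graded pieces. -/
def grDim (μ : Fin (M.numJumps τ σ)) : ℕ :=
  Module.finrank (periodField τ σ) (M.TFil τ σ (M.jump τ σ μ)) -
    Module.finrank (periodField τ σ) (M.TFil τ σ (M.jump τ σ μ + 1))

end Realization

/-- `s_1 + ⋯ + s_n` (with `s_1 = s 0`, and so on). -/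
def partialSum {t : ℕ} (s : Fin t → ℕ) (n : ℕ) : ℕ := ∑ ν : Fin t, if (ν : ℕ) < n then s ν else 0

/-- The index `i` (counted from `0`) belongs to the `μ`-th block of the partition
`s_1 + ⋯ + s_t`. -/
abbrev InBlock {t : ℕ} (s : Fin t → ℕ) (μ : Fin t) (i : ℕ) : Prop :=
  partialSum s (μ : ℕ) ≤ i ∧ i < partialSum s ((μ : ℕ) + 1)

namespace Realization

variable {F : Type uF} {E : Type uE} [Field F] [CharZero F] [Field E] [CharZero E]
variable (M N : Realization.{uF, uE, uB, uD} F E) (τ : F →+* ℂ) (σ : E →+* ℂ)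

/-- Matrices with `d_*` rows whose columns are grouped into `d_*^+` columns of sign `+1` and
`d_*^-` columns of sign `-1`. -/
abbrev PMatrix : Type :=
  Matrix (Fin (M.dStar τ σ)) ((ε : ℤˣ) × Fin (M.dSign τ σ ε)) ℂ

/-- `X` is the `(τ, σ)`-period matrix of `M` with respect to some choice of bases `u^±` of
`B_σ^±(M_τ)` over `E^σ` and of a basis `ω` of `T_{τ, σ}(M)` over `E^σ F^{(τ, ρ)}` that is
adapted to the Hodge filtration. -/
def IsPeriodMatrix (X : M.PMatrix τ σ) : Prop :=
  ∃ (u : ∀ ε : ℤˣ, Module.Basis (Fin (M.dSign τ σ ε)) σ.fieldRange (M.Bsign τ σ ε))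
    (ω : Module.Basis (Fin (M.dStar τ σ)) (periodField τ σ) (M.T τ σ)),
    (∀ μ, M.TFil τ σ (M.jump τ σ μ) = Submodule.span (periodField τ σ)
      (ω '' {i | partialSum (M.grDim τ σ) μ ≤ i})) ∧
    ∀ ε j, M.I0 τ σ (M.inclB τ σ (u ε j : M.B τ σ)) =
      ∑ i, X i ⟨ε, j⟩ • M.inclT τ σ (ω i)

/-- `c` is a value of the period `c^±_{(τ, σ)}(M) = f^±(X)`: the minor of a period matrix `X`
formed by the first `d_*^±` rows and by the columns of sign `±`. -/
def IsPeriod (ε : ℤˣ) (c : ℂ) : Prop :=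
  ∃ X : M.PMatrix τ σ, M.IsPeriodMatrix τ σ X ∧
    c = Matrix.det (Matrix.of fun i j : Fin (M.dSign τ σ ε) =>
      if h : (i : ℕ) < M.dStar τ σ then X ⟨i, h⟩ ⟨ε, j⟩ else 0)

/-- The weight of the `i`-th row of a period matrix is `w`. -/
def HasRowWeight (i : Fin (M.dStar τ σ)) (w : ℤ) : Prop :=
  ∃ μ, InBlock (M.grDim τ σ) μ i ∧ w = M.jump τ σ μ

/-- The number of rows of a period matrix of `M` whose weight `w` satisfies `k + w < q`. -/
def countRows (k q : ℤ) : ℕ :=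
  Nat.card {i : Fin (M.dStar τ σ) // ∃ w, M.HasRowWeight τ σ i w ∧ k + w < q}

/-- `c` is a value of `c^±_{(τ, σ)}(M, N)`: the period `c^±_{(τ, σ)}(M ⊗_F N)` if `τ` is real,
and its product with
`c^±_{(ι₀, σ)}(M^{[τ]} ⊗_{F^{(τ, ρ)}} N^{[ρτ]})` if `τ` is complex, where `M^{[τ]}` and `N^{[ρτ]}`
are the extensions of scalars along `τ, ρτ : F → F^{(τ, ρ)}` and `ι₀` is the inclusion. -/
def IsPairPeriod (ε : ℤˣ) (c : ℂ) : Prop :=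
  (ComplexEmbedding.IsReal τ ∧ (M.tensor N).IsPeriod τ σ ε c) ∨
  (¬ ComplexEmbedding.IsReal τ ∧ ∃ c₁ c₂ : ℂ, c = c₁ * c₂ ∧
    (M.tensor N).IsPeriod τ σ ε c₁ ∧
    ((M.extend (Orbit.toConjField (⟨τ, Or.inl rfl⟩ : Orbit τ))).tensor
      (N.extend (Orbit.toConjField (⟨ComplexEmbedding.conjugate τ, Or.inr rfl⟩ : Orbit τ)))).IsPeriod
      (conjField τ).subtype σ ε c₂)

/-! ### The condition on the Hodge filtration of the tensor product -/

/-- `V ⊗_K W → V' ⊗_ℂ W'`, `v ⊗ w ↦ f v ⊗ g w`. -/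
def tensorIncl {K : Subfield ℂ} {V : Type uR} {W : Type uS} {V' : Type uT} {W' : Type uV}
    [AddCommGroup V] [AddCommGroup W] [AddCommGroup V'] [AddCommGroup W']
    [Module K V] [Module K W] [Module ℂ V'] [Module ℂ W']
    (f : V →ₗ[K] V') (g : W →ₗ[K] W') : V ⊗[K] W →ₗ[K] V' ⊗[ℂ] W' :=
  TensorProduct.lift (LinearMap.mk₂ K (fun v w => f v ⊗ₜ[ℂ] g w)
    (fun v v' w => by rw [map_add, TensorProduct.add_tmul])
    (fun r v w => by rw [map_smul]; rfl)
    (fun v w w' => by rw [map_add, TensorProduct.tmul_add])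
    (fun r v w => by
      rw [map_smul]
      exact TensorProduct.tmul_smul (r : ℂ) (f v) (g w)))

/-- The eigenspaces `(B^{M, N})^±` of `F^M ⊗ F^N` on `B_σ(M_τ) ⊗ B_σ(N_τ)`. -/
def pairBsign (ε : ℤˣ) : Submodule σ.fieldRange (M.B τ σ ⊗[σ.fieldRange] N.B τ σ) :=
  Module.End.eigenspace (TensorProduct.map (M.involution τ σ) (N.involution τ σ))
    ((ε : ℤ) : σ.fieldRange)

/-- The Hodge filtration of `T^{M, N} = T_{τ, σ}(M) ⊗ T_{τ, σ}(N)`. -/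
def pairFil (p : ℤ) : Submodule (periodField τ σ) (M.T τ σ ⊗[periodField τ σ] N.T τ σ) :=
  ⨆ (m : ℤ) (n : ℤ) (_ : m + n = p),
    Submodule.map₂ (TensorProduct.mk (periodField τ σ) (M.T τ σ) (N.T τ σ))
      (M.TFil τ σ m) (N.TFil τ σ n)

/-- `(B^{M, N})^± ⊗ ℂ`, inside `B^{M, N} ⊗ ℂ`. -/
def pairBsignC (ε : ℤˣ) : Submodule ℂ (M.BC τ σ ⊗[ℂ] N.BC τ σ) :=
  Submodule.span ℂ (tensorIncl (M.inclB τ σ) (N.inclB τ σ) '' (M.pairBsign N τ σ ε : Set _))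

/-- `Fil^p(T^{M, N}) ⊗ ℂ`, inside `T^{M, N} ⊗ ℂ`. -/
def pairFilC (p : ℤ) : Submodule ℂ (M.TC τ σ ⊗[ℂ] N.TC τ σ) :=
  Submodule.span ℂ (tensorIncl (M.inclT τ σ) (N.inclT τ σ) '' (M.pairFil N τ σ p : Set _))

/-- The condition `(Fil^∓)_{τ, σ}` for the sign `ε`, fulfilled by the step `Fil^q` of the
Hodge filtration: `I^0(M) ⊗ I^0(N)` induces an isomorphism of `(B^{M, N})^ε ⊗ ℂ` with
`(T^{M, N} / Fil^q) ⊗ ℂ`. -/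
def FilCondition (ε : ℤˣ) (q : ℤ) : Prop :=
  Function.Bijective
    (((M.pairFilC N τ σ q).mkQ ∘ₗ
        (TensorProduct.congr (M.I0 τ σ) (N.I0 τ σ)).toLinearMap).domRestrict
      (M.pairBsignC N τ σ ε))

end Realization

/-! ### Polynomial functions of admissible type -/

section Types

variable {t d : ℕ} (s : Fin t → ℕ) (d' : ℤˣ → ℕ) (a : Fin t → ℕ) (k : ℤˣ → ℕ)

/-- Admissibility of the type `{(a_1, …, a_t); (k^+, k^-)}` with respect to the partitions
`s_1 + ⋯ + s_t = d^+ + d^-`. Indices are shifted by one: `a ⟨n, _⟩` is `a_{n+1}`. Here `d' 1` is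
`d^+`, `d' (-1)` is `d^-`, and likewise for `k`; inequalities on `a_0` or `a_{t+1}` are void. -/
def IsAdmissible : Prop :=
  ∃ tp tm : ℕ, tp ≤ t ∧ tm ≤ t ∧ partialSum s tp = d' 1 ∧ partialSum s tm = d' (-1) ∧
    Antitone a ∧
    (∀ i : Fin t, (i : ℕ) < min tp tm → a i + a i.rev = k 1 + k (-1)) ∧
    (∀ i : Fin t, (i : ℕ) + 1 = tp → k 1 ≤ a i) ∧
    (∀ i : Fin t, (i : ℕ) = tp → a i ≤ k (-1)) ∧
    (∀ i : Fin t, (i : ℕ) + 1 = min tp tm → max (k 1) (k (-1)) ≤ a i) ∧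
    (∀ i : Fin t, (i : ℕ) = max tp tm → a i ≤ min (k 1) (k (-1))) ∧
    (∀ i : Fin t, tm ≤ (i : ℕ) → (i : ℕ) < tp → a i = k 1) ∧
    (∀ i : Fin t, tp ≤ (i : ℕ) → (i : ℕ) < tm → a i = k (-1))

/-- The value of a polynomial in the entries of a matrix. -/
def evalMatrix {m n : Type} (f : MvPolynomial (m × n) ℚ) (x : Matrix m n ℂ) : ℂ :=
  MvPolynomial.aeval (fun ij : m × n => x ij.1 ij.2) f

/-- The lower parabolic subgroup of `GL_d` attached to the partition `s`. -/
def IsLowerParabolic (p : GL (Fin d) ℂ) : Prop :=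
  ∀ (i j : Fin d) (μ ν : Fin t), InBlock s μ i → InBlock s ν j → μ < ν → (p : Matrix _ _ ℂ) i j = 0

variable {d'}

/-- The polynomial function `f` is of type `{(a_1, …, a_t); (k^+, k^-)}`. -/
def IsOfType (f : MvPolynomial (Fin d × ((ε : ℤˣ) × Fin (d' ε))) ℚ) : Prop :=
  ∀ (p : GL (Fin d) ℂ) (h : ∀ ε : ℤˣ, GL (Fin (d' ε)) ℂ)
    (x : Matrix (Fin d) ((ε : ℤˣ) × Fin (d' ε)) ℂ), IsLowerParabolic s p →
    evalMatrix f ((p : Matrix (Fin d) (Fin d) ℂ) * x *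
        Matrix.blockDiagonal' fun ε => (h ε : Matrix (Fin (d' ε)) (Fin (d' ε)) ℂ)) =
      (∏ μ, ((p : Matrix (Fin d) (Fin d) ℂ).toSquareBlockProp
          fun i => InBlock s μ i).det ^ a μ) *
        (∏ ε, (h ε : Matrix (Fin (d' ε)) (Fin (d' ε)) ℂ).det ^ k ε) * evalMatrix f x

/-- `f` is a nonzero polynomial function of the given type, the type is admissible, and it
characterizes `f` up to a constant multiple. -/
def IsCharacterizedByType (f : MvPolynomial (Fin d × ((ε : ℤˣ) × Fin (d' ε))) ℚ) : Prop :=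
  IsAdmissible s d' a k ∧ IsOfType s a k f ∧ f ≠ 0 ∧
    ∀ g : MvPolynomial (Fin d × ((ε : ℤˣ) × Fin (d' ε))) ℚ,
      IsOfType s a k g → ∃ r : ℚ, g = r • f

end Types

/-- `a ∼_K b`. -/
def SimUpTo (K : Subfield ℂ) (a b : ℂ) : Prop := ∃ r ∈ K, r ≠ 0 ∧ a = b * r

end YoshidaPeriods

end

open YoshidaPeriods

universe uF uE uB uD

open scoped TensorProduct
open NumberField

noncomputable section

universe uR uS uT uV uW uG uB' uD'

/-! Write B for the eigenspace (B^{M,N})^ε and T for T^{M,N}. The condition on `q` says that I^0(M)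
⊗ I^0(N) identifies B ⊗ ℂ with (T / Fil^q) ⊗ ℂ. The two sides carry rational structures over E^σ and
over K, so the determinant of this isomorphism is defined up to a factor in K^× (`simUpTo_det`,
`IsPairBasis.simUpTo`). It is computed in two ways.

With bases coming from tensor product motives it is the pair period. The components of T are indexed
by pairs of elements of {τ, ρτ}. If τ is real there is one pair. If τ is complex, M ⊗ N accounts for
the two equal pairs and M^{[τ]} ⊗ N^{[ρτ]} for the two mixed ones; the comparison matrix is block
diagonal and the determinant is a product of two periods (`IsPairBasis.merge`,
`IsPairPeriod.exists_isPairBasis`). That both blocks are square is a consequence: injectivity bounds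
the columns by the rows in each block, and the totals agree.

With tensor products of bases of the two factors it is `pairDet g X Y`, the minor of X ⊗ Y on the
pairs of rows of total weight less than `q` and the pairs of columns whose signs have product ε. It
is nonzero at period matrices.

The separation of X and Y comes from semi-invariance. For fixed Y the minor is multiplied, under the
parabolic group acting on the rows and the block diagonal group acting on the columns of X, by a
character that does not depend on Y (`pairDet_mul`). Lower triangular and block diagonal matrices
together already have a Zariski dense orbit through a rational point x₀ (`exists_dense_orbit`), so a
semi-invariant polynomial is determined by its character and its value at x₀. With the analogous
point y₀ for N this gives pairDet(X, Y) pairDet(x₀, y₀) = pairDet(X, y₀) pairDet(x₀, Y), and the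
factors on the right are φ and ψ (`exists_pairDet_factorization`). The same argument proves that the
types characterize them.

Admissibility uses only that the minor is square (`eq_of_card_eq`). By Hodge symmetry, equality of
the numbers of rows and columns says that a sum of differences of filtration dimensions of N, all of
one sign, is plus or minus the product of the middle Hodge numbers of M and N. The rows of M of
middle weight alone account for this amount, hence the other differences vanish. This is the
relation a_i + a_{t+1-i} = k^+ + k^-, and the inequalities follow by monotonicity. -/

section

/-! ### The tangent map of the orbit of lower triangular and block diagonal matrices -/

section OpenOrbit

/-- The reflection of `Fin d` that exchanges the first `m` and the last `m` elements and fixes the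
remaining ones. -/
def outerRev {d : ℕ} (m : ℕ) (i : Fin d) : Fin d :=
  if (i : ℕ) < m ∨ d ≤ (i : ℕ) + m then i.rev else i

theorem outerRev_outerRev {d m : ℕ} (i : Fin d) :
    outerRev m (outerRev m i) = i := by
  ext
  by_cases h : (i : ℕ) < m ∨ d ≤ (i : ℕ) + m
  · have h2 : ((i.rev : Fin d) : ℕ) < m ∨ d ≤ ((i.rev : Fin d) : ℕ) + m := by
      rw [Fin.val_rev]; omega
    rw [outerRev, outerRev, if_pos h, if_pos h2, Fin.rev_rev]
  · rw [outerRev, outerRev, if_neg h, if_neg h]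

/-- The reflection swaps the two outer segments and reverses each of them, so it inverts the order
of any two indices of which at least one is moved. Conjugation by it therefore turns a strictly
upper position into a strictly lower one, unless both indices are fixed. -/
theorem outerRev_lt {d m : ℕ} (i j : Fin d) (hij : i < j)
    (h : outerRev m i < outerRev m j) : outerRev m i = i ∧ outerRev m j = j := by
  unfold outerRev at *
  rw [Fin.lt_def] at hij
  by_cases h1 : (i : ℕ) < m ∨ d ≤ (i : ℕ) + m <;> by_cases h2 : (j : ℕ) < m ∨ d ≤ (j : ℕ) + m
  · rw [if_pos h1, if_pos h2, Fin.lt_def, Fin.val_rev, Fin.val_rev] at h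
    omega
  · rw [if_pos h1, if_neg h2, Fin.lt_def, Fin.val_rev] at h
    omega
  · rw [if_neg h1, if_pos h2, Fin.lt_def, Fin.val_rev] at h
    omega
  · exact ⟨if_neg h1, if_neg h2⟩

/-- Every square matrix is the sum of a lower triangular matrix and of a matrix that is invariant
under conjugation by `outerRev m`. -/
theorem exists_lower_add_invariant {d m : ℕ} (Y : Matrix (Fin d) (Fin d) ℂ) :
    ∃ c : Matrix (Fin d) (Fin d) ℂ, (∀ i j, c (outerRev m i) (outerRev m j) = c i j) ∧
      ∀ i j, i < j → c i j = Y i j := by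
  -- The entries above the diagonal are prescribed and then copied along the orbits of the
  -- reflection. By `outerRev_lt` the two prescriptions can meet only at a position fixed by the
  -- reflection, where they agree.
  refine ⟨fun i j => if i < j then Y i j else
    if outerRev m i < outerRev m j then Y (outerRev m i) (outerRev m j) else 0, ?_, ?_⟩
  · intro i j
    simp only [outerRev_outerRev]
    by_cases h1 : i < j
    · by_cases h2 : outerRev m i < outerRev m j
      · obtain ⟨h3, h4⟩ := outerRev_lt i j h1 h2
        simp [h1, h3, h4]
      · simp [h1, h2]
    · by_cases h2 : outerRev m i < outerRev m j
      · simp [h1, h2]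
      · simp [h1, h2]
  · intro i j h
    simp [h]

/-- A representative of the open orbit of the lower triangular group and of the group of block
diagonal matrices. -/
def orbitPoint (d : ℕ) (d' : ℤˣ → ℕ) (δ : ℤˣ) : Matrix (Fin d) ((ε : ℤˣ) × Fin (d' ε)) ℚ :=
  fun i c => (if (i : ℕ) = c.2 then 1 else 0) +
    if c.1 = δ then (if (c.2 : ℕ) < d' (-δ) ∧ (i.rev : ℕ) = c.2 then 1 else 0)
    else (if (i.rev : ℕ) = c.2 then -1 else 0)

/-- The columns of sign `δ` are symmetrized and the others antisymmetrized under the reflection of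
the rows. The middle rows belong to unpaired columns of sign `δ`, which is why the reflected entry
is added only for `c.2 < d' (-δ)`. As a matrix identity this is `J * x = x * diag(±1)`, with `J` the
permutation matrix of the reflection. -/
theorem orbitPoint_outerRev {d : ℕ} {d' : ℤˣ → ℕ} {δ : ℤˣ} (hd : d = d' δ + d' (-δ))
    (hδ : d' (-δ) ≤ d' δ) (i : Fin d) (c : (ε : ℤˣ) × Fin (d' ε)) :
    orbitPoint d d' δ (outerRev (d' (-δ)) i) c =
      (if c.1 = δ then 1 else -1) * orbitPoint d d' δ i c := by
  obtain ⟨κ, k⟩ := c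
  have hk := k.2
  unfold orbitPoint outerRev
  by_cases h : κ = δ
  · subst h
    by_cases h1 : (i : ℕ) < d' (-κ) ∨ d ≤ (i : ℕ) + d' (-κ)
    · simp only [if_true, if_pos h1, Fin.rev_rev, Fin.val_rev]
      split_ifs <;> first | (exfalso; omega) | norm_num
    · simp only [if_true, if_neg h1, one_mul]
  · have h0 : κ = -δ := by
      rcases Int.units_eq_one_or κ with h | h <;> rcases Int.units_eq_one_or δ with h' | h' <;>
        simp_all
    subst h0
    simp only [if_neg h]
    by_cases h1 : (i : ℕ) < d' (-δ) ∨ d ≤ (i : ℕ) + d' (-δ)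
    · simp only [if_pos h1, Fin.rev_rev, Fin.val_rev]
      split_ifs <;> first | (exfalso; omega) | norm_num
    · simp only [if_neg h1, Fin.val_rev]
      split_ifs <;> first | (exfalso; omega) | norm_num

/-- Paired columns give both the sum and the difference of two mirror coordinates of `v`, and
unpaired columns give a middle coordinate; as 2 is invertible, everything vanishes. Hence the orbit
point is an invertible matrix. -/
theorem orbitPoint_injective {d : ℕ} {d' : ℤˣ → ℕ} {δ : ℤˣ} (hd : d = d' δ + d' (-δ))
    (hδ : d' (-δ) ≤ d' δ) (v : Fin d → ℚ) (hv : ∀ c, ∑ i, v i * orbitPoint d d' δ i c = 0) :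
    v = 0 := by
  have h1 : ∀ k (hk : k < d' δ) , v ⟨k, by omega⟩ +
      (if k < d' (-δ) then v (Fin.rev ⟨k, by omega⟩) else 0) = 0 := by
    intro k hk
    refine Eq.trans ?_ (hv ⟨δ, k, hk⟩)
    simp only [orbitPoint, mul_add, Finset.sum_add_distrib, if_true]
    congr 1
    · rw [Finset.sum_eq_single ⟨k, by omega⟩]
      · simp
      · intro b _ hb
        rw [if_neg, mul_zero]
        exact fun h => hb (Fin.ext h)
      · simp
    · split_ifs with h
      · rw [Finset.sum_eq_single (Fin.rev ⟨k, by omega⟩)]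
        · simp [h]
        · intro b _ hb
          rw [if_neg, mul_zero]
          rintro ⟨-, h'⟩
          exact hb (Fin.rev_eq_iff.1 (Fin.ext h'))
        · simp
      · exact (Finset.sum_eq_zero fun i _ => by rw [if_neg fun h' => h h'.1, mul_zero]).symm
  have h2 : ∀ k (hk : k < d' (-δ)) , v ⟨k, by omega⟩ - v (Fin.rev ⟨k, by omega⟩) = 0 := by
    intro k hk
    have hne : (-δ : ℤˣ) ≠ δ := by
      rcases Int.units_eq_one_or δ with h | h <;> subst h <;> decide
    rw [← hv ⟨-δ, k, hk⟩]
    simp only [orbitPoint, mul_add, Finset.sum_add_distrib, if_neg hne]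
    rw [sub_eq_add_neg]
    congr 1
    · rw [Finset.sum_eq_single ⟨k, by omega⟩]
      · simp
      · intro b _ hb
        rw [if_neg, mul_zero]
        exact fun h => hb (Fin.ext h)
      · simp
    · rw [Finset.sum_eq_single (Fin.rev ⟨k, by omega⟩)]
      · simp
      · intro b _ hb
        rw [if_neg, mul_zero]
        intro h'
        exact hb (Fin.rev_eq_iff.1 (Fin.ext h'))
      · simp
  funext i
  rw [Pi.zero_apply]
  by_cases hi : (i : ℕ) < d' δ
  · have := h1 i hi
    by_cases hi' : (i : ℕ) < d' (-δ)
    · have h3 := h2 i hi'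
      rw [if_pos hi'] at this
      simp only [Fin.eta] at this h3
      linarith
    · rwa [if_neg hi', add_zero] at this
  · have hk : (i.rev : ℕ) < d' (-δ) := by rw [Fin.val_rev]; omega
    have h3 := h1 _ (lt_of_lt_of_le hk hδ)
    have h4 := h2 _ hk
    rw [if_pos hk] at h3
    simp only [Fin.eta, Fin.rev_rev] at h3 h4
    linarith

/-- This is surjectivity of the derivative of the orbit map at the identity. Conjugation by the
orbit point identifies the matrices commuting with the reflection `J` with those commuting with the
diagonal matrix of signs, that is, with the block diagonal ones. The claim is thus the decomposition
`exists_lower_add_invariant`, multiplied by the orbit point. -/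
theorem exists_lower_mul_add_mul_block {d : ℕ} {d' : ℤˣ → ℕ} {δ : ℤˣ} (hd : d = d' δ + d' (-δ))
    (hδ : d' (-δ) ≤ d' δ) (e : Fin d ≃ (ε : ℤˣ) × Fin (d' ε)) (y : Matrix (Fin d) (Fin d) ℂ) :
    ∃ ξ η : Matrix (Fin d) (Fin d) ℂ, (∀ i j, i < j → ξ i j = 0) ∧
      (∀ i j, (e i).1 ≠ (e j).1 → η i j = 0) ∧
      ξ * ((orbitPoint d d' δ).submatrix id e).map (algebraMap ℚ ℂ) +
        ((orbitPoint d d' δ).submatrix id e).map (algebraMap ℚ ℂ) * η = y := by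
  set x : Matrix (Fin d) (Fin d) ℚ := (orbitPoint d d' δ).submatrix id e with hx
  have hdet : x.det ≠ 0 := by
    intro h0
    obtain ⟨v, hv, hv'⟩ := Matrix.exists_vecMul_eq_zero_iff.2 h0
    apply hv
    refine orbitPoint_injective hd hδ v fun c => ?_
    have := congrFun hv' (e.symm c)
    simpa [hx, Matrix.vecMul, dotProduct] using this
  set x' := x.map (algebraMap ℚ ℂ) with hx'
  have hdet' : IsUnit x'.det := by
    have : x'.det = algebraMap ℚ ℂ x.det := by
      rw [RingHom.map_det]; rfl
    rw [this]
    exact (isUnit_iff_ne_zero.2 hdet).map _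
  obtain ⟨c, hc, hc'⟩ := exists_lower_add_invariant (m := d' (-δ)) (y * x'⁻¹)
  -- Decompose `y * x'⁻¹` as a lower triangular matrix plus `c`; the second term, `c * x'`, equals
  -- `x' * (x'⁻¹ * c * x')`.
  refine ⟨y * x'⁻¹ - c, x'⁻¹ * c * x', ?_, ?_, ?_⟩
  · intro i j hij
    rw [Matrix.sub_apply, hc' i j hij, sub_self]
  · set s : Fin d → ℂ := fun j => if (e j).1 = δ then 1 else -1 with hs
    set J : Matrix (Fin d) (Fin d) ℂ := fun i j => if j = outerRev (d' (-δ)) i then 1 else 0 with hJ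
    have hJx : J * x' = x' * Matrix.diagonal s := by
      ext i j
      rw [Matrix.mul_diagonal, Matrix.mul_apply]
      simp only [hJ, ite_mul, one_mul, zero_mul, Finset.sum_ite_eq', Finset.mem_univ, if_true]
      have := orbitPoint_outerRev hd hδ i (e j)
      simp only [hx', hx, Matrix.map_apply, Matrix.submatrix_apply, id]
      rw [this, hs, mul_comm]
      simp only
      split_ifs <;> simp
    have hJc : J * c = c * J := by
      ext i j
      rw [Matrix.mul_apply, Matrix.mul_apply]
      simp only [hJ, ite_mul, one_mul, zero_mul, Finset.sum_ite_eq', Finset.mem_univ, if_true]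
      rw [Finset.sum_eq_single (outerRev (d' (-δ)) j)]
      · rw [outerRev_outerRev, if_pos rfl, mul_one, ← hc i,
          outerRev_outerRev]
      · intro b _ hb
        rw [if_neg, mul_zero]
        rintro rfl
        exact hb (outerRev_outerRev b).symm
      · simp
    have hcomm : Matrix.diagonal s * (x'⁻¹ * c * x') = (x'⁻¹ * c * x') * Matrix.diagonal s := by
      have h1 : Matrix.diagonal s * x'⁻¹ = x'⁻¹ * J := by
        calc Matrix.diagonal s * x'⁻¹ = x'⁻¹ * (x' * Matrix.diagonal s) * x'⁻¹ := by
              rw [← Matrix.mul_assoc, Matrix.nonsing_inv_mul _ hdet', Matrix.one_mul]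
          _ = x'⁻¹ * J := by
              rw [← hJx, Matrix.mul_assoc, Matrix.mul_assoc, Matrix.mul_nonsing_inv _ hdet',
                Matrix.mul_one]
      rw [← Matrix.mul_assoc, ← Matrix.mul_assoc, h1, Matrix.mul_assoc x'⁻¹ J c, hJc,
        ← Matrix.mul_assoc, Matrix.mul_assoc _ J x', hJx, ← Matrix.mul_assoc]
    intro i j hij
    have := congrFun (congrFun hcomm i) j
    rw [Matrix.diagonal_mul, Matrix.mul_diagonal] at this
    have hsij : s i ≠ s j := by
      simp only [hs]
      rcases Int.units_eq_one_or δ with h | h <;> rcases Int.units_eq_one_or (e i).1 with h' | h' <;>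
        rcases Int.units_eq_one_or (e j).1 with h'' | h'' <;> simp_all <;> norm_num
    have h2 : (s i - s j) * (x'⁻¹ * c * x') i j = 0 := by
      rw [sub_mul, this]; ring
    exact (mul_eq_zero.1 h2).resolve_left (sub_ne_zero.2 hsij)
  · rw [← Matrix.mul_assoc, ← Matrix.mul_assoc, Matrix.mul_nonsing_inv _ hdet', Matrix.one_mul,
      Matrix.sub_mul, Matrix.mul_assoc, Matrix.nonsing_inv_mul _ hdet', Matrix.mul_one]
    abel

end OpenOrbit

end

section

section OpenOrbit

open Topology Filter in
/-- There is a rational point whose orbit under lower triangular and block diagonal matrices is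
Zariski dense. -/
theorem exists_dense_orbit {d : ℕ} {d' : ℤˣ → ℕ} (hd : d = d' 1 + d' (-1)) :
    ∃ x₀ : Matrix (Fin d) ((ε : ℤˣ) × Fin (d' ε)) ℚ,
      ∀ f : MvPolynomial (Fin d × ((ε : ℤˣ) × Fin (d' ε))) ℂ,
        (∀ (p : GL (Fin d) ℂ) (h : ∀ ε : ℤˣ, GL (Fin (d' ε)) ℂ),
          (∀ i j, i < j → (p : Matrix (Fin d) (Fin d) ℂ) i j = 0) →
          MvPolynomial.eval (fun ij => ((p : Matrix (Fin d) (Fin d) ℂ) *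
            x₀.map (algebraMap ℚ ℂ) * Matrix.blockDiagonal' fun ε =>
              (h ε : Matrix (Fin (d' ε)) (Fin (d' ε)) ℂ)) ij.1 ij.2) f = 0) → f = 0 := by
  obtain ⟨δ, hdδ, hδ⟩ : ∃ δ : ℤˣ, d = d' δ + d' (-δ) ∧ d' (-δ) ≤ d' δ := by
    rcases le_total (d' 1) (d' (-1)) with h | h
    · exact ⟨-1, by rw [neg_neg, hd, add_comm], by rwa [neg_neg]⟩
    · exact ⟨1, hd, h⟩
  have hcard : Fintype.card (Fin d) = Fintype.card ((ε : ℤˣ) × Fin (d' ε)) := by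
    rw [Fintype.card_fin, Fintype.card_sigma]
    simp only [Fintype.card_fin]
    rw [show (Finset.univ : Finset ℤˣ) = {1, -1} from rfl, Finset.sum_pair (by decide), hd]
  let e : Fin d ≃ (ε : ℤˣ) × Fin (d' ε) := Fintype.equivOfCardEq hcard
  refine ⟨orbitPoint d d' δ, fun f hf => ?_⟩
  set x : Matrix (Fin d) (Fin d) ℂ :=
    ((orbitPoint d d' δ).submatrix id e).map (algebraMap ℚ ℂ) with hx
  -- Truncating arbitrary matrices parametrizes both factors by a full vector space, and the orbit
  -- map becomes the bilinear map `B`.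
  let low : (Fin d → Fin d → ℂ) →ₗ[ℂ] Matrix (Fin d) (Fin d) ℂ :=
    { toFun := fun a => Matrix.of fun i j => if i < j then 0 else a i j
      map_add' := fun a b => by ext i j; simp only [Matrix.of_apply, Matrix.add_apply]; split_ifs <;> simp
      map_smul' := fun r b => by ext i j; simp only [Matrix.of_apply, Matrix.smul_apply]; split_ifs <;> simp }
  let bd : (Fin d → Fin d → ℂ) →ₗ[ℂ] Matrix (Fin d) (Fin d) ℂ :=
    { toFun := fun a => Matrix.of fun i j => if (e i).1 = (e j).1 then a i j else 0
      map_add' := fun a b => by ext i j; simp only [Matrix.of_apply, Matrix.add_apply]; split_ifs <;> simp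
      map_smul' := fun r b => by ext i j; simp only [Matrix.of_apply, Matrix.smul_apply]; split_ifs <;> simp }
  let B : (Fin d → Fin d → ℂ) →ₗ[ℂ] (Fin d → Fin d → ℂ) →ₗ[ℂ] (Fin d → Fin d → ℂ) :=
    LinearMap.mk₂ ℂ (fun a b => (low a * x * bd b : Matrix (Fin d) (Fin d) ℂ))
      (fun a b c => by rw [map_add, Matrix.add_mul, Matrix.add_mul]; rfl)
      (fun r a c => by rw [map_smul, Matrix.smul_mul, Matrix.smul_mul]; rfl)
      (fun a b c => by rw [map_add, Matrix.mul_add]; rfl)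
      (fun r a c => by rw [map_smul, Matrix.mul_smul]; rfl)
  let one : Fin d → Fin d → ℂ := (1 : Matrix (Fin d) (Fin d) ℂ)
  have hlow1 : low one = 1 := by
    ext i j
    simp only [low, one, LinearMap.coe_mk, AddHom.coe_mk, Matrix.of_apply]
    split_ifs with h
    · exact (Matrix.one_apply_ne h.ne).symm
    · rfl
  have hbd1 : bd one = 1 := by
    ext i j
    simp only [bd, one, LinearMap.coe_mk, AddHom.coe_mk, Matrix.of_apply]
    split_ifs with h
    · rfl
    · exact (Matrix.one_apply_ne fun h' => h (by rw [h'])).symm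
  -- A surjective strict derivative makes the map open at `(1, 1)`, so images of neighbourhoods of
  -- the identity are neighbourhoods of the orbit point.
  have hder := B.toContinuousBilinearMap.isBoundedBilinearMap.hasStrictFDerivAt (one, one)
  have hsurj := hder.map_nhds_eq_of_surj (by
    rw [LinearMap.range_eq_top]
    intro y
    obtain ⟨ξ, η, hξ, hη, hy⟩ := exists_lower_mul_add_mul_block hdδ hδ e (Matrix.of y)
    refine ⟨(ξ, η), ?_⟩
    have h1 : low ξ = ξ := by
      ext i j
      simp only [low, LinearMap.coe_mk, AddHom.coe_mk, Matrix.of_apply]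
      split_ifs with h
      · exact (hξ i j h).symm
      · rfl
    have h2 : bd η = η := by
      ext i j
      simp only [bd, LinearMap.coe_mk, AddHom.coe_mk, Matrix.of_apply]
      split_ifs with h
      · rfl
      · exact (hη i j h).symm
    change (low one * x * bd η : Matrix (Fin d) (Fin d) ℂ) + (low ξ * x * bd one) = Matrix.of y
    rw [hlow1, hbd1, h1, h2, ← hy, Matrix.one_mul, Matrix.mul_one, add_comm])
  let blk : ∀ ε : ℤˣ, (Fin d → Fin d → ℂ) → Matrix (Fin (d' ε)) (Fin (d' ε)) ℂ := fun ε b =>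
    Matrix.of fun i j => b (e.symm ⟨ε, i⟩) (e.symm ⟨ε, j⟩)
  have hblk1 : ∀ ε, blk ε one = 1 := by
    intro ε
    ext i j
    by_cases h : i = j
    · subst h
      simp [blk, one]
    · rw [Matrix.one_apply_ne h]
      simp only [blk, one, Matrix.of_apply]
      refine Matrix.one_apply_ne fun h' => h ?_
      simpa using h'
  -- Close to the identity the truncated matrices are invertible, so the values of `B` there lie in
  -- the group orbit.
  have hU : ∀ᶠ ab in 𝓝 (one, one), (low ab.1).det ≠ 0 ∧ ∀ ε, (blk ε ab.2).det ≠ 0 := by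
    rw [eventually_and, eventually_all]
    have hcl : Continuous fun ab : (Fin d → Fin d → ℂ) × (Fin d → Fin d → ℂ) => (low ab.1).det := by
      refine Continuous.matrix_det (continuous_matrix fun i j => ?_)
      simp only [low, LinearMap.coe_mk, AddHom.coe_mk, Matrix.of_apply]
      split_ifs
      · exact continuous_const
      · fun_prop
    have hcb : ∀ ε, Continuous
        fun ab : (Fin d → Fin d → ℂ) × (Fin d → Fin d → ℂ) => (blk ε ab.2).det := by
      intro ε
      refine Continuous.matrix_det (continuous_matrix fun i j => ?_)
      simp only [blk, Matrix.of_apply]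
      fun_prop
    refine ⟨hcl.continuousAt.eventually_ne ?_, fun ε => (hcb ε).continuousAt.eventually_ne ?_⟩
    · simp only [hlow1, Matrix.det_one]
      exact one_ne_zero
    · simp only [hblk1, Matrix.det_one]
      exact one_ne_zero
  have hV := image_mem_map (m := fun p : (Fin d → Fin d → ℂ) × (Fin d → Fin d → ℂ) =>
    B.toContinuousBilinearMap p.1 p.2) hU
  rw [hsurj] at hV
  have hcont : Continuous fun (y : Fin d × ((ε : ℤˣ) × Fin (d' ε)) → ℂ) (i j : Fin d) =>
      y (i, e j) := by fun_prop
  let y₀ : Fin d × ((ε : ℤˣ) × Fin (d' ε)) → ℂ := fun ij => algebraMap ℚ ℂ (orbitPoint d d' δ ij.1 ij.2)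
  have hy₀ : (fun (i j : Fin d) => y₀ (i, e j)) = B.toContinuousBilinearMap one one := by
    change _ = (low one * x * bd one : Matrix (Fin d) (Fin d) ℂ)
    rw [hlow1, hbd1, Matrix.one_mul, Matrix.mul_one]
    rfl
  have hW := hcont.continuousAt (x := y₀) (hy₀ ▸ hV)
  rw [mem_map, nhds_pi, Filter.mem_pi] at hW
  obtain ⟨I, -, t, ht, hI⟩ := hW
  -- The orbit contains a product of neighbourhoods of the entries of the orbit point. Each of them
  -- is an infinite set, so a polynomial vanishing on the product is zero.
  refine MvPolynomial.funext_set t (fun i => infinite_of_mem_nhds _ (ht i)) fun y hy => ?_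
  obtain ⟨⟨a, b⟩, ⟨ha, hb⟩, hab⟩ := hI (Set.pi_mono' (fun _ _ => le_rfl) (Set.subset_univ I) hy)
  rw [map_zero]
  have key := hf (Matrix.GeneralLinearGroup.mkOfDetNeZero _ ha)
    (fun ε => Matrix.GeneralLinearGroup.mkOfDetNeZero _ (hb ε)) (fun i j hij => if_pos hij)
  rw [← key]
  congr 2
  funext ij
  obtain ⟨i, c⟩ := ij
  have h3 := congrFun (congrFun hab i) (e.symm c)
  simp only [Equiv.apply_symm_apply] at h3
  rw [← h3]
  change (low a * x * bd b : Matrix (Fin d) (Fin d) ℂ) i (e.symm c) =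
    (low a * (orbitPoint d d' δ).map (algebraMap ℚ ℂ) *
      Matrix.blockDiagonal' fun ε => blk ε b) i c
  rw [Matrix.mul_assoc, Matrix.mul_assoc, Matrix.mul_apply, Matrix.mul_apply]
  refine Finset.sum_congr rfl fun j _ => ?_
  congr 1
  rw [Matrix.mul_apply, Matrix.mul_apply, ← e.sum_comp]
  refine Finset.sum_congr rfl fun k _ => ?_
  congr 1
  simp only [bd, LinearMap.coe_mk, AddHom.coe_mk, Matrix.of_apply, Equiv.apply_symm_apply]
  obtain ⟨k, rfl⟩ := e.symm.surjective k
  rw [Equiv.apply_symm_apply]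
  obtain ⟨κ, k⟩ := k
  obtain ⟨γ, c⟩ := c
  by_cases h : κ = γ
  · subst h
    simp [blk]
  · rw [if_neg h, Matrix.blockDiagonal'_apply_ne _ _ _ h]

end OpenOrbit

end

section

/-! ### Minors of X ⊗ Y and their transformation behaviour -/

section PairDeterminant

variable {R : Type*} [CommRing R]

theorem det_eq_prod_toSquareBlock {m J : Type*} [Fintype m] [DecidableEq m] [Fintype J]
    [DecidableEq J] (A : Matrix m m R) (b : m → J) (h : ∀ i j, b i ≠ b j → A i j = 0) :
    A.det = ∏ j, (A.toSquareBlock b j).det := by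
  let f := Fintype.equivFin J
  have hA : A.BlockTriangular (f ∘ b) := fun i j hij => h i j fun h' => by
    simp only [Function.comp_apply, h', lt_self_iff_false] at hij
  rw [hA.det_fintype, ← f.prod_comp]
  refine Finset.prod_congr rfl fun j _ => ?_
  let g : {a // b a = j} ≃ {a // (f ∘ b) a = f j} :=
    Equiv.subtypeEquivRight fun a => by simp
  rw [← Matrix.det_submatrix_equiv_self g]
  rfl

/-- The matrix `A ⊗ 1`, restricted to a subset of the index set. -/
def restrictedTensor {I J : Type*} [DecidableEq J] (S : I × J → Prop) (A : Matrix I I R) :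
    Matrix {s // S s} {s // S s} R :=
  Matrix.of fun s s' => if s.1.2 = s'.1.2 then A s.1.1 s'.1.1 else 0

/-- Entries with different second indices vanish, so the matrix is block diagonal for the second
index, and the block at `j` is the principal submatrix of `A` on the fibre of `S` over `j`. -/
theorem det_restrictedTensor {I J : Type*} [Fintype I] [Fintype J] [DecidableEq I] [DecidableEq J]
    (S : I × J → Prop) [DecidablePred S] (A : Matrix I I R) :
    (restrictedTensor S A).det =
      ∏ j, (A.submatrix (Subtype.val : {i // S (i, j)} → I) Subtype.val).det := by
  rw [det_eq_prod_toSquareBlock _ (fun s : {s // S s} => s.1.2) fun i j hij => by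
    rw [restrictedTensor, Matrix.of_apply, if_neg hij]]
  refine Finset.prod_congr rfl fun j _ => ?_
  let g : {i // S (i, j)} ≃ {s : {s // S s} // s.1.2 = j} :=
    { toFun := fun i => ⟨⟨(i.1, j), i.2⟩, rfl⟩
      invFun := fun s => ⟨s.1.1.1, by obtain ⟨⟨⟨i, j'⟩, h⟩, rfl⟩ := s; exact h⟩
      left_inv := fun i => rfl
      right_inv := fun s => by obtain ⟨⟨⟨i, j'⟩, h⟩, rfl⟩ := s; rfl }
  rw [← Matrix.det_submatrix_equiv_self g]
  congr 1
  ext a b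
  exact if_pos rfl

theorem sum_subtype_prod {I J : Type*} [Fintype I] [Fintype J]
    (S : I × J → Prop) [DecidablePred S] (G : I × J → R) :
    ∑ s : {s // S s}, G s.1 = ∑ i, ∑ j, if S (i, j) then G (i, j) else 0 := by
  rw [← Fintype.sum_prod_type (f := fun s : I × J => if S s then G s else 0), ← Finset.sum_filter]
  exact (Finset.sum_subtype _ (fun x => by simp) G).symm

variable {d e : ℕ} (wM : Fin d → ℤ) (wN : Fin e → ℤ) (q : ℤ) (d' e' : ℤˣ → ℕ) (ε : ℤˣ)

/-- The pairs of rows whose weights have a sum less than `q`. -/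
abbrev LowRow : Type := {ij : Fin d × Fin e // wM ij.1 + wN ij.2 < q}

/-- The pairs of columns whose signs have the product `ε`. -/
abbrev PairCol : Type :=
  {c : ((δ : ℤˣ) × Fin (d' δ)) × ((δ : ℤˣ) × Fin (e' δ)) // c.2.1 = ε * c.1.1}

variable {wM wN q d' e' ε}

/-- The rows of weight less than `q` and the columns of sign `ε` of `X ⊗ Y`. -/
def pairMatrix (X : Matrix (Fin d) ((δ : ℤˣ) × Fin (d' δ)) R)
    (Y : Matrix (Fin e) ((δ : ℤˣ) × Fin (e' δ)) R) :
    Matrix (LowRow wM wN q) (PairCol d' e' ε) R :=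
  Matrix.of fun r c => X r.1.1 c.1.1 * Y r.1.2 c.1.2

/-- The determinant of `pairMatrix`, with respect to a bijection of the rows and the columns. -/
def pairDet (g : LowRow wM wN q ≃ PairCol d' e' ε) (X : Matrix (Fin d) ((δ : ℤˣ) × Fin (d' δ)) R)
    (Y : Matrix (Fin e) ((δ : ℤˣ) × Fin (e' δ)) R) : R :=
  ((pairMatrix X Y).submatrix id g).det

/-- Exchanging the two factors. -/
def swapRow : LowRow wN wM q ≃ LowRow wM wN q :=
  (Equiv.prodComm _ _).subtypeEquiv fun a => by
    rw [Equiv.prodComm_apply, Prod.fst_swap, Prod.snd_swap, add_comm]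

/-- Exchanging the two factors. -/
def swapCol : PairCol d' e' ε ≃ PairCol e' d' ε :=
  (Equiv.prodComm _ _).subtypeEquiv fun a => by
    rw [Equiv.prodComm_apply, Prod.fst_swap, Prod.snd_swap]
    constructor
    · intro h; rw [h, ← mul_assoc, Int.units_mul_self, one_mul]
    · intro h; rw [h, ← mul_assoc, Int.units_mul_self, one_mul]

/-- This makes everything proved for the first factor available for the second one. -/
theorem pairDet_swap (g : LowRow wM wN q ≃ PairCol d' e' ε)
    (X : Matrix (Fin d) ((δ : ℤˣ) × Fin (d' δ)) R)
    (Y : Matrix (Fin e) ((δ : ℤˣ) × Fin (e' δ)) R) :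
    pairDet ((swapRow.trans g).trans swapCol) Y X = pairDet g X Y := by
  unfold pairDet
  rw [← Matrix.det_submatrix_equiv_self (swapRow (wM := wM) (wN := wN) (q := q))
    ((pairMatrix X Y).submatrix id g)]
  congr 1
  ext r c
  exact mul_comm _ _

theorem map_pairDet {S : Type*} [CommRing S] (f : R →+* S) (g : LowRow wM wN q ≃ PairCol d' e' ε)
    (X : Matrix (Fin d) ((δ : ℤˣ) × Fin (d' δ)) R)
    (Y : Matrix (Fin e) ((δ : ℤˣ) × Fin (e' δ)) R) :
    f (pairDet g X Y) = pairDet g (X.map f) (Y.map f) := by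
  rw [pairDet, RingHom.map_det]
  congr 1
  ext r c
  exact map_mul f _ _

/-- A weight condition keeps or discards whole blocks of rows. What is left of `p` is still block
triangular, for the reversed order because `p` is lower triangular, and its diagonal blocks are
those of the blocks kept. -/
theorem det_submatrix_low {t : ℕ} {s : Fin t → ℕ} {blk : Fin d → Fin t} {jump : Fin t → ℤ}
    (hblk : ∀ (i : Fin d) μ, InBlock s μ i ↔ blk i = μ) (hw : ∀ i, wM i = jump (blk i))
    (p : Matrix (Fin d) (Fin d) R) (hp : ∀ i j, blk i < blk j → p i j = 0) (x : ℤ) :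
    (p.submatrix (Subtype.val : {i // wM i + x < q} → Fin d) Subtype.val).det =
      ∏ μ, if jump μ + x < q then (p.toSquareBlockProp fun i : Fin d => InBlock s μ i).det else 1 := by
  have hA : (p.submatrix (Subtype.val : {i // wM i + x < q} → Fin d) Subtype.val).BlockTriangular
      (fun i => OrderDual.toDual (blk i.1)) := fun i j hij => hp _ _ hij
  rw [hA.det_fintype, ← OrderDual.toDual.prod_comp]
  refine Finset.prod_congr rfl fun μ _ => ?_
  split_ifs with h
  · let g : {i : Fin d // InBlock s μ i} ≃
        {i : {i // wM i + x < q} // OrderDual.toDual (blk i.1) = OrderDual.toDual μ} :=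
      { toFun := fun i => ⟨⟨i.1, by rw [hw, (hblk _ _).1 i.2]; exact h⟩, by
          rw [(hblk _ _).1 i.2]⟩
        invFun := fun i => ⟨i.1.1, (hblk _ _).2 (OrderDual.toDual.injective i.2)⟩
        left_inv := fun i => rfl
        right_inv := fun i => rfl }
    rw [← Matrix.det_submatrix_equiv_self g]
    rfl
  · have : IsEmpty {i : {i // wM i + x < q} // OrderDual.toDual (blk i.1) = OrderDual.toDual μ} :=
      ⟨fun i => h (by
        have h1 := i.1.2
        rwa [hw, OrderDual.toDual.injective i.2] at h1)⟩
    exact Matrix.det_isEmpty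

/-- Once the sign `γ` of the second column is fixed, the first column must have sign `ε * γ`, since
signs are their own inverses. A single diagonal block remains. -/
theorem det_submatrix_blockDiagonal' (h : ∀ δ : ℤˣ, Matrix (Fin (d' δ)) (Fin (d' δ)) R)
    (γ ε : ℤˣ) :
    ((Matrix.blockDiagonal' h).submatrix
      (Subtype.val : {c : (δ : ℤˣ) × Fin (d' δ) // γ = ε * c.1} → _) Subtype.val).det =
        (h (ε * γ)).det := by
  let g : Fin (d' (ε * γ)) ≃ {c : (δ : ℤˣ) × Fin (d' δ) // γ = ε * c.1} :=
    { toFun := fun i => ⟨⟨ε * γ, i⟩, by rw [← mul_assoc, Int.units_mul_self, one_mul]⟩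
      invFun := fun c => Fin.cast
        (congrArg d' ((Eq.trans (by rw [← mul_assoc, Int.units_mul_self, one_mul])
          (congrArg (ε * ·) c.2.symm)))) c.1.2
      left_inv := fun i => rfl
      right_inv := fun c => by
        obtain ⟨⟨κ, i⟩, hc⟩ := c
        have hc : ε * γ = κ := by rw [hc, ← mul_assoc, Int.units_mul_self, one_mul]
        subst hc
        rfl }
  rw [← Matrix.det_submatrix_equiv_self g]
  congr 1
  ext i j
  simp [g]

variable (wM wN q) in
/-- `p ⊗ 1`, restricted to the rows of weight less than `q`. -/
def rowTensor (p : Matrix (Fin d) (Fin d) R) : Matrix (LowRow wM wN q) (LowRow wM wN q) R :=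
  restrictedTensor (fun ij : Fin d × Fin e => wM ij.1 + wN ij.2 < q) p

variable (e' ε) in
/-- `h ⊗ 1`, restricted to the columns of sign `ε`. -/
def colTensor (h : ∀ δ : ℤˣ, Matrix (Fin (d' δ)) (Fin (d' δ)) R) :
    Matrix (PairCol d' e' ε) (PairCol d' e' ε) R :=
  restrictedTensor (fun c : ((δ : ℤˣ) × Fin (d' δ)) × ((δ : ℤˣ) × Fin (e' δ)) =>
    c.2.1 = ε * c.1.1) (Matrix.blockDiagonal' h)

/-- Restriction to the low rows is compatible with `p ⊗ 1`, since a lower parabolic matrix combines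
a row only with rows of at most its own weight; restriction to the columns of sign `ε` is compatible
with `h ⊗ 1`, since `h` preserves signs. Each diagonal block of `p` then occurs once for every row
of `Y` that pairs with it to a low row, and `det (h δ)` once for every column of `Y` of sign `ε *
δ`. -/
theorem pairDet_mul {t : ℕ} {s : Fin t → ℕ} {blk : Fin d → Fin t} {jump : Fin t → ℤ}
    (hblk : ∀ (i : Fin d) μ, InBlock s μ i ↔ blk i = μ) (hw : ∀ i, wM i = jump (blk i))
    (hj : StrictMono jump) (g : LowRow wM wN q ≃ PairCol d' e' ε)
    (p : Matrix (Fin d) (Fin d) R) (hp : ∀ i j, blk i < blk j → p i j = 0)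
    (h : ∀ δ : ℤˣ, Matrix (Fin (d' δ)) (Fin (d' δ)) R)
    (X : Matrix (Fin d) ((δ : ℤˣ) × Fin (d' δ)) R)
    (Y : Matrix (Fin e) ((δ : ℤˣ) × Fin (e' δ)) R) :
    pairDet g (p * X * Matrix.blockDiagonal' h) Y =
      (∏ μ, (p.toSquareBlockProp fun i : Fin d => InBlock s μ i).det ^
        (Nat.card {j // jump μ + wN j < q})) *
        (∏ δ, (h δ).det ^ e' (ε * δ)) * pairDet g X Y := by
  have key : (pairMatrix (p * X * Matrix.blockDiagonal' h) Y :
      Matrix (LowRow wM wN q) (PairCol d' e' ε) R) =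
        rowTensor wM wN q p *
          (pairMatrix X Y : Matrix (LowRow wM wN q) (PairCol d' e' ε) R) * colTensor e' ε h := by
    have h1 : ∀ X : Matrix (Fin d) ((δ : ℤˣ) × Fin (d' δ)) R,
        (pairMatrix (p * X) Y : Matrix (LowRow wM wN q) (PairCol d' e' ε) R) =
        rowTensor wM wN q p *
          (pairMatrix X Y : Matrix (LowRow wM wN q) (PairCol d' e' ε) R) := by
      intro X
      ext r c
      rw [Matrix.mul_apply]
      refine Eq.trans ?_ (sum_subtype_prod (fun ij : Fin d × Fin e => wM ij.1 + wN ij.2 < q)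
        fun ij => (if r.1.2 = ij.2 then p r.1.1 ij.1 else 0) * (X ij.1 c.1.1 * Y ij.2 c.1.2)).symm
      change (p * X) r.1.1 c.1.1 * Y r.1.2 c.1.2 = _
      rw [Matrix.mul_apply, Finset.sum_mul]
      refine Finset.sum_congr rfl fun i _ => ?_
      rw [Finset.sum_eq_single r.1.2]
      · rw [if_pos rfl]
        split_ifs with h2
        · rw [mul_assoc]
        -- A row `i` that is not low with this row of `Y`, whereas `r` is, has larger weight and
        -- hence lies in a later block.
        · rw [hp, zero_mul, zero_mul]
          by_contra h3
          have h4 := hj.monotone (not_lt.1 h3)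
          have h5 : wM r.1.1 + wN r.1.2 < q := r.2
          replace h2 : ¬ wM i + wN r.1.2 < q := h2
          rw [hw] at h2 h5
          omega
      · intro j _ hj
        rw [if_neg hj.symm, zero_mul, ite_self]
      · simp
    have h2 : ∀ X : Matrix (Fin d) ((δ : ℤˣ) × Fin (d' δ)) R,
        (pairMatrix (X * Matrix.blockDiagonal' h) Y :
          Matrix (LowRow wM wN q) (PairCol d' e' ε) R) =
        (pairMatrix X Y : Matrix (LowRow wM wN q) (PairCol d' e' ε) R) *
          colTensor e' ε h := by
      intro X
      ext r c
      rw [Matrix.mul_apply]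
      refine Eq.trans ?_ (sum_subtype_prod
        (fun c : ((δ : ℤˣ) × Fin (d' δ)) × ((δ : ℤˣ) × Fin (e' δ)) => c.2.1 = ε * c.1.1)
        fun b => (X r.1.1 b.1 * Y r.1.2 b.2) *
          (if b.2 = c.1.2 then Matrix.blockDiagonal' h b.1 c.1.1 else 0)).symm
      change (X * Matrix.blockDiagonal' h) r.1.1 c.1.1 * Y r.1.2 c.1.2 = _
      rw [Matrix.mul_apply, Finset.sum_mul]
      refine Finset.sum_congr rfl fun i _ => ?_
      rw [Finset.sum_eq_single c.1.2]
      · rw [if_pos rfl]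
        split_ifs with h2
        · ring
        · have : i.1 ≠ c.1.1.1 := fun h3 => h2 (by rw [h3]; exact c.2)
          obtain ⟨i1, i2⟩ := i
          rcases hc : c.1.1 with ⟨c1, c2⟩
          rw [hc] at this
          rw [Matrix.blockDiagonal'_apply_ne _ _ _ this, mul_zero, zero_mul]
      · intro j _ hj
        rw [if_neg hj, mul_zero, ite_self]
      · simp
    rw [h2, h1]
  have hsub : ∀ (A : Matrix (LowRow wM wN q) (LowRow wM wN q) R)
      (B : Matrix (LowRow wM wN q) (PairCol d' e' ε) R)
      (C : Matrix (PairCol d' e' ε) (PairCol d' e' ε) R),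
      (A * B * C).submatrix id g = A * B.submatrix id g * C.submatrix g g := by
    intro A B C
    ext i j
    simp only [Matrix.mul_apply, Matrix.submatrix_apply, id]
    rw [← g.sum_comp]
  rw [pairDet, key, hsub, Matrix.det_mul, Matrix.det_mul, Matrix.det_submatrix_equiv_self,
    rowTensor, colTensor, det_restrictedTensor, det_restrictedTensor]
  rw [mul_right_comm]
  refine congrArg₂ _ (congrArg₂ _ ?_ ?_) rfl
  · rw [Finset.prod_congr rfl fun j _ => det_submatrix_low hblk hw p hp (wN j), Finset.prod_comm]
    refine Finset.prod_congr rfl fun μ _ => ?_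
    rw [Finset.prod_ite, Finset.prod_const_one, mul_one, Finset.prod_const, Nat.card_eq_fintype_card,
      Fintype.card_subtype]
  · rw [Finset.prod_congr rfl fun j _ => det_submatrix_blockDiagonal' h j.1 ε]
    let D : ℤˣ → R := fun δ => (h δ).det
    change ∏ j : (δ : ℤˣ) × Fin (e' δ), D (ε * j.1) = ∏ δ, D δ ^ e' (ε * δ)
    rw [Fintype.prod_sigma, ← Equiv.prod_comp (Equiv.mulLeft ε) fun δ => D δ ^ e' (ε * δ)]
    refine Finset.prod_congr rfl fun δ _ => ?_
    simp only [Finset.prod_const, Finset.card_univ, Fintype.card_fin, Equiv.coe_mulLeft]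
    rw [← mul_assoc, Int.units_mul_self, one_mul]

end PairDeterminant

end

section

/-! ### Semi-invariant polynomials and dense orbits -/

section SemiInvariants

theorem evalMatrix_eq_eval_map {m n : Type} (f : MvPolynomial (m × n) ℚ) (x : Matrix m n ℂ) :
    evalMatrix f x =
      MvPolynomial.eval (fun ij : m × n => x ij.1 ij.2) (MvPolynomial.map (algebraMap ℚ ℂ) f) := by
  rw [evalMatrix, MvPolynomial.eval_map, MvPolynomial.aeval_def]

theorem evalMatrix_map {m n : Type} (f : MvPolynomial (m × n) ℚ) (x : Matrix m n ℚ) :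
    evalMatrix f (x.map (algebraMap ℚ ℂ)) =
      algebraMap ℚ ℂ (MvPolynomial.eval (fun ij : m × n => x ij.1 ij.2) f) := by
  rw [evalMatrix]
  exact MvPolynomial.aeval_algebraMap_apply ℂ (fun ij : m × n => x ij.1 ij.2) f

theorem partialSum_mono {t : ℕ} (s : Fin t → ℕ) : Monotone (partialSum s) := by
  intro m n hmn
  refine Finset.sum_le_sum fun ν _ => ?_
  split_ifs <;> omega

theorem lt_of_inBlock {t : ℕ} {s : Fin t → ℕ} {μ ν : Fin t} (hμν : μ < ν) {i j : ℕ}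
    (hi : InBlock s μ i) (hj : InBlock s ν j) : i < j :=
  hi.2.trans_le ((partialSum_mono s (Fin.lt_def.1 hμν)).trans hj.1)

/-- Uniqueness needs only the lower triangular part of each parabolic group, so one dense orbit
serves all partitions `s`. -/
theorem isLowerParabolic_of_lowerTriangular {t d : ℕ} (s : Fin t → ℕ) (p : GL (Fin d) ℂ)
    (hp : ∀ i j, i < j → (p : Matrix (Fin d) (Fin d) ℂ) i j = 0) : IsLowerParabolic s p :=
  fun _ _ _ _ hi hj hμν => hp _ _ (Fin.lt_def.2 (lt_of_inBlock hμν hi hj))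

variable {d : ℕ} {d' : ℤˣ → ℕ}

/-- A point with a Zariski dense orbit. -/
def IsDensePoint (x₀ : Matrix (Fin d) ((ε : ℤˣ) × Fin (d' ε)) ℚ) : Prop :=
  ∀ f : MvPolynomial (Fin d × ((ε : ℤˣ) × Fin (d' ε))) ℂ,
    (∀ (p : GL (Fin d) ℂ) (h : ∀ ε : ℤˣ, GL (Fin (d' ε)) ℂ),
      (∀ i j, i < j → (p : Matrix (Fin d) (Fin d) ℂ) i j = 0) →
      MvPolynomial.eval (fun ij => ((p : Matrix (Fin d) (Fin d) ℂ) *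
        x₀.map (algebraMap ℚ ℂ) * Matrix.blockDiagonal' fun ε =>
          (h ε : Matrix (Fin (d' ε)) (Fin (d' ε)) ℂ)) ij.1 ij.2) f = 0) → f = 0

/-- The complex analogue of `IsOfType`, for an arbitrary multiplier `χ`. -/
def IsSemiInvariant (χ : GL (Fin d) ℂ → (∀ ε : ℤˣ, GL (Fin (d' ε)) ℂ) → ℂ)
    (f : MvPolynomial (Fin d × ((ε : ℤˣ) × Fin (d' ε))) ℂ) : Prop :=
  ∀ (p : GL (Fin d) ℂ) (h : ∀ ε : ℤˣ, GL (Fin (d' ε)) ℂ)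
    (x : Matrix (Fin d) ((ε : ℤˣ) × Fin (d' ε)) ℂ),
      (∀ i j, i < j → (p : Matrix (Fin d) (Fin d) ℂ) i j = 0) →
      MvPolynomial.eval (fun ij => ((p : Matrix (Fin d) (Fin d) ℂ) *
        x * Matrix.blockDiagonal' fun ε =>
          (h ε : Matrix (Fin (d' ε)) (Fin (d' ε)) ℂ)) ij.1 ij.2) f =
        χ p h * MvPolynomial.eval (fun ij => x ij.1 ij.2) f

variable {x₀ : Matrix (Fin d) ((ε : ℤˣ) × Fin (d' ε)) ℚ}
  {χ : GL (Fin d) ℂ → (∀ ε : ℤˣ, GL (Fin (d' ε)) ℂ) → ℂ}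
  {f f₁ f₂ : MvPolynomial (Fin d × ((ε : ℤˣ) × Fin (d' ε))) ℂ}

theorem IsDensePoint.eq_zero (hx₀ : IsDensePoint x₀) (hf : IsSemiInvariant χ f)
    (h0 : MvPolynomial.eval (fun ij => x₀.map (algebraMap ℚ ℂ) ij.1 ij.2) f = 0) : f = 0 :=
  hx₀ f fun p h hp => by rw [hf p h _ hp, h0, mul_zero]

/-- The difference of the two sides vanishes at `x₀` and is multiplied by `χ` along the orbit. No
multiplicativity of `χ` is needed. -/
theorem IsDensePoint.eval_mul_eq (hx₀ : IsDensePoint x₀) (h₁ : IsSemiInvariant χ f₁)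
    (h₂ : IsSemiInvariant χ f₂) :
    MvPolynomial.C (MvPolynomial.eval (fun ij => x₀.map (algebraMap ℚ ℂ) ij.1 ij.2) f₁) * f₂ =
      MvPolynomial.C (MvPolynomial.eval (fun ij => x₀.map (algebraMap ℚ ℂ) ij.1 ij.2) f₂) * f₁ := by
  rw [← sub_eq_zero]
  refine hx₀ _ fun p h hp => ?_
  simp only [map_sub, map_mul, MvPolynomial.eval_C]
  rw [h₁ p h _ hp, h₂ p h _ hp]
  ring

theorem isSemiInvariant_of_isOfType {t : ℕ} {s a : Fin t → ℕ} {k : ℤˣ → ℕ}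
    {g : MvPolynomial (Fin d × ((ε : ℤˣ) × Fin (d' ε))) ℚ} (hg : IsOfType s a k g) :
    IsSemiInvariant (fun p h => (∏ μ, ((p : Matrix (Fin d) (Fin d) ℂ).toSquareBlockProp
          fun i => InBlock s μ i).det ^ a μ) *
        (∏ ε, (h ε : Matrix (Fin (d' ε)) (Fin (d' ε)) ℂ).det ^ k ε))
      (MvPolynomial.map (algebraMap ℚ ℂ) g) := fun p h x hp => by
  have := hg p h x (isLowerParabolic_of_lowerTriangular s p hp)
  rwa [evalMatrix_eq_eval_map, evalMatrix_eq_eval_map] at this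

/-- The point `x₀` is rational, so the values of `φ` and `g` there, and with them the factor of
proportionality, are rational. -/
theorem IsDensePoint.exists_eq_smul (hx₀ : IsDensePoint x₀) {t : ℕ} {s a : Fin t → ℕ} {k : ℤˣ → ℕ}
    {φ g : MvPolynomial (Fin d × ((ε : ℤˣ) × Fin (d' ε))) ℚ} (hφ : IsOfType s a k φ)
    (hφ0 : φ ≠ 0) (hg : IsOfType s a k g) : ∃ r : ℚ, g = r • φ := by
  have hinj := MvPolynomial.map_injective (σ := Fin d × ((ε : ℤˣ) × Fin (d' ε)))
    (algebraMap ℚ ℂ) (algebraMap ℚ ℂ).injective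
  have h1 : MvPolynomial.eval (fun ij => x₀ ij.1 ij.2) φ ≠ 0 := by
    intro h0
    apply hφ0
    apply hinj
    rw [map_zero]
    refine hx₀.eq_zero (isSemiInvariant_of_isOfType hφ) ?_
    rw [← evalMatrix_eq_eval_map, evalMatrix_map, h0, map_zero]
  have h2 := hx₀.eval_mul_eq (isSemiInvariant_of_isOfType hφ) (isSemiInvariant_of_isOfType hg)
  rw [← evalMatrix_eq_eval_map, ← evalMatrix_eq_eval_map, evalMatrix_map, evalMatrix_map,
    ← MvPolynomial.map_C (algebraMap ℚ ℂ), ← MvPolynomial.map_C (algebraMap ℚ ℂ), ← map_mul,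
    ← map_mul] at h2
  have h3 := hinj h2
  rw [← MvPolynomial.smul_eq_C_mul, ← MvPolynomial.smul_eq_C_mul] at h3
  refine ⟨(MvPolynomial.eval (fun ij => x₀ ij.1 ij.2) φ)⁻¹ *
    MvPolynomial.eval (fun ij => x₀ ij.1 ij.2) g, ?_⟩
  rw [mul_smul, ← h3, smul_smul, inv_mul_cancel₀ h1, one_smul]

end SemiInvariants

/-! ### Separation of the two variables of the minor -/

section PairPolynomial

variable {R : Type*} [CommRing R] {d e : ℕ} {wM : Fin d → ℤ} {wN : Fin e → ℤ} {q : ℤ}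
  {d' e' : ℤˣ → ℕ} {ε : ℤˣ}

/-- `pairDet g X Y` as a polynomial in the entries of `X`. -/
def pairPoly (g : LowRow wM wN q ≃ PairCol d' e' ε) (Y : Matrix (Fin e) ((δ : ℤˣ) × Fin (e' δ)) R) :
    MvPolynomial (Fin d × ((δ : ℤˣ) × Fin (d' δ))) R :=
  pairDet g (Matrix.of fun i c => MvPolynomial.X (i, c)) (Y.map MvPolynomial.C)

theorem eval_pairPoly (g : LowRow wM wN q ≃ PairCol d' e' ε)
    (X : Matrix (Fin d) ((δ : ℤˣ) × Fin (d' δ)) R) (Y : Matrix (Fin e) ((δ : ℤˣ) × Fin (e' δ)) R) :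
    MvPolynomial.eval (fun ij => X ij.1 ij.2) (pairPoly g Y) = pairDet g X Y := by
  rw [pairPoly, map_pairDet]
  congr 1
  · ext i c
    simp
  · ext i c
    simp

theorem map_pairPoly {S : Type*} [CommRing S] (f : R →+* S) (g : LowRow wM wN q ≃ PairCol d' e' ε)
    (Y : Matrix (Fin e) ((δ : ℤˣ) × Fin (e' δ)) R) :
    MvPolynomial.map f (pairPoly g Y) = pairPoly g (Y.map f) := by
  rw [pairPoly, map_pairDet]
  congr 1
  · ext i c
    simp
  · ext i c
    simp

theorem evalMatrix_pairPoly (g : LowRow wM wN q ≃ PairCol d' e' ε)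
    (X : Matrix (Fin d) ((δ : ℤˣ) × Fin (d' δ)) ℂ) (Y : Matrix (Fin e) ((δ : ℤˣ) × Fin (e' δ)) ℚ) :
    evalMatrix (pairPoly g Y) X = pairDet g X (Y.map (algebraMap ℚ ℂ)) := by
  rw [evalMatrix_eq_eval_map, map_pairPoly, eval_pairPoly]

/-- The rows are distributed into blocks of sizes `s μ` and weights `jump μ`, and `w i` is the
weight of the `i`-th row. -/
structure IsGrading {d t : ℕ} (s : Fin t → ℕ) (jump : Fin t → ℤ) (w : Fin d → ℤ) : Prop where
  strictMono : StrictMono jump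
  exists_block : ∃ blk : Fin d → Fin t,
    (∀ (i : Fin d) μ, InBlock s μ i ↔ blk i = μ) ∧ ∀ i, w i = jump (blk i)

theorem pairDet_lowerParabolic {t : ℕ} {s : Fin t → ℕ} {jump : Fin t → ℤ}
    (hM : IsGrading s jump wM) (g : LowRow wM wN q ≃ PairCol d' e' ε)
    (p : GL (Fin d) ℂ) (h : ∀ ε : ℤˣ, GL (Fin (d' ε)) ℂ) (hp : IsLowerParabolic s p)
    (X : Matrix (Fin d) ((δ : ℤˣ) × Fin (d' δ)) ℂ) (Y : Matrix (Fin e) ((δ : ℤˣ) × Fin (e' δ)) ℂ) :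
    pairDet g ((p : Matrix (Fin d) (Fin d) ℂ) * X * Matrix.blockDiagonal' fun ε =>
        (h ε : Matrix (Fin (d' ε)) (Fin (d' ε)) ℂ)) Y =
      (∏ μ, ((p : Matrix (Fin d) (Fin d) ℂ).toSquareBlockProp fun i => InBlock s μ i).det ^
        (Nat.card {j // jump μ + wN j < q})) *
        (∏ δ, (h δ : Matrix (Fin (d' δ)) (Fin (d' δ)) ℂ).det ^ e' (ε * δ)) * pairDet g X Y := by
  obtain ⟨blk, hblk, hw⟩ := hM.exists_block
  exact pairDet_mul hblk hw hM.strictMono g _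
    (fun i j hij => hp i j _ _ ((hblk _ _).2 rfl) ((hblk _ _).2 rfl) hij) _ X Y

theorem isOfType_pairPoly {t : ℕ} {s : Fin t → ℕ} {jump : Fin t → ℤ}
    (hM : IsGrading s jump wM) (g : LowRow wM wN q ≃ PairCol d' e' ε)
    (Y : Matrix (Fin e) ((δ : ℤˣ) × Fin (e' δ)) ℚ) :
    IsOfType s (fun μ => Nat.card {j // jump μ + wN j < q}) (fun δ => e' (ε * δ))
      (pairPoly g Y) := by
  intro p h x hp
  rw [evalMatrix_pairPoly, evalMatrix_pairPoly, pairDet_lowerParabolic hM g p h hp]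

theorem isSemiInvariant_pairPoly {t : ℕ} {s : Fin t → ℕ} {jump : Fin t → ℤ}
    (hM : IsGrading s jump wM) (g : LowRow wM wN q ≃ PairCol d' e' ε)
    (Y : Matrix (Fin e) ((δ : ℤˣ) × Fin (e' δ)) ℂ) :
    IsSemiInvariant (fun p h => (∏ μ, ((p : Matrix (Fin d) (Fin d) ℂ).toSquareBlockProp
          fun i => InBlock s μ i).det ^ (Nat.card {j // jump μ + wN j < q})) *
        (∏ δ, (h δ : Matrix (Fin (d' δ)) (Fin (d' δ)) ℂ).det ^ e' (ε * δ))) (pairPoly g Y) := by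
  intro p h x hp
  rw [eval_pairPoly, eval_pairPoly,
    pairDet_lowerParabolic hM g p h (isLowerParabolic_of_lowerTriangular s p hp)]

/-- If `pairDet g` is not identically zero, it is, up to a rational constant, a product of a
polynomial in `X` and a polynomial in `Y`, both of which are characterized by their types. -/
theorem exists_pairDet_factorization {t u : ℕ} {sM : Fin t → ℕ} {jM : Fin t → ℤ} {sN : Fin u → ℕ}
    {jN : Fin u → ℤ} (hM : IsGrading sM jM wM) (hN : IsGrading sN jN wN)
    (hd : d = d' 1 + d' (-1)) (he : e = e' 1 + e' (-1)) (g : LowRow wM wN q ≃ PairCol d' e' ε)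
    (X₁ : Matrix (Fin d) ((δ : ℤˣ) × Fin (d' δ)) ℂ) (Y₁ : Matrix (Fin e) ((δ : ℤˣ) × Fin (e' δ)) ℂ)
    (h₁ : pairDet g X₁ Y₁ ≠ 0)
    (haM : IsAdmissible sM d' (fun μ => Nat.card {j // jM μ + wN j < q}) fun δ => e' (ε * δ))
    (haN : IsAdmissible sN e' (fun ν => Nat.card {j // jN ν + wM j < q}) fun δ => d' (ε * δ)) :
    ∃ (φ : MvPolynomial (Fin d × ((δ : ℤˣ) × Fin (d' δ))) ℚ)
      (ψ : MvPolynomial (Fin e × ((δ : ℤˣ) × Fin (e' δ))) ℚ) (r : ℚ), r ≠ 0 ∧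
      IsCharacterizedByType sM (fun μ => Nat.card {j // jM μ + wN j < q})
        (fun δ => e' (ε * δ)) φ ∧
      IsCharacterizedByType sN (fun ν => Nat.card {j // jN ν + wM j < q})
        (fun δ => d' (ε * δ)) ψ ∧
      ∀ X Y, evalMatrix φ X * evalMatrix ψ Y = r * pairDet g X Y := by
  obtain ⟨x₀, hx₀⟩ : ∃ x₀ : Matrix (Fin d) ((ε : ℤˣ) × Fin (d' ε)) ℚ, IsDensePoint x₀ :=
    exists_dense_orbit hd
  obtain ⟨y₀, hy₀⟩ : ∃ y₀ : Matrix (Fin e) ((ε : ℤˣ) × Fin (e' ε)) ℚ, IsDensePoint y₀ :=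
    exists_dense_orbit he
  set g' := (swapRow.trans g).trans swapCol with hg'
  set x := x₀.map (algebraMap ℚ ℂ) with hx
  set y := y₀.map (algebraMap ℚ ℂ) with hy
  -- Nonvanishing is carried to the rational points one variable at a time: a semi-invariant
  -- polynomial that vanishes at a dense point is zero.
  have h2 : pairDet g x Y₁ ≠ 0 := by
    intro h0
    have h3 := hx₀.eq_zero (isSemiInvariant_pairPoly hM g Y₁) (by rw [eval_pairPoly]; exact h0)
    apply h₁
    rw [← eval_pairPoly, h3, map_zero]
  have h3 : pairDet g x y ≠ 0 := by
    intro h0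
    have h3 := hy₀.eq_zero (isSemiInvariant_pairPoly hN g' x)
      (by rw [eval_pairPoly, hg', pairDet_swap]; exact h0)
    apply h2
    rw [← pairDet_swap, ← eval_pairPoly, h3, map_zero]
  have hr : (algebraMap ℚ ℂ) (pairDet g x₀ y₀) = pairDet g x y := map_pairDet _ g _ _
  have hr0 : pairDet g x₀ y₀ ≠ 0 := by
    intro h0
    apply h3
    rw [← hr, h0, map_zero]
  have hφ0 : pairPoly g y₀ ≠ 0 := by
    intro h0
    apply hr0
    rw [← eval_pairPoly, h0, map_zero]
  have hψ0 : pairPoly g' x₀ ≠ 0 := by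
    intro h0
    apply hr0
    rw [← pairDet_swap, ← eval_pairPoly, h0, map_zero]
  refine ⟨pairPoly g y₀, pairPoly g' x₀, pairDet g x₀ y₀, hr0,
    ⟨haM, isOfType_pairPoly hM g y₀, hφ0, fun f hf =>
      hx₀.exists_eq_smul (isOfType_pairPoly hM g y₀) hφ0 hf⟩,
    ⟨haN, isOfType_pairPoly hN g' x₀, hψ0, fun f hf =>
      hy₀.exists_eq_smul (isOfType_pairPoly hN g' x₀) hψ0 hf⟩, fun X Y => ?_⟩
  rw [evalMatrix_pairPoly, evalMatrix_pairPoly, hg', pairDet_swap]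
  -- As polynomials in the first variable, the minors for `Y` and for `y` have the same multiplier
  -- and are therefore proportional; the ratio is read off at `x₀`.
  have h4 := hx₀.eval_mul_eq (isSemiInvariant_pairPoly hM g Y) (isSemiInvariant_pairPoly hM g y)
  have h5 := congrArg (MvPolynomial.eval fun ij => X ij.1 ij.2) h4
  simp only [map_mul, MvPolynomial.eval_C] at h5
  rw [← hx, eval_pairPoly, eval_pairPoly, eval_pairPoly, eval_pairPoly] at h5
  rw [← hx, ← hy, mul_comm, h5, ← hr]
  rfl

end PairPolynomial

end

section

/-! ### Dimensions of filtrations, their jumps and the weights of rows -/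

section StepFunctions

/-- A decreasing function with limits `d` at `-∞` and `0` at `∞`, such as the dimensions of the
steps of a filtration. -/
structure IsStep (ρ : ℤ → ℕ) (d : ℕ) : Prop where
  antitone : Antitone ρ
  exists_top : ∃ a, ∀ p ≤ a, ρ p = d
  exists_bot : ∃ b, ∀ p, b ≤ p → ρ p = 0

variable {ρ : ℤ → ℕ} {d : ℕ}

theorem IsStep.le (h : IsStep ρ d) (p : ℤ) : ρ p ≤ d := by
  obtain ⟨a, ha⟩ := h.exists_top
  rw [← ha _ (min_le_right p a)]
  exact h.antitone (min_le_left p a)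

/-- The heights telescope: far to the left there are no jumps, and raising `x` by one adds exactly
the drop at `x`, which is zero unless `x` is a jump. -/
theorem IsStep.sum_jumps_add (h : IsStep ρ d) {J : Finset ℤ}
    (hJ : ∀ p, p ∈ J ↔ ρ (p + 1) ≠ ρ p) (x : ℤ) :
    (∑ p ∈ J, if p < x then ρ p - ρ (p + 1) else 0) + ρ x = d := by
  obtain ⟨a, ha⟩ := h.exists_top
  have h0 : ∀ x ≤ a, (∑ p ∈ J, if p < x then ρ p - ρ (p + 1) else 0) + ρ x = d := by
    intro x hx
    rw [ha x hx, Finset.sum_eq_zero, zero_add]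
    intro p _
    split_ifs with hp
    · rw [ha p (by omega), ha (p + 1) (by omega), Nat.sub_self]
    · rfl
  rcases le_total x a with hx | hx
  · exact h0 x hx
  · induction x, hx using Int.leInduction with
    | base => exact h0 a le_rfl
    | succ x _ ih =>
      have h1 : (∑ p ∈ J, if p < x + 1 then ρ p - ρ (p + 1) else 0) =
          (∑ p ∈ J, if p < x then ρ p - ρ (p + 1) else 0) + (ρ x - ρ (x + 1)) := by
        have h2 : ∀ p, (if p < x + 1 then ρ p - ρ (p + 1) else 0) =
            (if p < x then ρ p - ρ (p + 1) else 0) + if x = p then ρ p - ρ (p + 1) else 0 := by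
          intro p
          rcases lt_trichotomy p x with hp | hp | hp
          · rw [if_pos (by omega), if_pos hp, if_neg (by omega), add_zero]
          · rw [if_pos (by omega), if_neg (by omega), if_pos hp.symm, zero_add]
          · rw [if_neg (by omega), if_neg (by omega), if_neg (by omega)]
        rw [Finset.sum_congr rfl fun p _ => h2 p, Finset.sum_add_distrib, Finset.sum_ite_eq]
        congr 1
        split_ifs with hx
        · rfl
        · rw [hJ, not_not] at hx
          rw [hx, Nat.sub_self]
      have h3 := h.antitone (show x ≤ x + 1 by omega)
      omega

/-- The `jump μ` are the jumps of the step function `ρ`, and the `s μ` their heights. -/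
structure IsJumps {t : ℕ} (ρ : ℤ → ℕ) (jump : Fin t → ℤ) (s : Fin t → ℕ) : Prop where
  strictMono : StrictMono jump
  mem_range : ∀ p, p ∈ Set.range jump ↔ ρ (p + 1) ≠ ρ p
  height : ∀ μ, s μ = ρ (jump μ) - ρ (jump μ + 1)

variable {t : ℕ} {jump : Fin t → ℤ} {s : Fin t → ℕ}

theorem IsJumps.partialSum_add (hj : IsJumps ρ jump s) (h : IsStep ρ d) {n : ℕ} {x : ℤ}
    (hn : ∀ ν : Fin t, (ν : ℕ) < n ↔ jump ν < x) : partialSum s n + ρ x = d := by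
  rw [← h.sum_jumps_add (J := Finset.univ.image jump) (fun p => by
    rw [← hj.mem_range p]; simp) x, Finset.sum_image fun _ _ _ _ h => hj.strictMono.injective h]
  congr 1
  refine Finset.sum_congr rfl fun ν _ => ?_
  rw [hj.height]
  exact if_congr (hn ν) rfl rfl

theorem exists_inBlock {s : Fin t → ℕ} {i : ℕ} (hi : i < partialSum s t) : ∃ μ, InBlock s μ i := by
  classical
  have hex : ∃ n, i < partialSum s n := ⟨t, hi⟩
  have h1 := Nat.find_spec hex
  have h2 : Nat.find hex ≠ 0 := by
    intro h0
    rw [h0] at h1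
    simp [partialSum] at h1
  obtain ⟨n, hn⟩ := Nat.exists_eq_succ_of_ne_zero h2
  have h3 : Nat.find hex ≤ t := Nat.find_le hi
  refine ⟨⟨n, by omega⟩, ?_, ?_⟩
  · exact not_lt.1 (Nat.find_min hex (m := n) (by omega))
  · rw [hn] at h1
    exact h1

theorem IsJumps.exists_gt (hj : IsJumps ρ jump s) (h : IsStep ρ d) : partialSum s t = d := by
  obtain ⟨b, hb⟩ := h.exists_bot
  have := hj.partialSum_add h (n := t) (x := b) fun ν => by
    refine iff_of_true ν.2 ?_
    by_contra hν
    exact (hj.mem_range (jump ν)).1 ⟨ν, rfl⟩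
      ((hb _ (by omega)).trans (hb _ (not_lt.1 hν)).symm)
  rwa [hb b le_rfl, add_zero] at this

/-- The two ends of the block of `i` are `d - ρ (jump μ)` and `d - ρ (jump μ + 1)`, and `ρ`
decreases. This describes the weight of a row by `ρ` alone, without reference to blocks, which is
the form in which duality can be applied. -/
theorem IsJumps.le_iff_of_inBlock (hj : IsJumps ρ jump s) (h : IsStep ρ d) {i : ℕ} {μ : Fin t}
    (hi : InBlock s μ i) (p : ℤ) : p ≤ jump μ ↔ d ≤ i + ρ p := by
  have h1 := hj.partialSum_add h (n := μ) (x := jump μ) fun ν => by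
    rw [hj.strictMono.lt_iff_lt, Fin.lt_def]
  have h2 := hj.partialSum_add h (n := μ + 1) (x := jump μ + 1) fun ν => by
    rw [Int.lt_add_one_iff, hj.strictMono.le_iff_le, Fin.le_def, Nat.lt_succ_iff]
  obtain ⟨h3, h4⟩ := hi
  constructor
  · intro hp
    have := h.antitone hp
    omega
  · intro hp
    by_contra hlt
    have := h.antitone (show jump μ + 1 ≤ p by omega)
    omega

/-- The weights of the rows are the jumps of `ρ`. -/
def IsRowWeight (ρ : ℤ → ℕ) {d : ℕ} (w : Fin d → ℤ) : Prop := ∀ i p, p ≤ w i ↔ d ≤ (i : ℕ) + ρ p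

/-- The blocks are disjoint and exhaust the rows, so the relation between a row and its weight is a
function. -/
theorem IsJumps.exists_grading (hj : IsJumps ρ jump s) (h : IsStep ρ d) :
    ∃ w : Fin d → ℤ, IsGrading s jump w ∧ IsRowWeight ρ w ∧
      ∀ (i : Fin d) x, (∃ μ, InBlock s μ i ∧ x = jump μ) ↔ x = w i := by
  have hex : ∀ i : Fin d, ∃ μ, InBlock s μ i := fun i =>
    exists_inBlock (by rw [hj.exists_gt h]; exact i.2)
  choose blk hblk using hex
  have huniq : ∀ (i : Fin d) μ, InBlock s μ i ↔ blk i = μ := by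
    intro i μ
    constructor
    · intro hμ
      rcases lt_trichotomy (blk i) μ with h1 | h1 | h1
      · exact absurd (lt_of_inBlock h1 (hblk i) hμ) (lt_irrefl _)
      · exact h1
      · exact absurd (lt_of_inBlock h1 hμ (hblk i)) (lt_irrefl _)
    · rintro rfl
      exact hblk i
  refine ⟨fun i => jump (blk i), ⟨hj.strictMono, blk, huniq, fun i => rfl⟩,
    fun i p => hj.le_iff_of_inBlock h (hblk i) p, fun i x => ?_⟩
  constructor
  · rintro ⟨μ, hμ, rfl⟩
    exact congrArg jump ((huniq i μ).1 hμ).symm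
  · rintro rfl
    exact ⟨_, hblk i, rfl⟩

variable {w : Fin d → ℤ}

theorem IsRowWeight.card_lt (hw : IsRowWeight ρ w) (x : ℤ) :
    Fintype.card {i // w i < x} = d - ρ x := by
  have h1 : ∀ i : Fin d, w i < x ↔ (i : ℕ) < d - ρ x := fun i => by
    rw [← not_le, hw i x]; omega
  rw [Fintype.card_subtype, Finset.filter_congr fun i _ => h1 i, Fin.card_filter_val_lt]
  omega

/-- An integer is determined by its lower bounds; for `w i.rev` these are given by `ρ p`, which the
symmetry converts into `ρ (W + 1 - p)`. -/
theorem IsRowWeight.rev (hw : IsRowWeight ρ w) {W : ℤ} (hsymm : ∀ p, ρ p + ρ (W + 1 - p) = d)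
    (i : Fin d) : w i.rev = W - w i := by
  refine eq_of_forall_le_iff fun p => ?_
  have h1 := hw i (W + 1 - p)
  have h2 := hsymm p
  have h3 := i.2
  rw [hw, Fin.val_rev]
  constructor
  · intro hp
    by_contra h4
    have := h1.1 (by omega)
    omega
  · intro hp
    by_contra h4
    have := h1.2 (by omega)
    omega

/-- The set of jumps is stable under `p ↦ W - p`, and a finite set has only one increasing
enumeration. -/
theorem IsJumps.rev (hj : IsJumps ρ jump s) {W : ℤ} (hsymm : ∀ p, ρ p + ρ (W + 1 - p) = d)
    (μ : Fin t) : jump μ.rev = W - jump μ := by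
  have hmem : ∀ p, p ∈ Set.range jump → W - p ∈ Set.range jump := by
    intro p hp
    rw [hj.mem_range] at hp ⊢
    have h1 := hsymm p
    have h2 := hsymm (p + 1)
    rw [show W + 1 - (p + 1) = W - p by ring] at h2
    rw [show W + 1 - p = W - p + 1 by ring] at h1
    omega
  have hcard : (Finset.univ.image jump).card = t := by
    rw [Finset.card_image_of_injective _ hj.strictMono.injective, Finset.card_univ,
      Fintype.card_fin]
  have e1 := Finset.orderEmbOfFin_unique hcard (f := jump) (fun x => by simp) hj.strictMono
  have e2 := Finset.orderEmbOfFin_unique hcard (f := fun μ => W - jump μ.rev) (fun x => by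
      obtain ⟨y, hy⟩ := hmem _ ⟨x.rev, rfl⟩
      simp only [Finset.mem_image, Finset.mem_univ, true_and]
      exact ⟨y, hy⟩) (fun x y hxy => by
      have := hj.strictMono (Fin.rev_lt_rev.2 hxy)
      simp only
      omega)
  have h1 : jump μ = W - jump μ.rev := congrFun (e1.trans e2.symm) μ
  omega

/-- Initial segments of `Fin t` are given by a cut. The cuts just below and just above the middle
weight will be `t^+` and `t^-`, in an order that depends on a sign. -/
theorem exists_count {P : Fin t → Prop} (hP : ∀ μ ν, μ ≤ ν → P ν → P μ) :
    ∃ n ≤ t, ∀ ν : Fin t, (ν : ℕ) < n ↔ P ν := by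
  classical
  by_cases hex : ∃ n, ∃ h : n < t, ¬ P ⟨n, h⟩
  · obtain ⟨h1, h2⟩ := Nat.find_spec hex
    refine ⟨Nat.find hex, h1.le, fun ν => ⟨fun hν => ?_, fun hν => ?_⟩⟩
    · have := Nat.find_min hex hν
      push Not at this
      exact this ν.2
    · by_contra h3
      exact h2 (hP _ ν (Fin.le_def.2 (not_lt.1 h3)) hν)
  · push Not at hex
    exact ⟨t, le_rfl, fun ν => iff_of_true ν.2 (hex ν ν.2)⟩

end StepFunctions

/-! ### Hodge symmetry and admissibility of the types -/

section Admissibility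

/-- Hodge numbers of weight `W`: `ρ` are the dimensions of the steps of the Hodge filtration, and
`d' ±1` the dimensions of the eigenspaces of an involution that exchanges `H^{p, q}` and `H^{q, p}`
and is a scalar on `H^{p, p}`. -/
structure IsHodge (ρ : ℤ → ℕ) (d : ℕ) (d' : ℤˣ → ℕ) (W : ℤ) : Prop extends IsStep ρ d where
  symm : ∀ p, ρ p + ρ (W + 1 - p) = d
  sign : ∃ δ, d' δ + ρ (W / 2 + 1) = d ∧ d' (-δ) + ρ ((W + 1) / 2) = d

variable {ρ ρ' : ℤ → ℕ} {d e : ℕ} {d' e' : ℤˣ → ℕ} {W W' : ℤ}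

/-- The index `(W + 1) / 2` is that of the last step containing the middle Hodge piece, and `W / 2 +
1` that of the first step beyond it; they coincide for odd `W`. They are exchanged by the symmetry
of `ρ`, so the two equations of `sign` add up to the total dimension. -/
theorem IsHodge.sign_add (h : IsHodge ρ d d' W) (δ : ℤˣ) : d' δ + d' (-δ) = d := by
  obtain ⟨γ, h1, h2⟩ := h.sign
  have h3 := h.symm ((W + 1) / 2)
  rw [show W + 1 - (W + 1) / 2 = W / 2 + 1 by omega] at h3
  have h4 := h.le (W / 2 + 1)
  have : δ = γ ∨ δ = -γ := by
    rcases Int.units_eq_one_or δ with h | h <;> rcases Int.units_eq_one_or γ with h' | h' <;>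
      simp [h, h']
  rcases this with rfl | rfl
  · omega
  · rw [neg_neg]
    omega

theorem IsRowWeight.card_mid {w : Fin d → ℤ} (hw : IsRowWeight ρ w) (h : IsHodge ρ d d' W) :
    (((Finset.univ.filter fun i => 2 * w i = W).card : ℕ) : ℤ) =
      (ρ ((W + 1) / 2) : ℤ) - ρ (W / 2 + 1) := by
  have h1 := hw.card_lt ((W + 1) / 2)
  have h2 := hw.card_lt (W / 2 + 1)
  have h3 := h.le ((W + 1) / 2)
  have h4 := h.le (W / 2 + 1)
  rw [Fintype.card_subtype] at h1 h2
  have h5 : (Finset.univ.filter fun i => w i < W / 2 + 1) =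
      (Finset.univ.filter fun i => w i < (W + 1) / 2) ∪
        (Finset.univ.filter fun i => 2 * w i = W) := by
    ext i
    simp only [Finset.mem_filter, Finset.mem_univ, true_and, Finset.mem_union]
    omega
  rw [h5, Finset.card_union_of_disjoint] at h2
  · omega
  · rw [Finset.disjoint_filter]
    intro i _ h6
    omega

/-- If the numbers of the pairs `(i, j)` with `i`-th weight plus `j`-th weight less than `q` and
greater than `W + W' - q` agree up to the product of the middle Hodge numbers, then they agree for
those `i` whose weight is not the middle one. -/
theorem eq_of_sum_sub_le (h : IsHodge ρ d d' W) (h' : IsHodge ρ' e e' W') {w : Fin d → ℤ}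
    (hw : IsRowWeight ρ w) {q₁ q₂ : ℤ} (hq : q₁ + q₂ = W + W' + 1) (hle : q₁ ≤ q₂)
    (hsum : ∑ i, ((ρ' (q₁ - w i) : ℤ) - ρ' (q₂ - w i)) ≤
      ((ρ ((W + 1) / 2) : ℤ) - ρ (W / 2 + 1)) * (ρ' ((W' + 1) / 2) - ρ' (W' / 2 + 1)))
    (i : Fin d) (hi : 2 * w i ≠ W) : ρ' (q₁ - w i) = ρ' (q₂ - w i) := by
  have hnn : ∀ i, 0 ≤ (ρ' (q₁ - w i) : ℤ) - ρ' (q₂ - w i) := fun i => by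
    have := h'.antitone (show q₁ - w i ≤ q₂ - w i by omega)
    omega
  have hmid : ∀ i, 2 * w i = W → (ρ' ((W' + 1) / 2) : ℤ) - ρ' (W' / 2 + 1) ≤
      ρ' (q₁ - w i) - ρ' (q₂ - w i) := by
    intro i hi
    rcases Int.even_or_odd' W' with ⟨k, hk | hk⟩
    -- For even `W` and `W'` the arguments `q₁ - w i` and `q₂ - w i` have the odd sum `W' + 1`, so
    -- they lie on different sides of the middle of the second filtration and the difference
    -- contains its whole middle piece.
    · have h1 := h'.antitone (show q₁ - w i ≤ (W' + 1) / 2 by omega)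
      have h2 := h'.antitone (show W' / 2 + 1 ≤ q₂ - w i by omega)
      omega
    · have h1 := hnn i
      rw [show (W' + 1) / 2 = W' / 2 + 1 by omega]
      omega
  by_contra hne
  have hpos : 0 < (ρ' (q₁ - w i) : ℤ) - ρ' (q₂ - w i) := by
    have := hnn i
    omega
  -- The middle rows already contribute the full upper bound, and one further positive term would
  -- exceed it.
  have h1 : ∑ i ∈ Finset.univ.filter (fun i => 2 * w i = W),
      ((ρ' (q₁ - w i) : ℤ) - ρ' (q₂ - w i)) < ∑ i, ((ρ' (q₁ - w i) : ℤ) - ρ' (q₂ - w i)) :=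
    Finset.sum_lt_sum_of_subset (Finset.filter_subset _ _) (Finset.mem_univ i)
      (by simpa using hi) hpos fun j _ _ => hnn j
  have h2 : ((Finset.univ.filter fun i => 2 * w i = W).card : ℤ) *
      ((ρ' ((W' + 1) / 2) : ℤ) - ρ' (W' / 2 + 1)) ≤
      ∑ i ∈ Finset.univ.filter (fun i => 2 * w i = W),
        ((ρ' (q₁ - w i) : ℤ) - ρ' (q₂ - w i)) := by
    rw [← nsmul_eq_mul]
    exact Finset.card_nsmul_le_sum _ _ _ fun i hi => hmid i (by simpa using hi)
  rw [hw.card_mid h] at h2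
  omega

theorem card_pairCol (d' e' : ℤˣ → ℕ) (ε : ℤˣ) :
    Fintype.card (PairCol d' e' ε) = d' 1 * e' ε + d' (-1) * e' (-ε) := by
  let g : PairCol d' e' ε ≃ (δ : ℤˣ) × (Fin (d' δ) × Fin (e' (ε * δ))) :=
    { toFun := fun c => ⟨c.1.1.1, c.1.1.2, Fin.cast (congrArg e' c.2) c.1.2.2⟩
      invFun := fun c => ⟨(⟨c.1, c.2.1⟩, ⟨ε * c.1, c.2.2⟩), rfl⟩
      left_inv := fun c => by
        obtain ⟨⟨⟨δ, i⟩, ⟨γ, j⟩⟩, h⟩ := c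
        have h0 : γ = ε * δ := h
        subst h0
        rfl
      right_inv := fun c => rfl }
  rw [Fintype.card_congr g, Fintype.card_sigma,
    show (Finset.univ : Finset ℤˣ) = {1, -1} from rfl, Finset.sum_pair (by decide)]
  simp only [Fintype.card_prod, Fintype.card_fin, mul_one, mul_neg]

theorem card_lowRow {w : Fin d → ℤ} {w' : Fin e → ℤ}
    (hw' : IsRowWeight ρ' w') (q : ℤ) :
    Fintype.card (LowRow w w' q) = ∑ i, (e - ρ' (q - w i)) := by
  let g : LowRow w w' q ≃ (i : Fin d) × {j // w' j < q - w i} :=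
    { toFun := fun r => ⟨r.1.1, r.1.2, by have := r.2; omega⟩
      invFun := fun r => ⟨(r.1, r.2.1), by have := r.2.2; simp only; omega⟩
      left_inv := fun r => rfl
      right_inv := fun r => rfl }
  rw [Fintype.card_congr g, Fintype.card_sigma]
  exact Finset.sum_congr rfl fun i _ => hw'.card_lt _

/-- Counting low rows through `ρ'`, and once more after reversing the rows, turns equality of
cardinalities into a formula for the sum of the differences `ρ' (q - w i) - ρ' (q' - w i)`, where
`q' = W + W' + 1 - q` is the mirror image of `q`. This sum is, up to sign, the product of the two
middle Hodge numbers, which is the extreme case treated in `eq_of_sum_sub_le`. -/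
theorem eq_of_card_eq (h : IsHodge ρ d d' W) (h' : IsHodge ρ' e e' W') {w : Fin d → ℤ}
    {w' : Fin e → ℤ} (hw : IsRowWeight ρ w) (hw' : IsRowWeight ρ' w') {q : ℤ} {ε δ : ℤˣ}
    (hδ : d' δ + ρ (W / 2 + 1) = d ∧ d' (-δ) + ρ ((W + 1) / 2) = d)
    (hcard : Fintype.card (LowRow w w' q) = Fintype.card (PairCol d' e' ε)) :
    (∀ i, 2 * w i ≠ W → ρ' (q - w i) = ρ' (W + W' + 1 - q - w i)) ∧
    ∀ i, 2 * w i = W → ρ' (q - w i) + e' (ε * δ) = e := by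
  rw [card_lowRow hw', card_pairCol] at hcard
  have hn : (∑ i, ((e : ℤ) - ρ' (q - w i))) = d' 1 * e' ε + d' (-1) * e' (-ε) := by
    have := congrArg (Nat.cast (R := ℤ)) hcard
    push_cast at this
    rw [← this]
    exact Finset.sum_congr rfl fun i _ => by rw [Nat.cast_sub (h'.le _)]
  -- Reversing the rows replaces `w i` by `W - w i`, and the symmetry of `ρ'` then turns
  -- codimensions at `q` into dimensions at the mirror image.
  have hn' : (∑ i, (ρ' (W + W' + 1 - q - w i) : ℤ)) = d' 1 * e' ε + d' (-1) * e' (-ε) := by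
    rw [← hn, ← Equiv.sum_comp Fin.revPerm]
    refine Finset.sum_congr rfl fun i _ => ?_
    rw [Fin.revPerm_apply, hw.rev h.symm]
    have := h'.symm (q - w i)
    rw [show W + W' + 1 - q - (W - w i) = W' + 1 - (q - w i) by ring]
    omega
  have hT : ∑ i, ((ρ' (q - w i) : ℤ) - ρ' (W + W' + 1 - q - w i)) =
      -((d' δ : ℤ) - d' (-δ)) * (e' (ε * δ) - e' (-(ε * δ))) := by
    rw [Finset.sum_sub_distrib, Finset.sum_const, Finset.card_univ, Fintype.card_fin,
      nsmul_eq_mul] at hn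
    rw [Finset.sum_sub_distrib, hn']
    have h1 : (∑ i, (ρ' (q - w i) : ℤ)) = d * e - (d' 1 * e' ε + d' (-1) * e' (-ε)) := by
      linarith
    have h2 : (d : ℤ) = d' 1 + d' (-1) := by rw [← h.sign_add 1]; push_cast; ring
    have h3 : (e : ℤ) = e' ε + e' (-ε) := by rw [← h'.sign_add ε]; push_cast; ring
    rw [h1, h2, h3]
    rcases Int.units_eq_one_or δ with rfl | rfl
    · rw [mul_one]; ring
    · rw [mul_neg, mul_one, neg_neg, neg_neg]; ring
  have hM : (d' δ : ℤ) - d' (-δ) = ρ ((W + 1) / 2) - ρ (W / 2 + 1) := by omega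
  have hM0 : (0 : ℤ) ≤ ρ ((W + 1) / 2) - ρ (W / 2 + 1) := by
    have := h.antitone (show (W + 1) / 2 ≤ W / 2 + 1 by omega)
    omega
  -- The sign `ε * δ` need not be the dominant one for the second factor; only the absolute value of
  -- the difference matters for the bound.
  have hN : (e' (ε * δ) : ℤ) - e' (-(ε * δ)) = ρ' ((W' + 1) / 2) - ρ' (W' / 2 + 1) ∨
      (e' (ε * δ) : ℤ) - e' (-(ε * δ)) = -(ρ' ((W' + 1) / 2) - ρ' (W' / 2 + 1)) := by
    obtain ⟨γ, h1, h2⟩ := h'.sign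
    have h3 := h'.sign_add γ
    have h4 := h'.sign_add (ε * δ)
    have : ε * δ = γ ∨ ε * δ = -γ := by
      rcases Int.units_eq_one_or (ε * δ) with h | h <;> rcases Int.units_eq_one_or γ with h' | h' <;>
        simp [h, h']
    rcases this with h | h
    · left; rw [h]; omega
    · right; rw [h, neg_neg]; omega
  have hN0 : (0 : ℤ) ≤ ρ' ((W' + 1) / 2) - ρ' (W' / 2 + 1) := by
    have := h'.antitone (show (W' + 1) / 2 ≤ W' / 2 + 1 by omega)
    omega
  have key : ∀ i, 2 * w i ≠ W → ρ' (q - w i) = ρ' (W + W' + 1 - q - w i) := by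
    have hp := mul_nonneg hM0 hN0
    rcases le_total q (W + W' + 1 - q) with hq | hq
    · refine eq_of_sum_sub_le h h' hw (by ring) hq ?_
      rw [hT, hM]
      rcases hN with h5 | h5 <;> rw [h5] <;> linarith
    · intro i hi
      refine (eq_of_sum_sub_le h h' hw (by ring) hq ?_ i hi).symm
      rw [show (∑ i, ((ρ' (W + W' + 1 - q - w i) : ℤ) - ρ' (q - w i))) =
        -∑ i, ((ρ' (q - w i) : ℤ) - ρ' (W + W' + 1 - q - w i)) by
          rw [← Finset.sum_neg_distrib]
          exact Finset.sum_congr rfl fun i _ => by ring]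
      rw [hT, hM]
      rcases hN with h5 | h5 <;> rw [h5] <;> linarith
  refine ⟨key, fun i₀ hi₀ => ?_⟩
  -- Only the rows of middle weight are left in the sum, and their terms are all equal. Dividing by
  -- their number, which is the middle Hodge number of the first factor, gives the value of each
  -- term.
  have h1 : ∑ i, ((ρ' (q - w i) : ℤ) - ρ' (W + W' + 1 - q - w i)) =
      ∑ i, if 2 * w i = W then ((ρ' (q - w i₀) : ℤ) - ρ' (W + W' + 1 - q - w i₀)) else 0 := by
    refine Finset.sum_congr rfl fun i _ => ?_
    split_ifs with h2
    · rw [show w i = w i₀ by omega]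
    · rw [key i h2, sub_self]
  rw [← Finset.sum_filter, Finset.sum_const, nsmul_eq_mul, hT] at h1
  have hcard : (((Finset.univ.filter fun i => 2 * w i = W).card : ℕ) : ℤ) =
      (d' δ : ℤ) - d' (-δ) := by
    rw [hM, hw.card_mid h]
  have hpos : 0 < (Finset.univ.filter fun i => 2 * w i = W).card :=
    Finset.card_pos.2 ⟨i₀, by simpa using hi₀⟩
  have h2 : (-((e' (ε * δ) : ℤ) - e' (-(ε * δ)))) =
      (ρ' (q - w i₀) : ℤ) - ρ' (W + W' + 1 - q - w i₀) := by
    have h3 : ((d' δ : ℤ) - d' (-δ)) ≠ 0 := by omega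
    apply mul_left_cancel₀ h3
    rw [← hcard, ← h1, ← hcard]
    ring
  have h3 := h'.symm (q - w i₀)
  rw [show W' + 1 - (q - w i₀) = W + W' + 1 - q - w i₀ by omega] at h3
  have h4 := h'.sign_add (ε * δ)
  omega

/-- The exponent `a μ` is the codimension of step `q - jump μ` in the second filtration. Off the
middle, `eq_of_card_eq` together with the two symmetries gives `a μ + a μ.rev = e`; at the middle it
gives the exponent itself. -/
theorem isAdmissible_of_card_eq (h : IsHodge ρ d d' W) (h' : IsHodge ρ' e e' W') {t : ℕ}
    {s : Fin t → ℕ} {jump : Fin t → ℤ} (hj : IsJumps ρ jump s) {w : Fin d → ℤ} {w' : Fin e → ℤ}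
    (hw : IsRowWeight ρ w) (hw' : IsRowWeight ρ' w') {q : ℤ} {ε : ℤˣ}
    (hjw : ∀ μ, ∃ i, w i = jump μ)
    (hcard : Fintype.card (LowRow w w' q) = Fintype.card (PairCol d' e' ε)) :
    IsAdmissible s d' (fun μ => Nat.card {j // jump μ + w' j < q}) fun δ => e' (ε * δ) := by
  obtain ⟨δ, hδ⟩ := h.sign
  obtain ⟨h1, h2⟩ := eq_of_card_eq h h' hw hw' hδ hcard
  have ha : (fun μ => Nat.card {j // jump μ + w' j < q}) = fun μ => e - ρ' (q - jump μ) := by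
    funext μ
    rw [← hw'.card_lt, Nat.card_eq_fintype_card]
    exact Fintype.card_congr (Equiv.subtypeEquivRight fun j => by omega)
  have hA : ∀ μ, 2 * jump μ ≠ W → ρ' (q - jump μ) = ρ' (W + W' + 1 - q - jump μ) := by
    intro μ hμ
    obtain ⟨i, hi⟩ := hjw μ
    rw [← hi] at hμ ⊢
    exact h1 i hμ
  have hmid : ∀ μ, 2 * jump μ = W → e - ρ' (q - jump μ) = e' (ε * δ) := by
    intro μ hμ
    obtain ⟨i, hi⟩ := hjw μ
    rw [← hi] at hμ ⊢
    have := h2 i hμ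
    omega
  have hrev : ∀ μ, 2 * jump μ ≠ W →
      (e - ρ' (q - jump μ)) + (e - ρ' (q - jump μ.rev)) = e := by
    intro μ hμ
    rw [hj.rev h.symm, hA μ hμ]
    have h3 := h'.symm (q - (W - jump μ))
    rw [show W' + 1 - (q - (W - jump μ)) = W + W' + 1 - q - jump μ by ring] at h3
    omega
  have hkk : ∀ γ, e' γ ≤ e - ρ' (W' / 2 + 1) := by
    intro γ
    obtain ⟨κ, h3, h4⟩ := h'.sign
    have h5 := h'.antitone (show (W' + 1) / 2 ≤ W' / 2 + 1 by omega)
    have : γ = κ ∨ γ = -κ := by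
      rcases Int.units_eq_one_or γ with h | h <;> rcases Int.units_eq_one_or κ with h' | h' <;>
        simp [h, h']
    rcases this with h | h
    · rw [h]; omega
    · rw [h]; omega
  -- The step `q - jump μ` and its mirror image have equal dimension, and the sum of their indices
  -- exceeds `W' + 1`. So the larger index is at least `W' / 2 + 1`, where the codimension is the
  -- larger of the two sign dimensions.
  have hlow : ∀ μ, 2 * jump μ < W → ∀ γ, e' γ ≤ e - ρ' (q - jump μ) := by
    intro μ hμ γ
    refine (hkk γ).trans (Nat.sub_le_sub_left ?_ e)
    have h3 := hA μ hμ.ne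
    rcases le_total (q - jump μ) (W + W' + 1 - q - jump μ) with h4 | h4
    · rw [h3]
      exact h'.antitone (by omega)
    · exact h'.antitone (by omega)
  have hhigh : ∀ μ, W < 2 * jump μ → ∀ γ, e - ρ' (q - jump μ) ≤ e' γ := by
    intro μ hμ γ
    have h3 := hrev μ hμ.ne'
    have h4 := hlow μ.rev (by rw [hj.rev h.symm]; omega) (-γ)
    have h5 := h'.sign_add γ
    omega
  obtain ⟨tl, htl, htl'⟩ := exists_count (P := fun μ => jump μ < (W + 1) / 2)
    fun μ ν hμν hν => (hj.strictMono.monotone hμν).trans_lt hν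
  obtain ⟨th, hth, hth'⟩ := exists_count (P := fun μ => jump μ < W / 2 + 1)
    fun μ ν hμν hν => (hj.strictMono.monotone hμν).trans_lt hν
  have hlh : tl ≤ th := by
    by_contra h3
    have h4 := (htl' ⟨th, by omega⟩).1 (not_le.1 h3)
    have h5 := (hth' ⟨th, by omega⟩).2 (by omega)
    exact lt_irrefl _ h5
  have hsl := hj.partialSum_add h.toIsStep htl'
  have hsh := hj.partialSum_add h.toIsStep hth'
  have hanti : Antitone fun μ => e - ρ' (q - jump μ) := fun μ ν hμν => by
    have := h'.antitone (show q - jump ν ≤ q - jump μ by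
      have := hj.strictMono.monotone hμν
      omega)
    simp only
    omega
  rw [ha]
  have h3 := h'.sign_add ε
  have hsum : ∀ i : Fin t, (i : ℕ) < tl → e - ρ' (q - jump i) + (e - ρ' (q - jump i.rev)) =
      e' ε + e' (-ε) := by
    intro i hi
    rw [h3]
    have := (htl' i).1 hi
    exact hrev i (by omega)
  -- The sign `δ` is the one whose eigenspace contains the middle Hodge piece, so its cut is `th`
  -- and the other one is `tl`.
  rcases Int.units_eq_one_or δ with rfl | rfl
  · rw [mul_one] at hmid
    refine ⟨th, tl, hth, htl, by omega, by omega, hanti, ?_, ?_, ?_, ?_, ?_, ?_, ?_⟩ <;>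
      simp only [mul_one, mul_neg, min_eq_right hlh, max_eq_left hlh]
    · exact hsum
    · intro i hi
      have h4 := (hth' i).1 (by omega)
      rcases lt_or_eq_of_le (show 2 * jump i ≤ W by omega) with h5 | h5
      · exact hlow i h5 _
      · exact (hmid i h5).ge
    · intro i hi
      have h4 := mt (hth' i).2 (by omega)
      exact hhigh i (by omega) _
    · intro i hi
      have h4 := (htl' i).1 (by omega)
      exact max_le (hlow i (by omega) _) (hlow i (by omega) _)
    · intro i hi
      have h4 := mt (hth' i).2 (by omega)
      exact le_min (hhigh i (by omega) _) (hhigh i (by omega) _)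
    · intro i hi hi'
      have h4 := (hth' i).1 (by omega)
      have h5 := mt (htl' i).2 (by omega)
      exact hmid i (by omega)
    · intro i hi hi'
      omega
  · rw [mul_neg, mul_one] at hmid
    rw [neg_neg] at hδ
    refine ⟨tl, th, htl, hth, by omega, by omega, hanti, ?_, ?_, ?_, ?_, ?_, ?_, ?_⟩ <;>
      simp only [mul_one, mul_neg, min_eq_left hlh, max_eq_right hlh]
    · exact hsum
    · intro i hi
      have h4 := (htl' i).1 (by omega)
      exact hlow i (by omega) _
    · intro i hi
      have h4 := mt (htl' i).2 (by omega)
      rcases lt_or_eq_of_le (show W ≤ 2 * jump i by omega) with h5 | h5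
      · exact hhigh i h5 _
      · exact (hmid i h5.symm).le
    · intro i hi
      have h4 := (htl' i).1 (by omega)
      exact max_le (hlow i (by omega) _) (hlow i (by omega) _)
    · intro i hi
      have h4 := mt (hth' i).2 (by omega)
      exact le_min (hhigh i (by omega) _) (hhigh i (by omega) _)
    · intro i hi hi'
      omega
    · intro i hi hi'
      have h4 := (hth' i).1 (by omega)
      have h5 := mt (htl' i).2 (by omega)
      exact hmid i (by omega)

end Admissibility

end

namespace YoshidaPeriods

/-! ### Scalar extension and rational structures of complex spaces -/

section BaseChangeLemmas

variable {R : Type uR} {S : Type uS} {T : Type uT} [CommRing R] [CommRing S] [CommRing T]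
variable (f : R →+* S) (g : S →+* T) (h : R →+* T)
variable {V : Type uV} {W : Type uW} [AddCommGroup V] [Module R V] [AddCommGroup W] [Module R W]

namespace BaseChange

theorem span_range_incl : Submodule.span S (Set.range (incl (V := V) f)) = ⊤ := by
  have := sub_top (V := V) f
  rwa [sub, Submodule.top_coe, Set.image_univ] at this

theorem hom_ext {P : Type*} [AddCommGroup P] [Module S P] {φ ψ : BaseChange f V →ₗ[S] P}
    (H : ∀ v, φ (incl f v) = ψ (incl f v)) : φ = ψ :=
  LinearMap.ext_on_range (span_range_incl f) H

theorem map_incl (φ : V →ₗ[R] W) (v : V) : map f φ (incl f v) = incl f (φ v) := by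
  let := f.toAlgebra
  exact LinearMap.baseChange_tmul (A := S) (f := φ) (1 : S) v

theorem tensorEquiv_incl (v : V) (w : W) :
    tensorEquiv f (incl f (v ⊗ₜ[R] w)) = incl f v ⊗ₜ[S] incl f w := by
  let := f.toAlgebra
  rfl

theorem trans_symm_incl (H : h = g.comp f) (v : V) :
    (trans f g h H).symm (incl g (incl f v)) = incl h v := by
  let := f.toAlgebra
  let := g.toAlgebra
  let := h.toAlgebra
  have : IsScalarTower R S T := IsScalarTower.of_algebraMap_eq' H
  refine (TensorProduct.AlgebraTensorModule.cancelBaseChange_tmul R S T (1 : T) v (1 : S)).trans ?_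
  rw [one_smul]
  rfl

theorem push_incl (H : h = g.comp f) (v : V) : push f g h H (incl f v) = incl h v :=
  trans_symm_incl f g h H v

end BaseChange

end BaseChangeLemmas

section Subfields

variable {R : Type uR} [CommRing R] {V : Type uV} [AddCommGroup V] [Module R V]

/-- `push`, as a linear map over a subfield `K` of `ℂ`. -/
def pushSubfield (K : Subfield ℂ) (f : R →+* K) (h : R →+* ℂ) (H : h = K.subtype.comp f) :
    BaseChange f V →ₗ[K] BaseChange h V where
  toFun := BaseChange.push f K.subtype h H
  map_add' _ _ := map_add _ _ _
  map_smul' _ _ := LinearMap.map_smulₛₗ _ _ _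

theorem isBaseChange_pushSubfield (K : Subfield ℂ) (f : R →+* K) (h : R →+* ℂ)
    (H : h = K.subtype.comp f) : IsBaseChange ℂ (pushSubfield (V := V) K f h H) := by
  refine IsBaseChange.of_equiv (BaseChange.trans f K.subtype h H (V := V)).symm fun x => ?_
  rfl

end Subfields

namespace Realization

variable {F : Type uF} {E : Type uE} [Field F] [CharZero F] [Field E] [CharZero E]
variable (M N : Realization.{uF, uE, uB, uD} F E) (τ : F →+* ℂ) (σ : E →+* ℂ)

instance : Finite (Orbit τ) :=
  (Set.finite_insert.2 (Set.finite_singleton _) : ({τ, ComplexEmbedding.conjugate τ} : Set _).Finite)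

theorem isBaseChange_inclT : IsBaseChange ℂ (M.inclT τ σ) :=
  IsBaseChange.pi (fun τ' : Orbit τ => pushSubfield (periodField τ σ) (pairingField σ τ')
    (pairing σ τ'.1) (pairing_eq_pairingField σ τ')) fun _ => isBaseChange_pushSubfield _ _ _ _

theorem isBaseChange_inclB : IsBaseChange ℂ (M.inclB τ σ) :=
  IsBaseChange.pi (fun τ' : Orbit τ => pushSubfield (V := M.HB τ'.1) σ.fieldRange
    σ.rangeRestrictField σ rfl) fun _ => isBaseChange_pushSubfield _ _ _ _

end Realization
end YoshidaPeriods

namespace YoshidaPeriods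

/-! ### Bases adapted to a filtration -/

section AdaptedBases

variable {K V : Type*} [Field K] [AddCommGroup V] [Module K V]

/-- The last vectors of the basis `b` span the steps of the filtration `f`. -/
def IsAdapted {d : ℕ} (f : ℤ → Submodule K V) (b : Module.Basis (Fin d) K V) : Prop :=
  ∀ p, f p = Submodule.span K (b '' {i | d ≤ (i : ℕ) + Module.finrank K (f p)})

/-- The steps form a chain and their dimensions are bounded, so a proper step of maximal dimension
contains every other proper step. -/
theorem exists_proper_bound [FiniteDimensional K V] [Nontrivial V] {f : ℤ → Submodule K V}
    (hf : Antitone f) : ∃ P : Submodule K V, P ≠ ⊤ ∧ ∀ p, f p ≠ ⊤ → f p ≤ P := by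
  by_cases h : ∃ p, f p ≠ ⊤
  · have hfin : (Set.range fun p : {p // f p ≠ ⊤} => Module.finrank K (f p)).Finite :=
      (Set.finite_Iic (Module.finrank K V)).subset (by
        rintro _ ⟨p, rfl⟩
        exact Submodule.finrank_le _)
    obtain ⟨p₀, hp₀⟩ := h
    obtain ⟨_, ⟨p, rfl⟩, hp⟩ := Set.exists_max_image _ id hfin ⟨_, ⟨⟨p₀, hp₀⟩, rfl⟩⟩
    refine ⟨f p, p.2, fun p' hp' => ?_⟩
    rcases le_total p.1 p' with h1 | h1
    · exact hf h1
    · exact (Submodule.eq_of_le_of_finrank_le (hf h1) (hp _ ⟨⟨p', hp'⟩, rfl⟩)).ge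
  · push Not at h
    exact ⟨⊥, bot_ne_top, fun p hp => absurd (h p) hp⟩

/-- Induction on the dimension. A hyperplane containing all proper steps carries an adapted basis
for the induced filtration, and a vector outside the hyperplane is put in front of it; it is needed
only for those steps that are the whole space. -/
theorem exists_isAdapted (n : ℕ) : ∀ {V : Type*} [AddCommGroup V] [Module K V]
    [FiniteDimensional K V] (_ : Module.finrank K V = n) {f : ℤ → Submodule K V} (_ : Antitone f),
    ∃ b : Module.Basis (Fin n) K V, IsAdapted f b := by
  induction n with
  | zero =>
    intro V _ _ _ hV f _
    have : Subsingleton V := Module.finrank_zero_iff.1 hV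
    refine ⟨Module.finBasisOfFinrankEq K V hV, fun p => ?_⟩
    exact Subsingleton.elim _ _
  | succ n ih =>
    intro V _ _ _ hV f hf
    have : Nontrivial V := Module.nontrivial_of_finrank_pos (R := K) (by omega)
    obtain ⟨P, hP, hfP⟩ := exists_proper_bound hf
    obtain ⟨H, hH, hPH⟩ := (eq_top_or_exists_le_coatom P).resolve_left hP
    obtain ⟨v, -, hv⟩ := SetLike.exists_of_lt (lt_top_iff_ne_top.2 hH.1)
    have hli : ∀ (c : K), ∀ x ∈ H, c • v + x = 0 → c = 0 := by
      intro c x hx h0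
      by_contra hc
      apply hv
      have : v = -(c⁻¹ • x) := by
        rw [eq_neg_iff_add_eq_zero, ← smul_right_injective V hc |>.eq_iff]
        simp only [smul_add, smul_smul, mul_inv_cancel₀ hc, one_smul, smul_zero, h0]
      rw [this]
      exact H.neg_mem (H.smul_mem _ hx)
    have hsp : ∀ z : V, ∃ c : K, z + c • v ∈ H := by
      intro z
      have h1 : H ⊔ Submodule.span K {v} = ⊤ := hH.2 _ (by
        refine lt_of_le_of_ne le_sup_left fun h => hv ?_
        rw [h]
        exact Submodule.mem_sup_right (Submodule.mem_span_singleton_self v))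
      obtain ⟨x, hx, y, hy, hxy⟩ := Submodule.mem_sup.1 (h1 ▸ Submodule.mem_top : z ∈ _)
      obtain ⟨c, rfl⟩ := Submodule.mem_span_singleton.1 hy
      refine ⟨-c, ?_⟩
      rw [← hxy, neg_smul, add_neg_cancel_right]
      exact hx
    have hHn : Module.finrank K H = n := by
      have h1 := Module.finrank_eq_card_basis
        (Module.Basis.mkFinCons v (Module.finBasis K H) hli hsp)
      rw [Fintype.card_fin, hV] at h1
      omega
    obtain ⟨b, hb⟩ := ih hHn (f := fun p => (f p).comap H.subtype)
      fun p p' hpp' => Submodule.comap_mono (hf hpp')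
    refine ⟨Module.Basis.mkFinCons v b hli hsp, fun p => ?_⟩
    by_cases hp : f p = ⊤
    · rw [hp, finrank_top, hV]
      rw [show {i : Fin (n + 1) | n + 1 ≤ (i : ℕ) + (n + 1)} = Set.univ by
        ext i; simp, Set.image_univ, Module.Basis.span_eq]
    · have hle : f p ≤ H := (hfP p hp).trans hPH
      have h1 : f p = ((f p).comap H.subtype).map H.subtype := by
        rw [Submodule.map_comap_subtype, inf_eq_right.2 hle]
      have h2 : Module.finrank K ((f p).comap H.subtype) = Module.finrank K (f p) := by
        conv_rhs => rw [h1]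
        exact (Submodule.finrank_map_subtype_eq H _).symm
      have h3 : Module.finrank K (f p) ≤ n := hHn ▸ Submodule.finrank_mono hle
      have h4 := hb p
      simp only at h4
      rw [h2] at h4
      conv_lhs => rw [h1, h4]
      rw [Submodule.map_span, Set.image_image]
      congr 1
      ext z
      constructor
      · rintro ⟨i, hi, rfl⟩
        refine ⟨i.succ, ?_, by simp [Module.Basis.coe_mkFinCons]⟩
        simp only [Set.mem_ofPred_eq, Fin.val_succ] at hi ⊢
        omega
      · rintro ⟨i, hi, rfl⟩
        rcases Fin.eq_zero_or_eq_succ i with rfl | ⟨j, rfl⟩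
        · simp only [Set.mem_ofPred_eq, Fin.val_zero] at hi
          omega
        · refine ⟨j, ?_, by simp [Module.Basis.coe_mkFinCons]⟩
          simp only [Set.mem_ofPred_eq, Fin.val_succ] at hi ⊢
          omega

end AdaptedBases

/-! ### Determinants with respect to rational bases -/

section RationalStructures

theorem span_image_span {K : Subfield ℂ} {V V' : Type*} [AddCommGroup V] [AddCommGroup V']
    [Module K V] [Module ℂ V'] (f : V →ₗ[K] V') (s : Set V) :
    Submodule.span ℂ (f '' (Submodule.span K s : Set V)) = Submodule.span ℂ (f '' s) := by
  refine le_antisymm (Submodule.span_le.2 ?_)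
    (Submodule.span_mono (Set.image_mono Submodule.subset_span))
  rw [← Submodule.map_coe, Submodule.map_span]
  exact Submodule.span_subset_span K ℂ _

theorem span_span_subfield {K : Subfield ℂ} {V : Type*} [AddCommGroup V]
    [Module ℂ V] (s : Set V) :
    Submodule.span ℂ (Submodule.span K s : Set V) = Submodule.span ℂ s :=
  Submodule.span_span_of_tower K ℂ s

theorem span_eq_of_span_subfield_eq {K : Subfield ℂ} {V : Type*} [AddCommGroup V]
    [Module ℂ V] {s s' : Set V} (h : Submodule.span K s = Submodule.span K s') :
    Submodule.span ℂ s = Submodule.span ℂ s' := by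
  rw [← span_span_subfield (K := K), h, span_span_subfield]

variable {V W : Type*} [AddCommGroup V] [Module ℂ V] [AddCommGroup W] [Module ℂ W]
variable {n : Type*} [Fintype n] [DecidableEq n]

/-- Each family is a `k`-combination of the other. Independence of `v` over `ℂ` forces one product
of the two transition matrices to be the identity, so their determinants are nonzero. -/
theorem exists_transition {k : Subfield ℂ} {v v' : n → V} (hv : LinearIndependent ℂ v)
    (h : Submodule.span k (Set.range v) = Submodule.span k (Set.range v')) :
    ∃ Q : Matrix n n k, Q.det ≠ 0 ∧ ∀ j, v' j = ∑ i, (Q i j : ℂ) • v i := by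
  have h1 : ∀ j, ∃ c : n → k, ∑ i, c i • v i = v' j := fun j =>
    Submodule.mem_span_range_iff_exists_fun k |>.1 (h ▸ Submodule.subset_span ⟨j, rfl⟩)
  have h2 : ∀ j, ∃ c : n → k, ∑ i, c i • v' i = v j := fun j =>
    Submodule.mem_span_range_iff_exists_fun k |>.1 (h.symm ▸ Submodule.subset_span ⟨j, rfl⟩)
  choose c hc using h1
  choose c' hc' using h2
  have hmul : (Matrix.of fun i j => c j i) * (Matrix.of fun i j => c' j i) = (1 : Matrix n n k) := by
    ext i j
    have h3 : ∑ i, (((Matrix.of fun i j => c j i) * (Matrix.of fun i j => c' j i) :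
        Matrix n n k) i j : ℂ) • v i = ∑ i, ((1 : Matrix n n k) i j : ℂ) • v i := by
      trans v j
      · rw [← hc' j]
        simp only [← hc, Matrix.mul_apply, Matrix.of_apply]
        simp only [Finset.smul_sum, AddSubmonoidClass.coe_finsetSum, Finset.sum_smul]
        rw [Finset.sum_comm]
        refine Finset.sum_congr rfl fun a _ => Finset.sum_congr rfl fun b _ => ?_
        change _ = (c' j a : ℂ) • (c a b : ℂ) • v b
        rw [smul_smul, mul_comm]
        rfl
      · rw [Finset.sum_eq_single j]
        · simp
        · intro b _ hb
          simp [Matrix.one_apply_ne hb]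
        · simp
    have h4 := (Fintype.linearIndependent_iff.1 hv) (fun i =>
      (((Matrix.of fun i j => c j i) * (Matrix.of fun i j => c' j i) :
        Matrix n n k) i j : ℂ) - ((1 : Matrix n n k) i j : ℂ)) (by
        simp only [sub_smul, Finset.sum_sub_distrib]
        rw [h3, sub_self]) i
    exact sub_eq_zero.1 h4
  refine ⟨Matrix.of fun i j => c j i, fun h0 => ?_, fun j => (hc j).symm⟩
  have h5 := congrArg Matrix.det hmul
  rw [Matrix.det_mul, h0, zero_mul, Matrix.det_one] at h5
  exact zero_ne_one h5

/-- The determinant of a linear map with respect to rational bases is well-defined up to a factor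
in `K`. -/
theorem simUpTo_det {k K : Subfield ℂ} (hkK : k ≤ K) (f : V →ₗ[ℂ] W) {v v' : n → V} {w w' : n → W}
    (hv : LinearIndependent ℂ v)
    (hw' : LinearIndependent ℂ w')
    (hvv : Submodule.span k (Set.range v) = Submodule.span k (Set.range v'))
    (hww : Submodule.span K (Set.range w) = Submodule.span K (Set.range w'))
    {Z Z' : Matrix n n ℂ} (hZ : ∀ j, f (v j) = ∑ i, Z i j • w i)
    (hZ' : ∀ j, f (v' j) = ∑ i, Z' i j • w' i) : SimUpTo K Z'.det Z.det := by
  obtain ⟨Q, hQ, hQv⟩ := exists_transition hv hvv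
  obtain ⟨P, hP, hPw⟩ := exists_transition hw' hww.symm
  have key : Z' = P.map (fun x => (x : ℂ)) * Z * Q.map (fun x => (x : ℂ)) := by
    ext i j
    have h1 : f (v' j) = ∑ i, (P.map (fun x => (x : ℂ)) * Z * Q.map (fun x => (x : ℂ))) i j • w' i := by
      rw [hQv j, map_sum]
      simp only [map_smul, hZ, hPw, Matrix.mul_apply, Matrix.map_apply, Finset.smul_sum,
        Finset.sum_smul, Finset.sum_mul, smul_smul]
      rw [Finset.sum_congr rfl fun a _ => Finset.sum_comm, Finset.sum_comm]
      refine Finset.sum_congr rfl fun a _ => Finset.sum_congr rfl fun b _ =>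
        Finset.sum_congr rfl fun c _ => ?_
      congr 1
      ring
    have h4 := (Fintype.linearIndependent_iff.1 hw') (fun i => Z' i j -
      (P.map (fun x => (x : ℂ)) * Z * Q.map (fun x => (x : ℂ))) i j) (by
        simp only [sub_smul, Finset.sum_sub_distrib]
        rw [← hZ', h1, sub_self]) i
    exact sub_eq_zero.1 h4
  have hPd : (P.map (fun x => (x : ℂ))).det = (P.det : ℂ) := (RingHom.map_det K.subtype P).symm
  have hQd : (Q.map (fun x => (x : ℂ))).det = (Q.det : ℂ) := (RingHom.map_det k.subtype Q).symm
  refine ⟨(P.det : ℂ) * (Q.det : ℂ), K.mul_mem P.det.2 (hkK Q.det.2), mul_ne_zero ?_ ?_, ?_⟩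
  · exact fun h => hP (Subtype.ext h)
  · exact fun h => hQ (Subtype.ext h)
  · rw [key, Matrix.det_mul, Matrix.det_mul, hPd, hQd]
    ring

end RationalStructures
end YoshidaPeriods

namespace YoshidaPeriods

/-! ### Generators of Betti and de Rham spaces, and the involution -/

theorem pi_span_eq {R O : Type*} [Ring R] [Finite O] [DecidableEq O] {A : O → Type*}
    [∀ o, AddCommGroup (A o)] [∀ o, Module R (A o)] (S : ∀ o, Set (A o)) :
    Submodule.pi Set.univ (fun o => Submodule.span R (S o)) =
      Submodule.span R {z | ∃ o, ∃ s ∈ S o, z = Pi.single o s} := by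
  rw [← Submodule.iSup_map_single]
  refine le_antisymm (iSup_le fun o => ?_) (Submodule.span_le.2 ?_)
  · rw [Submodule.map_span]
    refine Submodule.span_mono ?_
    rintro _ ⟨s, hs, rfl⟩
    exact ⟨o, s, hs, rfl⟩
  · rintro _ ⟨o, s, hs, rfl⟩
    exact Submodule.mem_iSup_of_mem o ⟨s, Submodule.subset_span hs, rfl⟩

section IsBaseChangeLemmas

variable {K : Subfield ℂ} {V V' : Type*} [AddCommGroup V] [AddCommGroup V'] [Module K V]
  [Module ℂ V'] {f : V →ₗ[K] V'}

/-- Extend the family to a `K`-basis; base change turns this into a `ℂ`-basis. -/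
theorem linearIndependent_of_isBaseChange (hf : IsBaseChange ℂ f) {ι : Type*} {v : ι → V}
    (hv : LinearIndependent K v) : LinearIndependent ℂ (f ∘ v) := by
  have h1 := (hf.basis (Module.Basis.sumExtend hv)).linearIndependent.comp Sum.inl Sum.inl_injective
  have h2 : f ∘ v = (hf.basis (Module.Basis.sumExtend hv)) ∘ Sum.inl := by
    funext i
    simp only [Function.comp_apply, IsBaseChange.basis_apply]
    congr 1
    simp only [Module.Basis.sumExtend, Module.Basis.reindex_apply, Module.Basis.extend_apply_self]
    rfl
  rwa [h2]

theorem finrank_span_image_of_isBaseChange (hf : IsBaseChange ℂ f) [FiniteDimensional K V]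
    (P : Submodule K V) :
    Module.finrank ℂ (Submodule.span ℂ (f '' (P : Set V))) = Module.finrank K P := by
  let b := Module.finBasis K P
  have h1 : LinearIndependent K (P.subtype ∘ b) :=
    b.linearIndependent.map' _ (LinearMap.ker_eq_bot.2 P.injective_subtype)
  have h2 : P = Submodule.span K (Set.range (P.subtype ∘ b)) := by
    rw [Set.range_comp, ← Submodule.map_span, b.span_eq, Submodule.map_top, Submodule.range_subtype]
  conv_lhs => rw [h2]
  rw [span_image_span, ← Set.range_comp,
    finrank_span_eq_card (linearIndependent_of_isBaseChange hf h1), Fintype.card_fin]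

end IsBaseChangeLemmas

/-- For an involution, `1 + δ F` is twice the projector onto the eigenspace of `δ`. As an image, the
eigenspace is compatible with passing to generators, which a kernel is not. -/
theorem eigenspace_eq_map {k V : Type*} [Field k] [CharZero k] [AddCommGroup V] [Module k V]
    (F : V →ₗ[k] V) (hF : ∀ x, F (F x) = x) (δ : ℤˣ) :
    Module.End.eigenspace F ((δ : ℤ) : k) =
      (⊤ : Submodule k V).map (LinearMap.id + ((δ : ℤ) : k) • F) := by
  have hδ : ((δ : ℤ) : k) * ((δ : ℤ) : k) = 1 := by
    rcases Int.units_eq_one_or δ with h | h <;> simp [h]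
  ext x
  rw [Module.End.mem_eigenspace_iff]
  constructor
  · intro hx
    refine ⟨(2 : k)⁻¹ • x, trivial, ?_⟩
    simp only [LinearMap.add_apply, LinearMap.id_apply, LinearMap.smul_apply, map_smul, hx]
    rw [smul_comm, smul_smul _ _ x, hδ, one_smul, ← two_smul k, smul_smul,
      inv_mul_cancel₀ (two_ne_zero (α := k)), one_smul]
  · rintro ⟨y, -, rfl⟩
    simp only [LinearMap.add_apply, LinearMap.id_apply, LinearMap.smul_apply, map_add, map_smul, hF,
      smul_add, smul_smul, hδ, one_smul]
    abel

namespace BaseChange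

variable {R : Type uR} {S : Type uS} {T : Type uT} [CommRing R] [CommRing S] [CommRing T]
variable (f : R →+* S) (g : S →+* T) (h : R →+* T)
variable {V : Type uV} {W : Type uW} [AddCommGroup V] [Module R V] [AddCommGroup W] [Module R W]

theorem push_map (H : h = g.comp f) (φ : V →ₗ[R] W) (x : BaseChange f V) :
    push f g h H (map f φ x) = map h φ (push f g h H x) := by
  have hx : x ∈ Submodule.span S (Set.range (incl (V := V) f)) := by
    rw [span_range_incl]; trivial
  induction hx using Submodule.span_induction with
  | mem x hx =>
    obtain ⟨v, rfl⟩ := hx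
    rw [map_incl, push_incl, push_incl, map_incl]
  | zero => simp only [map_zero]
  | add x y _ _ hx hy => simp only [map_add, hx, hy]
  | smul r x _ hx => simp only [LinearMap.map_smulₛₗ, map_smul, hx]

theorem map_map_symm (φ : V ≃ₗ[R] W) (x : BaseChange f V) :
    map f φ.symm.toLinearMap (map f φ.toLinearMap x) = x := by
  have : (map f φ.symm.toLinearMap) ∘ₗ (map f φ.toLinearMap) = LinearMap.id := by
    refine hom_ext f fun v => ?_
    rw [LinearMap.comp_apply, map_incl, map_incl]
    simp
  exact congrArg (fun ψ => ψ x) this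

end BaseChange

namespace Realization

variable {F : Type uF} {E : Type uE} [Field F] [CharZero F] [Field E] [CharZero E]
variable (M N : Realization.{uF, uE, uB, uD} F E) (τ : F →+* ℂ) (σ : E →+* ℂ)

section Generators

variable {τ}

open Classical in
/-- The vector of `T_{τ, σ}(M)` with component `x ⊗ 1` at `τ'`. -/
def genT (τ' : Orbit τ) (x : M.HdR) : M.T τ σ :=
  (Pi.single τ' (BaseChange.incl _ x) : ∀ τ' : Orbit τ, BaseChange (pairingField σ τ') M.HdR)

open Classical in
/-- The vector of `T_{τ, σ}(M) ⊗ ℂ` with component `x ⊗ 1` at `τ'`. -/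
def genTC (τ' : Orbit τ) (x : M.HdR) : M.TC τ σ :=
  (Pi.single τ' (BaseChange.incl _ x) : ∀ τ' : Orbit τ, BaseChange (pairing σ τ'.1) M.HdR)

open Classical in
/-- The vector of `B_σ(M_τ)` with component `x ⊗ 1` at `τ'`. -/
def genB (τ' : Orbit τ) (x : M.HB τ'.1) : M.B τ σ :=
  (Pi.single τ' (BaseChange.incl _ x) :
    ∀ τ' : Orbit τ, BaseChange σ.rangeRestrictField (M.HB τ'.1))

open Classical in
/-- The vector of `B_σ(M_τ) ⊗ ℂ` with component `x ⊗ 1` at `τ'`. -/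
def genBC (τ' : Orbit τ) (x : M.HB τ'.1) : M.BC τ σ :=
  (Pi.single τ' (BaseChange.incl _ x) : ∀ τ' : Orbit τ, BaseChange σ (M.HB τ'.1))

theorem genT_same (a : Orbit τ) (x : M.HdR) : M.genT σ a x a = BaseChange.incl _ x := by
  classical exact Pi.single_eq_same _ _

theorem genT_of_ne {a b : Orbit τ} (h : b ≠ a) (x : M.HdR) : M.genT σ a x b = 0 := by
  classical exact Pi.single_eq_of_ne h _

theorem genTC_same (a : Orbit τ) (x : M.HdR) : M.genTC σ a x a = BaseChange.incl _ x := by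
  classical exact Pi.single_eq_same _ _

theorem genTC_of_ne {a b : Orbit τ} (h : b ≠ a) (x : M.HdR) : M.genTC σ a x b = 0 := by
  classical exact Pi.single_eq_of_ne h _

theorem genB_same (a : Orbit τ) (x : M.HB a.1) : M.genB σ a x a = BaseChange.incl _ x := by
  classical exact Pi.single_eq_same _ _

theorem genB_of_ne {a b : Orbit τ} (h : b ≠ a) (x : M.HB a.1) : M.genB σ a x b = 0 := by
  classical exact Pi.single_eq_of_ne h _

theorem genBC_same (a : Orbit τ) (x : M.HB a.1) : M.genBC σ a x a = BaseChange.incl _ x := by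
  classical exact Pi.single_eq_same _ _

theorem genBC_of_ne {a b : Orbit τ} (h : b ≠ a) (x : M.HB a.1) : M.genBC σ a x b = 0 := by
  classical exact Pi.single_eq_of_ne h _

theorem inclT_genT (τ' : Orbit τ) (x : M.HdR) : M.inclT τ σ (M.genT σ τ' x) = M.genTC σ τ' x := by
  funext a
  change BaseChange.push _ _ _ (pairing_eq_pairingField σ a) (M.genT σ τ' x a) = M.genTC σ τ' x a
  by_cases h : a = τ'
  · subst h
    rw [genT_same, genTC_same, BaseChange.push_incl]
  · rw [genT_of_ne M σ h, genTC_of_ne M σ h, map_zero]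

theorem inclB_genB (τ' : Orbit τ) (x : M.HB τ'.1) :
    M.inclB τ σ (M.genB σ τ' x) = M.genBC σ τ' x := by
  funext a
  change BaseChange.push σ.rangeRestrictField σ.fieldRange.subtype σ rfl (M.genB σ τ' x a) = M.genBC σ τ' x a
  by_cases h : a = τ'
  · subst h
    rw [genB_same, genBC_same]
    exact BaseChange.push_incl σ.rangeRestrictField σ.fieldRange.subtype σ rfl _
  · rw [genB_of_ne M σ h, genBC_of_ne M σ h, map_zero]

variable (τ) in
theorem TFil_eq_span (p : ℤ) :
    M.TFil τ σ p = Submodule.span (periodField τ σ) {z | ∃ a, ∃ x ∈ M.Fil p, z = M.genT σ a x} := by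
  classical
  refine Eq.trans ?_ ((pi_span_eq (R := periodField τ σ) fun τ' : Orbit τ =>
    BaseChange.incl (pairingField σ τ') '' (M.Fil p : Set M.HdR)).trans ?_)
  · ext z
    exact ⟨fun h a _ => h a, fun h a => h a trivial⟩
  · congr 1
    ext z
    constructor
    · rintro ⟨a, _, ⟨x, hx, rfl⟩, rfl⟩
      exact ⟨a, x, hx, rfl⟩
    · rintro ⟨a, x, hx, rfl⟩
      exact ⟨a, _, ⟨x, hx, rfl⟩, rfl⟩

variable (τ) in
/-- The Hodge filtration of `T_{τ, σ}(M) ⊗ ℂ`. -/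
def TCFil (p : ℤ) : Submodule ℂ (M.TC τ σ) :=
  Submodule.pi (φ := fun τ' : Orbit τ => BaseChange (pairing σ τ'.1) M.HdR) Set.univ
    fun τ' => BaseChange.sub (pairing σ τ'.1) (M.Fil p)

variable (τ) in
theorem TCFil_eq_span (p : ℤ) :
    M.TCFil τ σ p = Submodule.span ℂ {z | ∃ a, ∃ x ∈ M.Fil p, z = M.genTC σ a x} := by
  classical
  refine (pi_span_eq (R := ℂ) fun τ' : Orbit τ =>
    BaseChange.incl (pairing σ τ'.1) '' (M.Fil p : Set M.HdR)).trans ?_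
  congr 1
  ext z
  constructor
  · rintro ⟨a, _, ⟨x, hx, rfl⟩, rfl⟩
    exact ⟨a, x, hx, rfl⟩
  · rintro ⟨a, x, hx, rfl⟩
    exact ⟨a, _, ⟨x, hx, rfl⟩, rfl⟩

theorem span_genT : Submodule.span (periodField τ σ) {z | ∃ a x, z = M.genT (τ := τ) σ a x} = ⊤ := by
  classical
  refine Eq.trans ?_ ((pi_span_eq (R := periodField τ σ) fun τ' : Orbit τ =>
    Set.range (BaseChange.incl (V := M.HdR) (pairingField σ τ'))).symm.trans ?_)
  · congr 1
    ext z
    constructor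
    · rintro ⟨a, x, rfl⟩
      exact ⟨a, _, ⟨x, rfl⟩, rfl⟩
    · rintro ⟨a, _, ⟨x, rfl⟩, rfl⟩
      exact ⟨a, x, rfl⟩
  · simp only [BaseChange.span_range_incl]
    exact Submodule.pi_top _

theorem span_genB : Submodule.span σ.fieldRange
    {z | ∃ (a : Orbit τ) (x : M.HB a.1), z = M.genB σ a x} = ⊤ := by
  classical
  refine Eq.trans ?_ ((pi_span_eq (R := σ.fieldRange) fun τ' : Orbit τ =>
    Set.range (BaseChange.incl (V := M.HB τ'.1) σ.rangeRestrictField)).symm.trans ?_)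
  · congr 1
    ext z
    constructor
    · rintro ⟨a, x, rfl⟩
      exact ⟨a, _, ⟨x, rfl⟩, rfl⟩
    · rintro ⟨a, _, ⟨x, rfl⟩, rfl⟩
      exact ⟨a, x, rfl⟩
  · simp only [BaseChange.span_range_incl]
    exact Submodule.pi_top _

theorem span_image_TFil (p : ℤ) :
    Submodule.span ℂ (M.inclT τ σ '' (M.TFil τ σ p : Set (M.T τ σ))) = M.TCFil τ σ p := by
  rw [TFil_eq_span, span_image_span, TCFil_eq_span]
  congr 1
  ext z
  constructor
  · rintro ⟨_, ⟨a, x, hx, rfl⟩, rfl⟩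
    exact ⟨a, x, hx, inclT_genT M σ a x⟩
  · rintro ⟨a, x, hx, rfl⟩
    exact ⟨_, ⟨a, x, hx, rfl⟩, inclT_genT M σ a x⟩

end Generators

section Involution

variable {τ}

theorem _root_.YoshidaPeriods.Orbit.eq_conj {F : Type uF} [Field F] {τ : F →+* ℂ} {τ' τ'' : Orbit τ}
    (h : τ'.1 = ComplexEmbedding.conjugate τ''.1) :
    τ'' = τ'.conj :=
  Subtype.ext (by
    change τ''.1 = ComplexEmbedding.conjugate τ'.1
    rw [h]
    exact (star_star τ''.1).symm)

/-- The components live in types that depend on the embedding. An arbitrary proof of conjugacy is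
allowed here so that later rewriting does not depend on how the conjugate embedding is presented. -/
theorem involution_apply (z : M.B τ σ) (τ' τ'' : Orbit τ)
    (h : τ'.1 = ComplexEmbedding.conjugate τ''.1) :
    M.involution τ σ z τ' =
      BaseChange.map σ.rangeRestrictField (M.Finf τ''.1 τ'.1 h).toLinearMap (z τ'') := by
  obtain rfl := Orbit.eq_conj h
  rfl

theorem involution_involution (z : M.B τ σ) : M.involution τ σ (M.involution τ σ z) = z := by
  funext a
  rw [involution_apply M σ _ a a.conj a.eq_conjugate_conj, involution_apply M σ _ a.conj a rfl,
    ← M.Finf_symm a.1 a.conj.1 rfl]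
  exact BaseChange.map_map_symm _ _ _

variable (τ) in
/-- The complexification of `involution`. -/
def involutionC : M.BC τ σ →ₗ[ℂ] M.BC τ σ where
  toFun x τ' := BaseChange.map σ
    (M.Finf τ'.conj.1 τ'.1 τ'.eq_conjugate_conj).toLinearMap (x τ'.conj)
  map_add' x y := by
    funext τ'
    exact map_add _ _ _
  map_smul' r x := by
    funext τ'
    exact LinearMap.map_smul _ _ _

theorem involutionC_apply (z : M.BC τ σ) (τ' τ'' : Orbit τ)
    (h : τ'.1 = ComplexEmbedding.conjugate τ''.1) :
    M.involutionC τ σ z τ' =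
      BaseChange.map σ (M.Finf τ''.1 τ'.1 h).toLinearMap (z τ'') := by
  obtain rfl := Orbit.eq_conj h
  rfl

theorem involutionC_involutionC (z : M.BC τ σ) : M.involutionC τ σ (M.involutionC τ σ z) = z := by
  funext a
  rw [involutionC_apply M σ _ a a.conj a.eq_conjugate_conj, involutionC_apply M σ _ a.conj a rfl,
    ← M.Finf_symm a.1 a.conj.1 rfl]
  exact BaseChange.map_map_symm _ _ _

theorem involutionC_inclB (z : M.B τ σ) :
    M.involutionC τ σ (M.inclB τ σ z) = M.inclB τ σ (M.involution τ σ z) := by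
  funext a
  exact (BaseChange.push_map σ.rangeRestrictField σ.fieldRange.subtype σ rfl _ _).symm

theorem mem_Bsign {δ : ℤˣ} {z : M.B τ σ} :
    z ∈ M.Bsign τ σ δ ↔ M.involution τ σ z = ((δ : ℤ) : σ.fieldRange) • z :=
  Module.End.mem_eigenspace_iff

theorem Bsign_eq_map (δ : ℤˣ) : M.Bsign τ σ δ =
    (⊤ : Submodule σ.fieldRange (M.B τ σ)).map
      (LinearMap.id + ((δ : ℤ) : σ.fieldRange) • M.involution τ σ) :=
  eigenspace_eq_map _ (M.involution_involution σ) δ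

theorem involutionC_of_mem {δ : ℤˣ} {z : M.BC τ σ}
    (hz : z ∈ Submodule.span ℂ (M.inclB τ σ '' (M.Bsign τ σ δ : Set (M.B τ σ)))) :
    M.involutionC τ σ z = ((δ : ℤ) : ℂ) • z := by
  induction hz using Submodule.span_induction with
  | mem x hx =>
    obtain ⟨v, hv, rfl⟩ := hx
    rw [involutionC_inclB, (M.mem_Bsign σ).1 hv, map_smul]
    rfl
  | zero => simp only [map_zero, smul_zero]
  | add x y _ _ hx hy => simp only [map_add, hx, hy, smul_add]
  | smul r x _ hx => rw [map_smul, hx, smul_comm]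

end Involution

end Realization
end YoshidaPeriods

namespace YoshidaPeriods

/-! ### Hodge decomposition and dimensions of eigenspaces -/

section Gradings

variable {R V : Type*} [Ring R] [AddCommGroup V] [Module R V] {A : ℤ → Submodule R V}

theorem isCompl_of_isInternal (h : DirectSum.IsInternal A) (p : ℤ) :
    IsCompl (⨆ i ≥ p, A i) (⨆ i ≤ p - 1, A i) := by
  refine ⟨h.submodule_iSupIndep.disjoint_biSup_biSup (s := Set.Ici p) (t := Set.Iic (p - 1))
    (Set.disjoint_left.2 fun i h1 h2 => ?_), codisjoint_iff.2 (top_le_iff.1 ?_)⟩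
  · rw [Set.mem_Ici] at h1
    rw [Set.mem_Iic] at h2
    omega
  · rw [← h.submodule_iSup_eq_top]
    refine iSup_le fun i => ?_
    rcases le_or_gt p i with hi | hi
    · exact le_sup_of_le_left (le_iSup₂_of_le i hi le_rfl)
    · exact le_sup_of_le_right (le_iSup₂_of_le i (by omega) le_rfl)

theorem mem_of_mem_of_mem (h : DirectSum.IsInternal A) {p : ℤ} {x : V} (h1 : x ∈ ⨆ i ≥ p, A i)
    (h2 : x ∈ ⨆ i ≤ p, A i) : x ∈ A p := by
  have h3 : (⨆ i ≥ p, A i) ≤ A p ⊔ ⨆ i ≥ p + 1, A i := by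
    refine iSup₂_le fun i hi => ?_
    rcases eq_or_ne i p with rfl | hne
    · exact le_sup_left
    · exact le_sup_of_le_right (le_iSup₂_of_le i (by omega) le_rfl)
  obtain ⟨a, ha, b, hb, rfl⟩ := Submodule.mem_sup.1 (h3 h1)
  have h4 : b ∈ ⨆ i ≤ p + 1 - 1, A i := by
    rw [add_sub_cancel_right]
    simpa using Submodule.sub_mem _ h2 ((le_iSup₂_of_le p le_rfl le_rfl : A p ≤ ⨆ i ≤ p, A i) ha)
  rw [(Submodule.disjoint_def.1 (isCompl_of_isInternal h (p + 1)).disjoint) b hb h4, add_zero]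
  exact ha

theorem isCompl_pi {O : Type*} {V : O → Type*} [∀ o, AddCommGroup (V o)] [∀ o, Module R (V o)]
    {P Q : ∀ o, Submodule R (V o)} (h : ∀ o, IsCompl (P o) (Q o)) :
    IsCompl (Submodule.pi Set.univ P) (Submodule.pi Set.univ Q) := by
  refine ⟨Submodule.disjoint_def.2 fun x h1 h2 => funext fun o => ?_,
    codisjoint_iff.2 (top_le_iff.1 fun x _ => ?_)⟩
  · exact Submodule.disjoint_def.1 (h o).disjoint _ (h1 o trivial) (h2 o trivial)
  · have h3 : ∀ o, ∃ y ∈ P o, ∃ z ∈ Q o, y + z = x o := fun o =>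
      Submodule.mem_sup.1 ((h o).sup_eq_top ▸ Submodule.mem_top)
    choose y hy z hz hyz using h3
    exact Submodule.mem_sup.2 ⟨y, fun o _ => hy o, z, fun o _ => hz o, funext hyz⟩

end Gradings

theorem isCompl_eigenspace {k V : Type*} [Field k] [CharZero k] [AddCommGroup V] [Module k V]
    (F : V →ₗ[k] V) (hF : ∀ x, F (F x) = x) (δ : ℤˣ) :
    IsCompl (Module.End.eigenspace F ((δ : ℤ) : k)) (Module.End.eigenspace F (((-δ : ℤˣ) : ℤ) : k)) := by
  have hδ : ((δ : ℤ) : k) ≠ 0 := by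
    rcases Int.units_eq_one_or δ with h | h <;> simp [h]
  refine ⟨Submodule.disjoint_def.2 fun x h1 h2 => ?_, codisjoint_iff.2 (top_le_iff.1 fun x _ => ?_)⟩
  · rw [Module.End.mem_eigenspace_iff] at h1 h2
    rw [h1, Units.val_neg, Int.cast_neg, neg_smul, eq_neg_iff_add_eq_zero, ← two_smul k,
      smul_eq_zero, smul_eq_zero] at h2
    exact (h2.resolve_left two_ne_zero).resolve_left hδ
  · rw [eigenspace_eq_map F hF, eigenspace_eq_map F hF]
    refine Submodule.mem_sup.2 ⟨_, ⟨(2 : k)⁻¹ • x, trivial, rfl⟩, _, ⟨(2 : k)⁻¹ • x, trivial, rfl⟩, ?_⟩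
    simp only [LinearMap.add_apply, LinearMap.id_apply, LinearMap.smul_apply, Units.val_neg,
      Int.cast_neg, neg_smul, LinearMap.neg_apply]
    rw [add_add_add_comm, add_neg_cancel, add_zero, ← two_smul k, smul_smul,
      mul_inv_cancel₀ (two_ne_zero (α := k)), one_smul]

theorem finite_baseChange {R : Type uR} {S : Type uS} [CommRing R] [CommRing S] (f : R →+* S)
    (V : Type uV) [AddCommGroup V] [Module R V] [Module.Finite R V] :
    Module.Finite S (BaseChange f V) :=
  letI := f.toAlgebra
  (inferInstance : Module.Finite S (S ⊗[R] V))

namespace Realization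

variable {F : Type uF} {E : Type uE} [Field F] [CharZero F] [Field E] [CharZero E]
variable (M : Realization.{uF, uE, uB, uD} F E) (τ : F →+* ℂ) (σ : E →+* ℂ)

/-- The dimensions of the steps of the Hodge filtration of `T_{τ, σ}(M)`. -/
def filDim (p : ℤ) : ℕ := Module.finrank (periodField τ σ) (M.TFil τ σ p)

theorem TFil_antitone : Antitone (M.TFil τ σ) := fun _ _ h _ hx a =>
  BaseChange.sub_mono _ (M.Fil_antitone h) (hx a)

theorem isStep_filDim [FiniteDimensional (periodField τ σ) (M.T τ σ)] :
    IsStep (M.filDim τ σ) (M.dStar τ σ) where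
  antitone p p' h := Submodule.finrank_mono (M.TFil_antitone τ σ h)
  exists_top := by
    obtain ⟨a, ha⟩ := M.Fil_exhaustive
    refine ⟨a, fun p hp => ?_⟩
    have h1 : M.TFil τ σ p = ⊤ := by
      have h2 : M.Fil p = ⊤ := top_le_iff.1 (ha ▸ M.Fil_antitone hp)
      refine top_le_iff.1 fun x _ => fun b => ?_
      have h3 : BaseChange.sub (pairingField σ b) (M.Fil p) = ⊤ := by rw [h2, BaseChange.sub_top]
      exact h3 ▸ Submodule.mem_top
    rw [filDim, h1, finrank_top]
    rfl
  exists_bot := by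
    obtain ⟨b, hb⟩ := M.Fil_separated
    refine ⟨b, fun p hp => ?_⟩
    have h1 : M.TFil τ σ p = ⊥ := by
      have h2 : M.Fil p = ⊥ := le_bot_iff.1 (hb ▸ M.Fil_antitone hp)
      refine le_bot_iff.1 fun x hx => funext fun a => ?_
      have h3 : BaseChange.sub (pairingField σ a) (M.Fil p) = ⊥ := by rw [h2, BaseChange.sub_bot]
      exact (Submodule.mem_bot _).1 (h3 ▸ hx a)
    rw [filDim, h1, finrank_bot]

theorem isJumps_filDim [FiniteDimensional (periodField τ σ) (M.T τ σ)] :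
    IsJumps (M.filDim τ σ) (M.jump τ σ) (M.grDim τ σ) where
  strictMono := ((M.jumpSet_finite τ σ).toFinset.orderEmbOfFin rfl).strictMono
  mem_range p := by
    have h1 : Set.range (M.jump τ σ) = M.jumpSet τ σ :=
      (Finset.range_orderEmbOfFin _ rfl).trans (Set.Finite.coe_toFinset _)
    rw [h1]
    refine not_congr ⟨fun h => by rw [filDim, filDim, h], fun h => ?_⟩
    exact Submodule.eq_of_le_of_finrank_eq (M.TFil_antitone τ σ (by omega)) h
  height _ := rfl

end Realization

namespace PureMotive

variable {F : Type uF} {E : Type uE} [Field F] [CharZero F] [Field E] [CharZero E]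
variable (M : PureMotive.{uF, uE, uB, uD} F E) (τ : F →+* ℂ) (σ : E →+* ℂ)

/-- Positivity of the rank gives finiteness, as `finrank` is zero for a free module of infinite
rank. -/
theorem finite_HdR : Module.Finite (E ⊗[ℚ] F) M.HdR := by
  have := M.free_HdR
  exact Module.finite_of_finrank_pos (by rw [M.finrank_HdR]; exact M.rank_pos)

theorem finite_HB : FiniteDimensional E (M.HB τ) :=
  FiniteDimensional.of_finrank_pos (by rw [M.finrank_HB]; exact M.rank_pos)

instance finite_T : FiniteDimensional (periodField τ σ) (M.T τ σ) := by
  have := M.finite_HdR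
  have : ∀ a : Orbit τ, FiniteDimensional (periodField τ σ) (BaseChange (pairingField σ a) M.HdR) :=
    fun a => finite_baseChange _ _
  exact inferInstanceAs (FiniteDimensional (periodField τ σ)
    (∀ a : Orbit τ, BaseChange (pairingField σ a) M.HdR))

instance finite_B : FiniteDimensional σ.fieldRange (M.B τ σ) := by
  have := M.finite_HB
  have : ∀ a : Orbit τ, FiniteDimensional σ.fieldRange (BaseChange σ.rangeRestrictField (M.HB a.1)) :=
    fun a => finite_baseChange _ _
  exact inferInstanceAs (FiniteDimensional σ.fieldRange
    (∀ a : Orbit τ, BaseChange σ.rangeRestrictField (M.HB a.1)))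

instance finite_BC : FiniteDimensional ℂ (M.BC τ σ) :=
  Module.Finite.of_basis ((M.isBaseChange_inclB τ σ).basis (Module.finBasis σ.fieldRange (M.B τ σ)))

theorem finrank_TC : Module.finrank ℂ (M.TC τ σ) = M.dStar τ σ := by
  rw [Module.finrank_eq_card_basis ((M.isBaseChange_inclT τ σ).basis
    (Module.finBasis (periodField τ σ) (M.T τ σ))), Fintype.card_fin]
  rfl

theorem finrank_BC : Module.finrank ℂ (M.BC τ σ) = M.dStar τ σ := by
  rw [(M.I0 τ σ).finrank_eq, finrank_TC]

theorem finrank_B : Module.finrank σ.fieldRange (M.B τ σ) = M.dStar τ σ := by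
  rw [← finrank_BC, Module.finrank_eq_card_basis ((M.isBaseChange_inclB τ σ).basis
    (Module.finBasis σ.fieldRange (M.B τ σ))), Fintype.card_fin]

theorem dSign_add (δ : ℤˣ) : M.dSign τ σ δ + M.dSign τ σ (-δ) = M.dStar τ σ := by
  rw [← M.finrank_B τ σ]
  exact Submodule.finrank_add_eq_of_isCompl
    (isCompl_eigenspace _ (M.involution_involution σ) δ)

/-- The sum of the `H^{i, w - i}` with `i ≥ p`. -/
def hodgeFil (p : ℤ) : Submodule ℂ (M.BC τ σ) :=
  Submodule.pi (φ := fun a : Orbit τ => BaseChange σ (M.HB a.1)) Set.univ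
    fun a => ⨆ i ≥ p, M.hodge a.1 σ i

/-- The sum of the `H^{i, w - i}` with `i ≤ p`. -/
def hodgeLow (p : ℤ) : Submodule ℂ (M.BC τ σ) :=
  Submodule.pi (φ := fun a : Orbit τ => BaseChange σ (M.HB a.1)) Set.univ
    fun a => ⨆ i ≤ p, M.hodge a.1 σ i

theorem isCompl_hodge (p : ℤ) : IsCompl (M.hodgeFil τ σ p) (M.hodgeLow τ σ (p - 1)) :=
  isCompl_pi fun a => isCompl_of_isInternal (M.hodge_internal a.1 σ) p

theorem map_hodgeFil (p : ℤ) : (M.hodgeFil τ σ p).map (M.I0 τ σ).toLinearMap = M.TCFil τ σ p := by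
  ext z
  constructor
  · rintro ⟨x, hx, rfl⟩ a -
    exact (M.Fil_eq a.1 σ p).ge ⟨x a, hx a trivial, rfl⟩
  · intro hz
    refine ⟨(M.I0 τ σ).symm z, fun a _ => ?_, (M.I0 τ σ).apply_symm_apply z⟩
    obtain ⟨x, hx, hxz⟩ := (M.Fil_eq a.1 σ p).le (hz a trivial)
    have h2 : (M.I0 τ σ).symm z a = x := by
      change (M.comparison a.1 σ).symm (z a) = x
      rw [← hxz]
      exact LinearEquiv.symm_apply_apply _ _
    rw [h2]
    exact hx

theorem finrank_hodgeFil (p : ℤ) : Module.finrank ℂ (M.hodgeFil τ σ p) = M.filDim τ σ p := by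
  rw [Realization.filDim, ← finrank_span_image_of_isBaseChange (M.isBaseChange_inclT τ σ),
    Realization.span_image_TFil, ← map_hodgeFil]
  exact ((M.I0 τ σ).finrank_map_eq _).symm

theorem involutionC_mem_hodgeLow {p : ℤ} {z : M.BC τ σ} (hz : z ∈ M.hodgeFil τ σ p) :
    M.involutionC τ σ z ∈ M.hodgeLow τ σ (M.weight - p) := by
  intro a _
  have h1 : (⨆ i ≥ p, M.hodge a.conj.1 σ i).map (BaseChange.map σ
      (M.Finf a.conj.1 a.1 a.eq_conjugate_conj).toLinearMap) ≤
      ⨆ i ≤ M.weight - p, M.hodge a.1 σ i := by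
    simp only [Submodule.map_iSup, M.hodge_Finf]
    exact iSup₂_le fun i hi => le_iSup₂_of_le (M.weight - i) (by omega) le_rfl
  exact h1 ⟨_, hz a.conj trivial, rfl⟩

theorem involutionC_mem_hodgeFil {p : ℤ} {z : M.BC τ σ} (hz : z ∈ M.hodgeLow τ σ p) :
    M.involutionC τ σ z ∈ M.hodgeFil τ σ (M.weight - p) := by
  intro a _
  have h1 : (⨆ i ≤ p, M.hodge a.conj.1 σ i).map (BaseChange.map σ
      (M.Finf a.conj.1 a.1 a.eq_conjugate_conj).toLinearMap) ≤
      ⨆ i ≥ M.weight - p, M.hodge a.1 σ i := by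
    simp only [Submodule.map_iSup, M.hodge_Finf]
    exact iSup₂_le fun i hi => le_iSup₂_of_le (M.weight - i) (by omega) le_rfl
  exact h1 ⟨_, hz a.conj trivial, rfl⟩

/-- The involution is bijective and exchanges H^{p,q} and H^{q,p}, so it exchanges upper and lower
parts of the decomposition. -/
theorem finrank_hodgeLow (p : ℤ) :
    Module.finrank ℂ (M.hodgeLow τ σ p) = M.filDim τ σ (M.weight - p) := by
  let e : M.BC τ σ ≃ₗ[ℂ] M.BC τ σ :=
    LinearEquiv.ofInvolutive (M.involutionC τ σ) (M.involutionC_involutionC σ)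
  rw [← finrank_hodgeFil]
  refine le_antisymm ?_ ?_
  · rw [← e.finrank_map_eq (M.hodgeLow τ σ p)]
    refine Submodule.finrank_mono ?_
    rintro _ ⟨x, hx, rfl⟩
    exact M.involutionC_mem_hodgeFil τ σ hx
  · rw [← e.finrank_map_eq (M.hodgeFil τ σ (M.weight - p))]
    refine Submodule.finrank_mono ?_
    rintro _ ⟨x, hx, rfl⟩
    have := M.involutionC_mem_hodgeLow τ σ hx
    rwa [sub_sub_cancel] at this

theorem filDim_add (p : ℤ) :
    M.filDim τ σ p + M.filDim τ σ (M.weight + 1 - p) = M.dStar τ σ := by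
  rw [← M.finrank_BC τ σ, ← Submodule.finrank_add_eq_of_isCompl (M.isCompl_hodge τ σ p),
    finrank_hodgeFil, finrank_hodgeLow, show M.weight + 1 - p = M.weight - (p - 1) by omega]

/-- The hypothesis makes the complexified eigenspace disjoint from the filtration step, so their
dimensions add up to at most that of the whole space. -/
theorem dSign_add_filDim_le {δ : ℤˣ} {p : ℤ}
    (h : ∀ z ∈ M.hodgeFil τ σ p, M.involutionC τ σ z = ((δ : ℤ) : ℂ) • z → z = 0) :
    M.dSign τ σ δ + M.filDim τ σ p ≤ M.dStar τ σ := by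
  rw [← M.finrank_BC τ σ, ← finrank_hodgeFil, Realization.dSign,
    ← finrank_span_image_of_isBaseChange (M.isBaseChange_inclB τ σ)]
  exact Submodule.finrank_add_finrank_le_of_disjoint
    (Submodule.disjoint_def.2 fun z h1 h2 => h z h2 (M.involutionC_of_mem σ h1))

theorem mem_hodgeLow_of_involutionC {δ : ℤˣ} {p : ℤ} {z : M.BC τ σ} (hz : z ∈ M.hodgeFil τ σ p)
    (h : M.involutionC τ σ z = ((δ : ℤ) : ℂ) • z) : z ∈ M.hodgeLow τ σ (M.weight - p) := by
  have h1 : ((δ : ℤ) : ℂ) • M.involutionC τ σ z = z := by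
    rw [h, smul_smul]
    rcases Int.units_eq_one_or δ with h | h <;> simp [h]
  rw [← h1]
  exact Submodule.smul_mem _ _ (M.involutionC_mem_hodgeLow τ σ hz)

theorem hodgeLow_mono {p p' : ℤ} (h : p ≤ p') : M.hodgeLow τ σ p ≤ M.hodgeLow τ σ p' :=
  fun _ hz a _ => (biSup_mono fun _ hi => hi.trans h : (⨆ i ≤ p, M.hodge a.1 σ i) ≤ _) (hz a trivial)

/-- An eigenvector in step `p` is a multiple of its own image, which lies in degrees at most `weight
- p < p`. These degrees are complementary to step `p`. -/
theorem eq_zero_of_lt {δ : ℤˣ} {p : ℤ} (hp : M.weight < 2 * p) (z : M.BC τ σ)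
    (hz : z ∈ M.hodgeFil τ σ p) (h : M.involutionC τ σ z = ((δ : ℤ) : ℂ) • z) : z = 0 :=
  Submodule.disjoint_def.1 (M.isCompl_hodge τ σ p).disjoint z hz
    (M.hodgeLow_mono τ σ (by omega) (M.mem_hodgeLow_of_involutionC τ σ hz h))

theorem exists_sign (hM : M.MiddleScalar) : ∃ δ : ℤˣ, ∀ z ∈ M.hodgeFil τ σ ((M.weight + 1) / 2),
    M.involutionC τ σ z = ((δ : ℤ) : ℂ) • z → z = 0 := by
  rcases Int.even_or_odd' M.weight with ⟨m, hm | hm⟩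
  · obtain ⟨c, hc⟩ := hM m hm.symm
    -- Any sign other than the middle scalar works: an eigenvector of that sign in the middle step
    -- lies in H^{m,m}, where the involution acts as `c`.
    have hδ : ∃ δ : ℤˣ, ((δ : ℤ) : ℂ) ≠ c := by
      by_cases h : c = 1
      · exact ⟨-1, by rw [h]; norm_num⟩
      · exact ⟨1, by simpa using Ne.symm h⟩
    obtain ⟨δ, hδ⟩ := hδ
    refine ⟨δ, fun z hz h => ?_⟩
    rw [show (M.weight + 1) / 2 = m by omega] at hz
    have h1 := M.mem_hodgeLow_of_involutionC τ σ hz h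
    rw [show M.weight - m = m by omega] at h1
    have h2 : ∀ a, z a ∈ M.hodge a.1 σ m := fun a =>
      mem_of_mem_of_mem (M.hodge_internal a.1 σ) (hz a trivial) (h1 a trivial)
    classical
    -- The scalar condition concerns families over all embeddings, so `z` is extended by zero
    -- outside `{τ, ρτ}`.
    let x : ∀ τ', BaseChange σ (M.HB τ') := fun τ' =>
      if h : τ' = τ ∨ τ' = ComplexEmbedding.conjugate τ then z ⟨τ', h⟩ else 0
    have hx : ∀ a : Orbit τ, x a.1 = z a := fun a => dif_pos a.2
    have h3 : M.involutionC τ σ z = c • z := by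
      funext a
      rw [Realization.involutionC_apply M.toRealization σ z a a.conj a.eq_conjugate_conj, ← hx,
        hc σ x ?_ _ _ a.eq_conjugate_conj, hx]
      · rfl
      · intro τ'
        by_cases h : τ' = τ ∨ τ' = ComplexEmbedding.conjugate τ
        · exact (hx ⟨τ', h⟩).symm ▸ h2 ⟨τ', h⟩
        · rw [show x τ' = 0 from dif_neg h]
          exact Submodule.zero_mem _
    rw [h, ← sub_eq_zero, ← sub_smul, smul_eq_zero] at h3
    exact h3.resolve_left (sub_ne_zero.2 hδ)
  · exact ⟨1, M.eq_zero_of_lt τ σ (by omega)⟩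

theorem isHodge (hM : M.MiddleScalar) :
    IsHodge (M.filDim τ σ) (M.dStar τ σ) (M.dSign τ σ) M.weight where
  toIsStep := M.isStep_filDim τ σ
  symm := M.filDim_add τ σ
  sign := by
    obtain ⟨δ, hδ⟩ := M.exists_sign τ σ hM
    -- As `δ` does not occur in the middle, the dominant sign is `-δ`. The two upper bounds for the
    -- sign dimensions add up to the total dimension, so both are equalities.
    refine ⟨-δ, ?_⟩
    have h1 := M.dSign_add_filDim_le τ σ hδ
    have h2 := M.dSign_add_filDim_le τ σ (δ := -δ) (p := M.weight / 2 + 1)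
      (M.eq_zero_of_lt τ σ (by omega))
    have h3 := M.dSign_add τ σ δ
    have h4 := M.filDim_add τ σ ((M.weight + 1) / 2)
    rw [show M.weight + 1 - (M.weight + 1) / 2 = M.weight / 2 + 1 by omega] at h4
    rw [neg_neg]
    constructor <;> omega

end PureMotive
end YoshidaPeriods

/-! ### Rational bases of parts of the tensor product -/

namespace YoshidaPeriods
namespace Realization

variable {F : Type uF} {E : Type uE} [Field F] [CharZero F] [Field E] [CharZero E]
variable (M N : Realization.{uF, uE, uB, uD} F E) {τ : F →+* ℂ} (σ : E →+* ℂ)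

theorem involutionC_genBC {a b : Orbit τ} (h : b.1 = ComplexEmbedding.conjugate a.1)
    (x : M.HB a.1) :
    M.involutionC τ σ (M.genBC σ a x) = M.genBC σ b (M.Finf a.1 b.1 h x) := by
  funext c
  by_cases hc : c = b
  · subst hc
    rw [involutionC_apply M σ _ c a h, genBC_same, genBC_same, BaseChange.map_incl]
    rfl
  · rw [involutionC_apply M σ _ c c.conj c.eq_conjugate_conj, genBC_of_ne M σ hc,
      genBC_of_ne M σ, map_zero]
    rintro rfl
    exact hc (Subtype.ext (c.eq_conjugate_conj.trans h.symm))

/-- `I^0(M) ⊗ I^0(N)`. -/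
abbrev pairI0 (τ : F →+* ℂ) : M.BC τ σ ⊗[ℂ] N.BC τ σ ≃ₗ[ℂ] M.TC τ σ ⊗[ℂ] N.TC τ σ :=
  TensorProduct.congr (M.I0 τ σ) (N.I0 τ σ)

/-- The complexification of `F^M ⊗ F^N`. -/
abbrev pairInvolution (τ : F →+* ℂ) : M.BC τ σ ⊗[ℂ] N.BC τ σ →ₗ[ℂ] M.BC τ σ ⊗[ℂ] N.BC τ σ :=
  TensorProduct.map (M.involutionC τ σ) (N.involutionC τ σ)

/-- The map `1 + ε (F^M ⊗ F^N)` on the complexification of `B^{M, N}`. -/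
def pairProj (ε : ℤˣ) : M.BC τ σ ⊗[ℂ] N.BC τ σ →ₗ[ℂ] M.BC τ σ ⊗[ℂ] N.BC τ σ :=
  LinearMap.id + ((ε : ℤ) : ℂ) • M.pairInvolution N σ τ

/-- Generators of the components of `T_{τ, σ}(M) ⊗ T_{τ, σ}(N)` with indices in `P`. -/
def pairGenT (P : Set (Orbit τ × Orbit τ)) : Set (M.TC τ σ ⊗[ℂ] N.TC τ σ) :=
  {z | ∃ p ∈ P, ∃ x y, z = M.genTC σ p.1 x ⊗ₜ N.genTC σ p.2 y}

/-- Generators of the components with indices in `P` of the Hodge filtration of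
`T_{τ, σ}(M) ⊗ T_{τ, σ}(N)`. -/
def pairGenFil (P : Set (Orbit τ × Orbit τ)) (q : ℤ) : Set (M.TC τ σ ⊗[ℂ] N.TC τ σ) :=
  {z | ∃ p ∈ P, ∃ m n : ℤ, m + n = q ∧ ∃ x ∈ M.Fil m, ∃ y ∈ N.Fil n,
    z = M.genTC σ p.1 x ⊗ₜ N.genTC σ p.2 y}

/-- Generators of the components with indices in `P` of the eigenspaces of `F^M ⊗ F^N`. -/
def pairGenB (P : Set (Orbit τ × Orbit τ)) (ε : ℤˣ) : Set (M.BC τ σ ⊗[ℂ] N.BC τ σ) :=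
  {z | ∃ p ∈ P, ∃ u v, z = M.pairProj N σ ε
    (M.genBC σ p.1 u ⊗ₜ N.genBC σ p.2 v)}

/-- Rational bases `ω` and `u` of the components with indices in `P` of `T^{M, N}` and of
`(B^{M, N})^ε`, such that the `ω i` for which `low i` does not hold span `Fil^q(T^{M, N})`. The
matrix `Z` represents the comparison isomorphism. -/
structure IsPairBasis (P : Set (Orbit τ × Orbit τ)) (ε : ℤˣ) (q : ℤ) {I J : Type*} [Fintype I]
    (low : I → Prop) (ω : I → M.TC τ σ ⊗[ℂ] N.TC τ σ) (u : J → M.BC τ σ ⊗[ℂ] N.BC τ σ)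
    (Z : Matrix I J ℂ) : Prop where
  linearIndependent_T : LinearIndependent ℂ ω
  span_T : Submodule.span (periodField τ σ) (Set.range ω) =
    Submodule.span (periodField τ σ) (M.pairGenT N σ P)
  span_Fil : Submodule.span ℂ (ω '' {i | ¬ low i}) = Submodule.span ℂ (M.pairGenFil N σ P q)
  linearIndependent_B : LinearIndependent ℂ u
  span_B : Submodule.span σ.fieldRange (Set.range u) =
    Submodule.span σ.fieldRange (M.pairGenB N σ P ε)
  matrix : ∀ j, M.pairI0 N σ τ (u j) = ∑ i, Z i j • ω i

/-! ### The eigenspaces and the filtration in terms of generators -/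

section Total

theorem tensorIncl_tmul {K : Subfield ℂ} {V : Type uR} {W : Type uS} {V' : Type uT} {W' : Type uV}
    [AddCommGroup V] [AddCommGroup W] [AddCommGroup V'] [AddCommGroup W']
    [Module K V] [Module K W] [Module ℂ V'] [Module ℂ W']
    (f : V →ₗ[K] V') (g : W →ₗ[K] W') (v : V) (w : W) :
    tensorIncl f g (v ⊗ₜ w) = f v ⊗ₜ[ℂ] g w :=
  rfl

theorem tensorIncl_range_span {K : Subfield ℂ} {V : Type uR} {W : Type uS} {V' : Type uT}
    {W' : Type uV} [AddCommGroup V] [AddCommGroup W] [AddCommGroup V'] [AddCommGroup W']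
    [Module K V] [Module K W] [Module ℂ V'] [Module ℂ W']
    (f : V →ₗ[K] V') (g : W →ₗ[K] W') {S : Set V} {S' : Set W} (hS : Submodule.span K S = ⊤)
    (hS' : Submodule.span K S' = ⊤) :
    LinearMap.range (tensorIncl f g) =
      Submodule.span K {z | ∃ s ∈ S, ∃ s' ∈ S', z = f s ⊗ₜ[ℂ] g s'} := by
  rw [LinearMap.range_eq_map, ← TensorProduct.map₂_mk_top_top_eq_top, ← hS, ← hS',
    Submodule.map₂_span_span, Submodule.map_span]
  congr 1
  ext z
  constructor
  · rintro ⟨_, ⟨s, hs, s', hs', rfl⟩, rfl⟩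
    exact ⟨s, hs, s', hs', rfl⟩
  · rintro ⟨s, hs, s', hs', rfl⟩
    exact ⟨_, ⟨s, hs, s', hs', rfl⟩, rfl⟩

theorem span_pairGenT_univ : Submodule.span (periodField τ σ) (M.pairGenT N σ Set.univ) =
    LinearMap.range (tensorIncl (M.inclT τ σ) (N.inclT τ σ)) := by
  rw [tensorIncl_range_span _ _ (M.span_genT σ) (N.span_genT σ)]
  congr 1
  ext z
  constructor
  · rintro ⟨p, -, x, y, rfl⟩
    exact ⟨_, ⟨p.1, x, rfl⟩, _, ⟨p.2, y, rfl⟩, by rw [inclT_genT, inclT_genT]⟩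
  · rintro ⟨_, ⟨a, x, rfl⟩, _, ⟨b, y, rfl⟩, rfl⟩
    exact ⟨(a, b), trivial, x, y, by rw [inclT_genT, inclT_genT]⟩

theorem pairFilC_eq_span (q : ℤ) :
    M.pairFilC N τ σ q = Submodule.span ℂ (M.pairGenFil N σ Set.univ q) := by
  have h1 : M.pairFil N τ σ q = Submodule.span (periodField τ σ)
      {z | ∃ p : Orbit τ × Orbit τ, ∃ m n : ℤ, m + n = q ∧ ∃ x ∈ M.Fil m, ∃ y ∈ N.Fil n,
        z = M.genT σ p.1 x ⊗ₜ N.genT σ p.2 y} := by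
    rw [pairFil]
    refine le_antisymm (iSup_le fun m => iSup_le fun n => iSup_le fun h => ?_)
      (Submodule.span_le.2 ?_)
    · rw [TFil_eq_span, TFil_eq_span, Submodule.map₂_span_span]
      refine Submodule.span_mono ?_
      rintro _ ⟨_, ⟨a, x, hx, rfl⟩, _, ⟨b, y, hy, rfl⟩, rfl⟩
      exact ⟨(a, b), m, n, h, x, hx, y, hy, rfl⟩
    · rintro _ ⟨p, m, n, h, x, hx, y, hy, rfl⟩
      refine Submodule.mem_iSup_of_mem m (Submodule.mem_iSup_of_mem n
        (Submodule.mem_iSup_of_mem h (Submodule.apply_mem_map₂ _ ?_ ?_)))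
      · rw [TFil_eq_span]
        exact Submodule.subset_span ⟨p.1, x, hx, rfl⟩
      · rw [TFil_eq_span]
        exact Submodule.subset_span ⟨p.2, y, hy, rfl⟩
  rw [pairFilC, h1, span_image_span]
  congr 1
  ext z
  constructor
  · rintro ⟨_, ⟨p, m, n, h, x, hx, y, hy, rfl⟩, rfl⟩
    exact ⟨p, trivial, m, n, h, x, hx, y, hy, by rw [tensorIncl_tmul, inclT_genT, inclT_genT]⟩
  · rintro ⟨p, -, m, n, h, x, hx, y, hy, rfl⟩
    exact ⟨_, ⟨p, m, n, h, x, hx, y, hy, rfl⟩, by rw [tensorIncl_tmul, inclT_genT, inclT_genT]⟩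

theorem pairInvolution_tensorIncl (z : M.B τ σ ⊗[σ.fieldRange] N.B τ σ) :
    M.pairInvolution N σ τ (tensorIncl (M.inclB τ σ) (N.inclB τ σ) z) =
      tensorIncl (M.inclB τ σ) (N.inclB τ σ)
        (TensorProduct.map (M.involution τ σ) (N.involution τ σ) z) := by
  induction z using TensorProduct.induction_on with
  | zero => simp only [map_zero]
  | tmul x y =>
    rw [tensorIncl_tmul, TensorProduct.map_tmul, TensorProduct.map_tmul, tensorIncl_tmul,
      involutionC_inclB, involutionC_inclB]
  | add x y hx hy => simp only [map_add, hx, hy]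

theorem pairInvolution_pairInvolution (z : M.B τ σ ⊗[σ.fieldRange] N.B τ σ) :
    TensorProduct.map (M.involution τ σ) (N.involution τ σ)
      (TensorProduct.map (M.involution τ σ) (N.involution τ σ) z) = z := by
  induction z using TensorProduct.induction_on with
  | zero => simp only [map_zero]
  | tmul x y =>
    rw [TensorProduct.map_tmul, TensorProduct.map_tmul, involution_involution, involution_involution]
  | add x y hx hy => simp only [map_add, hx, hy]

/-- The image of `(B^{M, N})^ε` in its complexification, in terms of generators of `B(M)` and
`B(N)`. -/
theorem map_pairBsign {S : Set (M.B τ σ)} {S' : Set (N.B τ σ)}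
    (hS : Submodule.span σ.fieldRange S = ⊤) (hS' : Submodule.span σ.fieldRange S' = ⊤) (ε : ℤˣ) :
    (M.pairBsign N τ σ ε).map (tensorIncl (M.inclB τ σ) (N.inclB τ σ)) =
      Submodule.span σ.fieldRange {z | ∃ s ∈ S, ∃ s' ∈ S',
        z = M.pairProj N σ ε
          (M.inclB τ σ s ⊗ₜ N.inclB τ σ s')} := by
  rw [pairBsign, eigenspace_eq_map _ (M.pairInvolution_pairInvolution N σ) ε,
    ← TensorProduct.map₂_mk_top_top_eq_top, ← hS, ← hS', Submodule.map₂_span_span,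
    Submodule.map_span, Submodule.map_span]
  have key : ∀ z, tensorIncl (M.inclB τ σ) (N.inclB τ σ)
      ((LinearMap.id + ((ε : ℤ) : σ.fieldRange) •
        TensorProduct.map (M.involution τ σ) (N.involution τ σ) : Module.End σ.fieldRange _) z) =
      M.pairProj N σ ε
        (tensorIncl (M.inclB τ σ) (N.inclB τ σ) z) := by
    intro z
    rw [pairProj, LinearMap.add_apply, LinearMap.add_apply, LinearMap.id_apply, LinearMap.id_apply,
      LinearMap.smul_apply, LinearMap.smul_apply, pairInvolution_tensorIncl, map_add, map_smul]
    rfl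
  congr 1
  ext z
  constructor
  · rintro ⟨_, ⟨_, ⟨s, hs, s', hs', rfl⟩, rfl⟩, rfl⟩
    exact ⟨s, hs, s', hs', key _⟩
  · rintro ⟨s, hs, s', hs', rfl⟩
    exact ⟨_, ⟨_, ⟨s, hs, s', hs', rfl⟩, rfl⟩, key _⟩

theorem span_pairGenB_univ (ε : ℤˣ) :
    Submodule.span σ.fieldRange (M.pairGenB N σ Set.univ ε) =
      (M.pairBsign N τ σ ε).map (tensorIncl (M.inclB τ σ) (N.inclB τ σ)) := by
  rw [map_pairBsign M N σ (M.span_genB σ) (N.span_genB σ)]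
  congr 1
  ext z
  constructor
  · rintro ⟨p, -, x, y, rfl⟩
    exact ⟨_, ⟨p.1, x, rfl⟩, _, ⟨p.2, y, rfl⟩, by rw [inclB_genB, inclB_genB]⟩
  · rintro ⟨_, ⟨a, x, rfl⟩, _, ⟨b, y, rfl⟩, rfl⟩
    exact ⟨(a, b), trivial, x, y, by rw [inclB_genB, inclB_genB]⟩

theorem pairBsignC_eq_span (ε : ℤˣ) :
    M.pairBsignC N τ σ ε = Submodule.span ℂ (M.pairGenB N σ Set.univ ε) := by
  rw [pairBsignC, ← span_span_subfield (K := σ.fieldRange) (M.pairGenB N σ Set.univ ε),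
    span_pairGenB_univ, Submodule.map_coe]

end Total

section Comparison

variable {M N σ}
variable {ε : ℤˣ} {q : ℤ} {P : Set (Orbit τ × Orbit τ)}

theorem pairGenFil_mono {P P' : Set (Orbit τ × Orbit τ)} (h : P ⊆ P') (q : ℤ) :
    M.pairGenFil N σ P q ⊆ M.pairGenFil N σ P' q := by
  rintro _ ⟨p, hp, H⟩
  exact ⟨p, h hp, H⟩

theorem pairGenB_mono {P P' : Set (Orbit τ × Orbit τ)} (h : P ⊆ P') (ε : ℤˣ) :
    M.pairGenB N σ P ε ⊆ M.pairGenB N σ P' ε := by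
  rintro _ ⟨p, hp, H⟩
  exact ⟨p, h hp, H⟩

variable (M N σ τ) in
/-- The comparison isomorphism followed by the projection to the quotient by `Fil^q`. -/
def pairQuot (q : ℤ) : M.BC τ σ ⊗[ℂ] N.BC τ σ →ₗ[ℂ]
    (M.TC τ σ ⊗[ℂ] N.TC τ σ) ⧸ M.pairFilC N τ σ q :=
  (M.pairFilC N τ σ q).mkQ ∘ₗ (M.pairI0 N σ τ).toLinearMap

variable {I J : Type*} [Fintype I] {low : I → Prop} {ω : I → M.TC τ σ ⊗[ℂ] N.TC τ σ}
  {u : J → M.BC τ σ ⊗[ℂ] N.BC τ σ} {Z : Matrix I J ℂ}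

namespace IsPairBasis

theorem mem_pairBsignC (h : M.IsPairBasis N σ P ε q low ω u Z) (j : J) :
    u j ∈ M.pairBsignC N τ σ ε := by
  have h1 : u j ∈ Submodule.span σ.fieldRange (M.pairGenB N σ P ε) :=
    h.span_B ▸ Submodule.subset_span ⟨j, rfl⟩
  rw [pairBsignC_eq_span]
  exact Submodule.span_mono (pairGenB_mono (Set.subset_univ P) ε)
    (Submodule.span_subset_span _ ℂ _ h1)

theorem mkQ_eq_zero (h : M.IsPairBasis N σ P ε q low ω u Z) {i : I} (hi : ¬ low i) :
    (M.pairFilC N τ σ q).mkQ (ω i) = 0 := by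
  rw [Submodule.mkQ_apply, Submodule.Quotient.mk_eq_zero, pairFilC_eq_span]
  have h1 : ω i ∈ Submodule.span ℂ (M.pairGenFil N σ P q) :=
    h.span_Fil ▸ Submodule.subset_span ⟨i, hi, rfl⟩
  exact Submodule.span_mono (pairGenFil_mono (Set.subset_univ P) q) h1

/-- Only injectivity from the condition on `q` is used, so this holds for any set `P` of components.
-/
theorem linearIndependent_pairQuot (h : M.IsPairBasis N σ P ε q low ω u Z)
    (hq : M.FilCondition N τ σ ε q) : LinearIndependent ℂ (M.pairQuot N τ σ q ∘ u) := by
  have h1 : LinearIndependent ℂ (fun j => (⟨u j, h.mem_pairBsignC j⟩ : M.pairBsignC N τ σ ε)) :=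
    LinearIndependent.of_comp (M.pairBsignC N τ σ ε).subtype h.linearIndependent_B
  exact h1.map' ((M.pairQuot N τ σ q).domRestrict (M.pairBsignC N τ σ ε)) (LinearMap.ker_eq_bot.2 hq.1)

theorem pairQuot_apply [DecidablePred low] (h : M.IsPairBasis N σ P ε q low ω u Z) (j : J) :
    M.pairQuot N τ σ q (u j) =
      ∑ i : {i // low i}, Z i j • (M.pairFilC N τ σ q).mkQ (ω i) := by
  have h1 : M.pairQuot N τ σ q (u j) = ∑ i, Z i j • (M.pairFilC N τ σ q).mkQ (ω i) := by
    rw [pairQuot, LinearMap.comp_apply, LinearEquiv.coe_coe, h.matrix, map_sum]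
    exact Finset.sum_congr rfl fun i _ => map_smul _ _ _
  rw [h1, ← Fintype.sum_subtype_add_sum_subtype low, add_eq_left]
  exact Finset.sum_eq_zero fun i _ => by rw [h.mkQ_eq_zero i.2, smul_zero]

end IsPairBasis
end Comparison

end Realization
end YoshidaPeriods

namespace YoshidaPeriods
namespace Realization

variable {F : Type uF} {E : Type uE} [Field F] [CharZero F] [Field E] [CharZero E]
variable {M N : Realization.{uF, uE, uB, uD} F E} {τ : F →+* ℂ} {σ : E →+* ℂ}
variable {ε : ℤˣ} {q : ℤ} {P : Set (Orbit τ × Orbit τ)}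

namespace IsPairBasis

section

variable {I J : Type*} [Fintype I] {low : I → Prop}
  {ω : I → M.TC τ σ ⊗[ℂ] N.TC τ σ} {u : J → M.BC τ σ ⊗[ℂ] N.BC τ σ} {Z : Matrix I J ℂ}

/-- The columns stay independent in the quotient by Fil^q, where their images are combinations of
the low vectors. This is the inequality available for each part separately. -/
theorem card_le [Fintype J] [DecidablePred low] (h : M.IsPairBasis N σ P ε q low ω u Z)
    (hq : M.FilCondition N τ σ ε q) :
    Fintype.card J ≤ Fintype.card {i // low i} := by
  rw [← finrank_span_eq_card (h.linearIndependent_pairQuot hq)]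
  have := FiniteDimensional.span_of_finite ℂ (Set.finite_range fun i : {i // low i} =>
    (M.pairFilC N τ σ q).mkQ (ω i))
  refine le_trans (Submodule.finrank_mono (Submodule.span_le.2 ?_))
    (finrank_range_le_card (R := ℂ)
      (fun i : {i // low i} => (M.pairFilC N τ σ q).mkQ (ω i)))
  rintro _ ⟨j, rfl⟩
  rw [Function.comp_apply, h.pairQuot_apply]
  exact Submodule.sum_mem _ fun i _ => Submodule.smul_mem _ _ (Submodule.subset_span ⟨i, rfl⟩)

theorem linearIndependent_mkQ (h : M.IsPairBasis N σ Set.univ ε q low ω u Z) :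
    LinearIndependent ℂ fun i : {i // low i} => (M.pairFilC N τ σ q).mkQ (ω i) := by
  refine (h.linearIndependent_T.comp _ Subtype.val_injective).map ?_
  rw [Submodule.ker_mkQ, pairFilC_eq_span, ← h.span_Fil, Set.range_comp]
  exact h.linearIndependent_T.disjoint_span_image
    (Set.disjoint_left.2 (by rintro _ ⟨i, rfl⟩ h2; exact h2 i.2))

theorem span_u (h : M.IsPairBasis N σ Set.univ ε q low ω u Z) :
    Submodule.span ℂ (Set.range u) = M.pairBsignC N τ σ ε := by
  rw [pairBsignC_eq_span]
  exact span_eq_of_span_subfield_eq h.span_B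

/-- The reverse inequality comes from surjectivity and needs all components: the eigenspace has to
be spanned by the whole family `u`. -/
theorem card_eq [Fintype J] [DecidablePred low] (h : M.IsPairBasis N σ Set.univ ε q low ω u Z)
    (hq : M.FilCondition N τ σ ε q) :
    Fintype.card {i // low i} = Fintype.card J := by
  refine le_antisymm ?_ (h.card_le hq)
  rw [← finrank_span_eq_card h.linearIndependent_mkQ]
  have := FiniteDimensional.span_of_finite ℂ (Set.finite_range (M.pairQuot N τ σ q ∘ u))
  refine le_trans (Submodule.finrank_mono (Submodule.span_le.2 ?_))
    (finrank_range_le_card (R := ℂ) (M.pairQuot N τ σ q ∘ u))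
  rintro _ ⟨i, rfl⟩
  obtain ⟨⟨b, hb⟩, hbi⟩ := hq.2 ((M.pairFilC N τ σ q).mkQ (ω i))
  rw [← h.span_u] at hb
  rw [Set.range_comp, ← Submodule.map_span]
  exact ⟨b, hb, hbi⟩

theorem pairQuot_apply_equiv [DecidablePred low] (h : M.IsPairBasis N σ P ε q low ω u Z)
    (e : {i // low i} ≃ J)
    (i' : {i // low i}) :
    M.pairQuot N τ σ q (u (e i')) =
      ∑ i : {i // low i}, Z.submatrix Subtype.val e i i' • (M.pairFilC N τ σ q).mkQ (ω i) :=
  h.pairQuot_apply (e i')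

theorem det_ne_zero [DecidablePred low] (h : M.IsPairBasis N σ P ε q low ω u Z)
    (hq : M.FilCondition N τ σ ε q)
    [DecidableEq I] (e : {i // low i} ≃ J) : (Z.submatrix (Subtype.val : {i // low i} → I) e).det ≠ 0 := by
  intro h0
  obtain ⟨c, hc, hc0⟩ := Matrix.exists_mulVec_eq_zero_iff.2 h0
  apply hc
  have hli := (h.linearIndependent_pairQuot hq).comp e e.injective
  refine funext (Fintype.linearIndependent_iff.1 hli c ?_)
  simp only [Function.comp_apply, h.pairQuot_apply_equiv e, Finset.smul_sum, smul_smul]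
  rw [Finset.sum_comm]
  refine Finset.sum_eq_zero fun i _ => ?_
  rw [← Finset.sum_smul]
  have := congrFun hc0 i
  rw [Matrix.mulVec, dotProduct] at this
  rw [Finset.sum_congr rfl fun j _ => mul_comm _ _, this, Pi.zero_apply, zero_smul]

/-- The vectors that are not low die in the quotient. Hence the low ones span the image of the full
rational structure, which does not depend on the basis chosen. -/
theorem span_mkQ (h : M.IsPairBasis N σ Set.univ ε q low ω u Z) :
    Submodule.span (periodField τ σ)
        (Set.range fun i : {i // low i} => (M.pairFilC N τ σ q).mkQ (ω i)) =
      (Submodule.span (periodField τ σ) (M.pairGenT N σ Set.univ)).map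
        ((M.pairFilC N τ σ q).mkQ.restrictScalars (periodField τ σ)) := by
  rw [← h.span_T, Submodule.map_span]
  refine le_antisymm (Submodule.span_mono ?_) (Submodule.span_le.2 ?_)
  · rintro _ ⟨i, rfl⟩
    exact ⟨_, ⟨i, rfl⟩, rfl⟩
  · rintro _ ⟨_, ⟨i, rfl⟩, rfl⟩
    by_cases hi : low i
    · exact Submodule.subset_span ⟨⟨i, hi⟩, rfl⟩
    · change (M.pairFilC N τ σ q).mkQ (ω i) ∈ _
      rw [h.mkQ_eq_zero hi]
      exact Submodule.zero_mem _

end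

/-- Both determinants belong to the same map `pairQuot`, written in bases of the same rational
structures of source and target; the bijections `e` and `e'` only order the bases. -/
theorem simUpTo {I J I' J' : Type*} [Fintype I] [Fintype I'] [DecidableEq I] [DecidableEq I']
    {low : I → Prop} {low' : I' → Prop} [DecidablePred low] [DecidablePred low']
    {ω : I → M.TC τ σ ⊗[ℂ] N.TC τ σ} {u : J → M.BC τ σ ⊗[ℂ] N.BC τ σ} {Z : Matrix I J ℂ}
    {ω' : I' → M.TC τ σ ⊗[ℂ] N.TC τ σ} {u' : J' → M.BC τ σ ⊗[ℂ] N.BC τ σ} {Z' : Matrix I' J' ℂ}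
    (h : M.IsPairBasis N σ Set.univ ε q low ω u Z)
    (h' : M.IsPairBasis N σ Set.univ ε q low' ω' u' Z')
    (e : {i // low i} ≃ J) (e' : {i // low' i} ≃ J') :
    SimUpTo (periodField τ σ) (Z'.submatrix (Subtype.val : {i // low' i} → I') e').det
      (Z.submatrix (Subtype.val : {i // low i} → I) e).det := by
  have : Fintype J := Fintype.ofEquiv _ e
  have : Fintype J' := Fintype.ofEquiv _ e'
  have hJ : Fintype.card J = Fintype.card J' := by
    rw [← finrank_span_eq_card h.linearIndependent_B, ← finrank_span_eq_card h'.linearIndependent_B,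
      h.span_u, h'.span_u]
  let g : {i // low i} ≃ {i // low' i} := Fintype.equivOfCardEq (by
    rw [Fintype.card_congr e, Fintype.card_congr e', hJ])
  rw [← Matrix.det_submatrix_equiv_self g (Z'.submatrix _ e')]
  refine simUpTo_det (k := σ.fieldRange) le_sup_left (M.pairQuot N τ σ q) (v := u ∘ e)
    (v' := u' ∘ e' ∘ g) (w := fun i : {i // low i} => (M.pairFilC N τ σ q).mkQ (ω i))
    (w' := fun i : {i // low i} => (M.pairFilC N τ σ q).mkQ (ω' (g i)))
    (h.linearIndependent_B.comp e e.injective) (h'.linearIndependent_mkQ.comp g g.injective)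
    ?_ ?_ (h.pairQuot_apply_equiv e) fun j => ?_
  · rw [e.surjective.range_comp, (e'.surjective.comp g.surjective).range_comp, h.span_B, h'.span_B]
  · rw [h.span_mkQ, ← h'.span_mkQ]
    congr 1
    exact (g.surjective.range_comp fun i : {i // low' i} => (M.pairFilC N τ σ q).mkQ (ω' i)).symm
  · refine (h'.pairQuot_apply_equiv e' (g j)).trans ?_
    exact (Equiv.sum_comp g fun i => Z'.submatrix Subtype.val e' i (g j) •
      (M.pairFilC N τ σ q).mkQ (ω' i)).symm

end IsPairBasis

/-! ### Disjoint sets of components -/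

section Merge

variable (M) (σ) in
/-- The projection of `T_{τ, σ}(M) ⊗ ℂ` to the component with index `a`. -/
def projTC (a : Orbit τ) : M.TC τ σ →ₗ[ℂ] M.TC τ σ := by
  classical
  exact (LinearMap.single ℂ (fun a : Orbit τ => BaseChange (pairing σ a.1) M.HdR) a) ∘ₗ
    (LinearMap.proj a : (∀ a : Orbit τ, BaseChange (pairing σ a.1) M.HdR) →ₗ[ℂ] _)

theorem projTC_genTC_same (a : Orbit τ) (x : M.HdR) :
    M.projTC σ a (M.genTC σ a x) = M.genTC σ a x := by
  classical
  exact congrArg (LinearMap.single ℂ (fun a : Orbit τ => BaseChange (pairing σ a.1) M.HdR) a)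
    (genTC_same M σ a x)

theorem projTC_genTC_of_ne {a b : Orbit τ} (h : a ≠ b) (x : M.HdR) :
    M.projTC σ a (M.genTC σ b x) = 0 := by
  classical
  exact (congrArg (LinearMap.single ℂ (fun a : Orbit τ => BaseChange (pairing σ a.1) M.HdR) a)
    (genTC_of_ne M σ h x)).trans (map_zero _)

variable (M N σ) in
/-- The projection to the components with indices in `P`. -/
def pairProjT [Fintype (Orbit τ)] (P : Set (Orbit τ × Orbit τ)) :
    M.TC τ σ ⊗[ℂ] N.TC τ σ →ₗ[ℂ] M.TC τ σ ⊗[ℂ] N.TC τ σ := by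
  classical
  exact ∑ p : Orbit τ × Orbit τ,
    if p ∈ P then TensorProduct.map (M.projTC σ p.1) (N.projTC σ p.2) else 0

theorem pairProjT_gen [Fintype (Orbit τ)] (P : Set (Orbit τ × Orbit τ)) (p : Orbit τ × Orbit τ)
    (x : M.HdR) (y : N.HdR) [Decidable (p ∈ P)] :
    M.pairProjT N σ P (M.genTC σ p.1 x ⊗ₜ N.genTC σ p.2 y) =
      if p ∈ P then M.genTC σ p.1 x ⊗ₜ N.genTC σ p.2 y else 0 := by
  classical
  rw [pairProjT, LinearMap.sum_apply, Finset.sum_eq_single p]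
  · split_ifs with h
    · rw [TensorProduct.map_tmul, projTC_genTC_same, projTC_genTC_same]
    · rfl
  · intro r _ hr
    split_ifs with h
    · rw [TensorProduct.map_tmul]
      by_cases h1 : r.1 = p.1
      · rw [projTC_genTC_of_ne (M := N) fun h2 => hr (Prod.ext h1 h2), TensorProduct.tmul_zero]
      · rw [projTC_genTC_of_ne h1, TensorProduct.zero_tmul]
    · rfl
  · exact fun h => absurd (Finset.mem_univ _) h

/-- The projection to the components in `P` is the identity on one span and zero on the other. -/
theorem disjoint_span_pairGenT {P P' : Set (Orbit τ × Orbit τ)} (h : Disjoint P P') :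
    Disjoint (Submodule.span ℂ (M.pairGenT N σ P)) (Submodule.span ℂ (M.pairGenT N σ P')) := by
  classical
  have : Fintype (Orbit τ) := Fintype.ofFinite _
  refine Submodule.disjoint_def.2 fun z hz hz' => ?_
  have h1 : M.pairProjT N σ P z = z := by
    clear hz'
    induction hz using Submodule.span_induction with
    | mem z hz =>
      obtain ⟨p, hp, x, y, rfl⟩ := hz
      rw [pairProjT_gen, if_pos hp]
    | zero => exact map_zero _
    | add x y _ _ hx hy => rw [map_add, hx, hy]
    | smul r x _ hx => rw [map_smul, hx]
  have h2 : M.pairProjT N σ P z = 0 := by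
    clear h1 hz
    induction hz' using Submodule.span_induction with
    | mem z hz =>
      obtain ⟨p, hp, x, y, rfl⟩ := hz
      rw [pairProjT_gen, if_neg (Set.disjoint_right.1 h hp)]
    | zero => exact map_zero _
    | add x y _ _ hx hy => rw [map_add, hx, hy, add_zero]
    | smul r x _ hx => rw [map_smul, hx, smul_zero]
  rw [← h1, h2]

theorem map_span_le_of_matrix {V W : Type*} [AddCommGroup V] [AddCommGroup W] [Module ℂ V]
    [Module ℂ W] {f : V →ₗ[ℂ] W} {I J : Type*} [Fintype I] {ω : I → W} {u : J → V}
    {Z : Matrix I J ℂ} (h : ∀ j, f (u j) = ∑ i, Z i j • ω i) :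
    (Submodule.span ℂ (Set.range u)).map f ≤ Submodule.span ℂ (Set.range ω) := by
  rw [Submodule.map_span, Submodule.span_le]
  rintro _ ⟨_, ⟨j, rfl⟩, rfl⟩
  rw [h]
  exact Submodule.sum_mem _ fun i _ => Submodule.smul_mem _ _ (Submodule.subset_span ⟨i, rfl⟩)

/-- The comparison isomorphism respects the two parts, so its matrix is block diagonal. This is what
turns a product of two periods into one determinant. -/
theorem IsPairBasis.merge {P₁ P₂ : Set (Orbit τ × Orbit τ)} (hd : Disjoint P₁ P₂)
    {I₁ J₁ I₂ J₂ : Type*} [Fintype I₁] [Fintype I₂] {low₁ : I₁ → Prop} {low₂ : I₂ → Prop}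
    {ω₁ : I₁ → M.TC τ σ ⊗[ℂ] N.TC τ σ} {u₁ : J₁ → M.BC τ σ ⊗[ℂ] N.BC τ σ} {Z₁ : Matrix I₁ J₁ ℂ}
    {ω₂ : I₂ → M.TC τ σ ⊗[ℂ] N.TC τ σ} {u₂ : J₂ → M.BC τ σ ⊗[ℂ] N.BC τ σ} {Z₂ : Matrix I₂ J₂ ℂ}
    (h₁ : M.IsPairBasis N σ P₁ ε q low₁ ω₁ u₁ Z₁) (h₂ : M.IsPairBasis N σ P₂ ε q low₂ ω₂ u₂ Z₂) :
    M.IsPairBasis N σ (P₁ ∪ P₂) ε q (Sum.elim low₁ low₂) (Sum.elim ω₁ ω₂) (Sum.elim u₁ u₂)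
      (Matrix.fromBlocks Z₁ 0 0 Z₂) := by
  have hdis : Disjoint (Submodule.span ℂ (Set.range ω₁)) (Submodule.span ℂ (Set.range ω₂)) := by
    rw [span_eq_of_span_subfield_eq h₁.span_T, span_eq_of_span_subfield_eq h₂.span_T]
    exact disjoint_span_pairGenT hd
  refine ⟨h₁.linearIndependent_T.sum_type h₂.linearIndependent_T hdis, ?_, ?_,
    h₁.linearIndependent_B.sum_type h₂.linearIndependent_B ?_, ?_, ?_⟩
  · have : M.pairGenT N σ (P₁ ∪ P₂) = M.pairGenT N σ P₁ ∪ M.pairGenT N σ P₂ := by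
      ext z
      simp only [pairGenT, Set.mem_ofPred_eq, Set.mem_union, or_and_right, exists_or]
    rw [this, Set.Sum.elim_range, Submodule.span_union, Submodule.span_union, h₁.span_T, h₂.span_T]
  · have h3 : M.pairGenFil N σ (P₁ ∪ P₂) q = M.pairGenFil N σ P₁ q ∪ M.pairGenFil N σ P₂ q := by
      ext z
      simp only [pairGenFil, Set.mem_ofPred_eq, Set.mem_union, or_and_right, exists_or]
    have h4 : Sum.elim ω₁ ω₂ '' {i | ¬ Sum.elim low₁ low₂ i} =
        ω₁ '' {i | ¬ low₁ i} ∪ ω₂ '' {i | ¬ low₂ i} := by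
      ext z
      simp
    rw [h3, h4, Submodule.span_union, Submodule.span_union, h₁.span_Fil, h₂.span_Fil]
  -- Disjointness on the Betti side is inherited from the de Rham side through the injective
  -- comparison map.
  · refine Submodule.disjoint_def.2 fun z hz hz' => ?_
    refine (M.pairI0 N σ τ).map_eq_zero_iff.1 (Submodule.disjoint_def.1 hdis _ ?_ ?_)
    · exact map_span_le_of_matrix (f := (M.pairI0 N σ τ).toLinearMap) h₁.matrix ⟨z, hz, rfl⟩
    · exact map_span_le_of_matrix (f := (M.pairI0 N σ τ).toLinearMap) h₂.matrix ⟨z, hz', rfl⟩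
  · have : M.pairGenB N σ (P₁ ∪ P₂) ε = M.pairGenB N σ P₁ ε ∪ M.pairGenB N σ P₂ ε := by
      ext z
      simp only [pairGenB, Set.mem_ofPred_eq, Set.mem_union, or_and_right, exists_or]
    rw [this, Set.Sum.elim_range, Submodule.span_union, Submodule.span_union, h₁.span_B, h₂.span_B]
  · rintro (j | j)
    · simp [h₁.matrix]
    · simp [h₂.matrix]

end Merge

end Realization
end YoshidaPeriods

/-! ### Tensor products of adapted bases and of eigenbases -/

namespace YoshidaPeriods

theorem linearIndependent_tmul {V W : Type*} [AddCommGroup V] [AddCommGroup W] [Module ℂ V]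
    [Module ℂ W] {I J : Type*} {v : I → V} {w : J → W} (hv : LinearIndependent ℂ v)
    (hw : LinearIndependent ℂ w) :
    LinearIndependent ℂ fun ij : I × J => v ij.1 ⊗ₜ[ℂ] w ij.2 :=
  hv.tmul_of_isDomain hw

namespace Realization

variable {F : Type uF} {E : Type uE} [Field F] [CharZero F] [Field E] [CharZero E]

section Adapted

variable (M : Realization.{uF, uE, uB, uD} F E) (τ : F →+* ℂ) (σ : E →+* ℂ)

/-- The filtration changes only at its jumps: step `p` equals the step at the first jump that is at
least `p`, and is zero if there is no such jump. -/
theorem isAdapted_iff [FiniteDimensional (periodField τ σ) (M.T τ σ)]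
    (ω : Module.Basis (Fin (M.dStar τ σ)) (periodField τ σ) (M.T τ σ)) :
    (∀ μ, M.TFil τ σ (M.jump τ σ μ) = Submodule.span (periodField τ σ)
      (ω '' {i | partialSum (M.grDim τ σ) μ ≤ i})) ↔ IsAdapted (M.TFil τ σ) ω := by
  have h := M.isStep_filDim τ σ
  have hj := M.isJumps_filDim τ σ
  have h1 : ∀ μ : Fin (M.numJumps τ σ),
      partialSum (M.grDim τ σ) μ + M.filDim τ σ (M.jump τ σ μ) = M.dStar τ σ := fun μ =>
    hj.partialSum_add h fun ν => by rw [hj.strictMono.lt_iff_lt, Fin.lt_def]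
  have h2 : ∀ μ : Fin (M.numJumps τ σ),
      {i : Fin (M.dStar τ σ) | partialSum (M.grDim τ σ) μ ≤ (i : ℕ)} =
        {i : Fin (M.dStar τ σ) | M.dStar τ σ ≤ (i : ℕ) + M.filDim τ σ (M.jump τ σ μ)} := fun μ => by
    ext i
    have := h1 μ
    simp only [Set.mem_ofPred_eq]
    omega
  constructor
  · intro H p
    change _ = Submodule.span _ (ω '' {i | _ ≤ (i : ℕ) + M.filDim τ σ p})
    by_cases hp : ∃ μ, p ≤ M.jump τ σ μ
    · classical
      obtain ⟨μ, hμ, hmin⟩ := (Finset.univ.filter fun μ => p ≤ M.jump τ σ μ).exists_min_image id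
        (by obtain ⟨μ, hμ⟩ := hp; exact ⟨μ, by simpa using hμ⟩)
      have hμ' : p ≤ M.jump τ σ μ := by simpa using hμ
      have h3 := hj.partialSum_add h (n := μ) (x := p) fun ν => by
        rw [← Fin.lt_def, ← not_le, ← not_le, not_iff_not]
        constructor
        · exact fun h => hμ'.trans (hj.strictMono.monotone h)
        · exact fun h => hmin ν (by simpa using h)
      have h4 : M.filDim τ σ p = M.filDim τ σ (M.jump τ σ μ) := by
        have := h1 μ
        omega
      have h5 : M.TFil τ σ (M.jump τ σ μ) = M.TFil τ σ p :=
        Submodule.eq_of_le_of_finrank_eq (M.TFil_antitone τ σ hμ') h4.symm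
      rw [h4, ← h2, ← h5, H μ]
    · push Not at hp
      have h3 := hj.partialSum_add h (n := M.numJumps τ σ) (x := p) fun ν =>
        iff_of_true ν.2 (hp ν)
      have h4 := hj.exists_gt h
      have h5 : M.filDim τ σ p = 0 := by omega
      rw [h5, Submodule.finrank_eq_zero.1 h5, eq_comm, Submodule.span_eq_bot]
      rintro _ ⟨i, hi, rfl⟩
      have := i.2
      simp only [Set.mem_ofPred_eq] at hi
      omega
  · intro H μ
    rw [h2]
    exact H _

variable {M τ σ} in
theorem _root_.YoshidaPeriods.IsAdapted.eq_span_weight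
    {ω : Module.Basis (Fin (M.dStar τ σ)) (periodField τ σ) (M.T τ σ)}
    (hω : IsAdapted (M.TFil τ σ) ω) {w : Fin (M.dStar τ σ) → ℤ}
    (hw : IsRowWeight (M.filDim τ σ) w) (p : ℤ) :
    M.TFil τ σ p = Submodule.span (periodField τ σ) (ω '' {i | p ≤ w i}) := by
  rw [hω p]
  congr 2
  ext i
  exact (hw i p).symm

end Adapted

section Bases

variable (M N : Realization.{uF, uE, uB, uD} F E) {τ : F →+* ℂ} {σ : E →+* ℂ}

/-- A basis of `B_σ(M_τ)` consisting of eigenvectors of the involution. -/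
def signBasis (u : ∀ ε : ℤˣ, Module.Basis (Fin (M.dSign τ σ ε)) σ.fieldRange (M.Bsign τ σ ε)) :
    Module.Basis ((ε : ℤˣ) × Fin (M.dSign τ σ ε)) σ.fieldRange (M.B τ σ) :=
  ((DirectSum.isInternal_submodule_iff_isCompl (M.Bsign τ σ) (i := 1) (j := -1) (by decide)
    (by ext δ; simpa using Int.units_eq_one_or δ)).2
    (isCompl_eigenspace _ (M.involution_involution σ) 1)).collectedBasis u

theorem signBasis_apply
    (u : ∀ ε : ℤˣ, Module.Basis (Fin (M.dSign τ σ ε)) σ.fieldRange (M.Bsign τ σ ε))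
    (c : (ε : ℤˣ) × Fin (M.dSign τ σ ε)) : M.signBasis u c = (u c.1 c.2 : M.B τ σ) := by
  rw [signBasis, DirectSum.IsInternal.collectedBasis_coe]

theorem involution_signBasis
    (u : ∀ ε : ℤˣ, Module.Basis (Fin (M.dSign τ σ ε)) σ.fieldRange (M.Bsign τ σ ε))
    (c : (ε : ℤˣ) × Fin (M.dSign τ σ ε)) :
    M.involution τ σ (M.signBasis u c) = ((c.1 : ℤ) : σ.fieldRange) • M.signBasis u c := by
  rw [signBasis_apply]
  exact (M.mem_Bsign σ).1 (u c.1 c.2).2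

variable {M N}
variable {u : ∀ ε : ℤˣ, Module.Basis (Fin (M.dSign τ σ ε)) σ.fieldRange (M.Bsign τ σ ε)}
  {ω : Module.Basis (Fin (M.dStar τ σ)) (periodField τ σ) (M.T τ σ)}
  {v : ∀ ε : ℤˣ, Module.Basis (Fin (N.dSign τ σ ε)) σ.fieldRange (N.Bsign τ σ ε)}
  {η : Module.Basis (Fin (N.dStar τ σ)) (periodField τ σ) (N.T τ σ)}

/-- The tensor product of eigenvectors has the product of the signs as eigenvalue, so `1 + ε (F^M ⊗
F^N)` doubles it or kills it. -/
theorem pairProj_signBasis (ε : ℤˣ) (c : (ε : ℤˣ) × Fin (M.dSign τ σ ε))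
    (c' : (ε : ℤˣ) × Fin (N.dSign τ σ ε)) :
    M.pairProj N σ ε (M.inclB τ σ (M.signBasis u c) ⊗ₜ N.inclB τ σ (N.signBasis v c')) =
      (if c'.1 = ε * c.1 then (2 : ℂ) else 0) •
        (M.inclB τ σ (M.signBasis u c) ⊗ₜ N.inclB τ σ (N.signBasis v c')) := by
  have h1 : M.pairInvolution N σ τ
      (M.inclB τ σ (M.signBasis u c) ⊗ₜ N.inclB τ σ (N.signBasis v c')) =
      (((c.1 * c'.1 : ℤˣ) : ℤ) : ℂ) •
        (M.inclB τ σ (M.signBasis u c) ⊗ₜ N.inclB τ σ (N.signBasis v c')) := by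
    rw [TensorProduct.map_tmul, involutionC_inclB, involutionC_inclB, involution_signBasis,
      involution_signBasis, map_smul, map_smul]
    change (((c.1 : ℤ) : ℂ) • M.inclB τ σ (M.signBasis u c)) ⊗ₜ[ℂ]
      (((c'.1 : ℤ) : ℂ) • N.inclB τ σ (N.signBasis v c')) = _
    rw [TensorProduct.smul_tmul_smul]
    push_cast
    rfl
  rw [pairProj, LinearMap.add_apply, LinearMap.id_apply, LinearMap.smul_apply, h1, smul_smul]
  have h2 : (1 + ((ε : ℤ) : ℂ) * (((c.1 * c'.1 : ℤˣ) : ℤ) : ℂ)) = if c'.1 = ε * c.1 then 2 else 0 := by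
    generalize c.1 = a
    generalize c'.1 = b
    rcases Int.units_eq_one_or ε with rfl | rfl <;> rcases Int.units_eq_one_or a with rfl | rfl <;>
      rcases Int.units_eq_one_or b with rfl | rfl <;> norm_num
  rw [← h2, add_smul, one_smul]

theorem linearIndependent_inclT_tmul {I J : Type*} {x : I → M.T τ σ} {y : J → N.T τ σ}
    (hx : LinearIndependent (periodField τ σ) x) (hy : LinearIndependent (periodField τ σ) y) :
    LinearIndependent ℂ fun ij : I × J => M.inclT τ σ (x ij.1) ⊗ₜ[ℂ] N.inclT τ σ (y ij.2) := by
  have h1 : LinearIndependent ℂ fun i => M.inclT τ σ (x i) :=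
    linearIndependent_of_isBaseChange (M.isBaseChange_inclT τ σ) hx
  have h2 : LinearIndependent ℂ fun j => N.inclT τ σ (y j) :=
    linearIndependent_of_isBaseChange (N.isBaseChange_inclT τ σ) hy
  have h3 := linearIndependent_tmul h1 h2
  exact h3

theorem linearIndependent_inclB_tmul {I J : Type*} {x : I → M.B τ σ} {y : J → N.B τ σ}
    (hx : LinearIndependent σ.fieldRange x) (hy : LinearIndependent σ.fieldRange y) :
    LinearIndependent ℂ fun ij : I × J => M.inclB τ σ (x ij.1) ⊗ₜ[ℂ] N.inclB τ σ (y ij.2) := by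
  have h1 : LinearIndependent ℂ fun i => M.inclB τ σ (x i) :=
    linearIndependent_of_isBaseChange (M.isBaseChange_inclB τ σ) hx
  have h2 : LinearIndependent ℂ fun j => N.inclB τ σ (y j) :=
    linearIndependent_of_isBaseChange (N.isBaseChange_inclB τ σ) hy
  have h3 := linearIndependent_tmul h1 h2
  exact h3

/-- This identifies the determinant of the comparison map, in bases that are tensor products, with
the minor `pairDet` of the two period matrices. -/
theorem isPairBasis_tensor {wM : Fin (M.dStar τ σ) → ℤ} {wN : Fin (N.dStar τ σ) → ℤ}
    (hω : ∀ p, M.TFil τ σ p = Submodule.span (periodField τ σ) (ω '' {i | p ≤ wM i}))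
    (hη : ∀ p, N.TFil τ σ p = Submodule.span (periodField τ σ) (η '' {i | p ≤ wN i}))
    {X : M.PMatrix τ σ} {Y : N.PMatrix τ σ}
    (hX : ∀ ε j, M.I0 τ σ (M.inclB τ σ (u ε j : M.B τ σ)) = ∑ i, X i ⟨ε, j⟩ • M.inclT τ σ (ω i))
    (hY : ∀ ε j, N.I0 τ σ (N.inclB τ σ (v ε j : N.B τ σ)) = ∑ i, Y i ⟨ε, j⟩ • N.inclT τ σ (η i))
    (ε : ℤˣ) (q : ℤ) :
    M.IsPairBasis N σ Set.univ ε q (fun ij : Fin (M.dStar τ σ) × Fin (N.dStar τ σ) => wM ij.1 + wN ij.2 < q)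
      (fun ij : Fin (M.dStar τ σ) × Fin (N.dStar τ σ) => M.inclT τ σ (ω ij.1) ⊗ₜ N.inclT τ σ (η ij.2))
      (fun c : PairCol (M.dSign τ σ) (N.dSign τ σ) ε =>
        M.inclB τ σ (M.signBasis u c.1.1) ⊗ₜ N.inclB τ σ (N.signBasis v c.1.2))
      (Matrix.of fun (r : Fin (M.dStar τ σ) × Fin (N.dStar τ σ))
        (c : PairCol (M.dSign τ σ) (N.dSign τ σ) ε) => X r.1 c.1.1 * Y r.2 c.1.2) := by
  refine ⟨?_, ?_, ?_, ?_, ?_, ?_⟩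
  · exact linearIndependent_inclT_tmul ω.linearIndependent η.linearIndependent
  · rw [span_pairGenT_univ, tensorIncl_range_span _ _ ω.span_eq η.span_eq]
    congr 1
    ext z
    constructor
    · rintro ⟨ij, rfl⟩
      exact ⟨_, ⟨ij.1, rfl⟩, _, ⟨ij.2, rfl⟩, rfl⟩
    · rintro ⟨_, ⟨i, rfl⟩, _, ⟨j, rfl⟩, rfl⟩
      exact ⟨(i, j), rfl⟩
  · rw [← pairFilC_eq_span, pairFilC]
    have h1 : M.pairFil N τ σ q = Submodule.span (periodField τ σ)
        {z | ∃ i j, q ≤ wM i + wN j ∧ z = ω i ⊗ₜ η j} := by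
      rw [pairFil]
      refine le_antisymm (iSup_le fun m => iSup_le fun n => iSup_le fun h => ?_)
        (Submodule.span_le.2 ?_)
      · rw [hω, hη, Submodule.map₂_span_span]
        refine Submodule.span_mono ?_
        rintro _ ⟨_, ⟨i, hi, rfl⟩, _, ⟨j, hj, rfl⟩, rfl⟩
        simp only [Set.mem_ofPred_eq] at hi hj
        exact ⟨i, j, by omega, rfl⟩
      · rintro _ ⟨i, j, h, rfl⟩
        -- The weight of `ω i` is used as the first degree; then the second degree `q - wM i` is at
        -- most the weight of `η j`.
        refine Submodule.mem_iSup_of_mem (wM i) (Submodule.mem_iSup_of_mem (q - wM i)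
          (Submodule.mem_iSup_of_mem (by omega) (Submodule.apply_mem_map₂ _ ?_ ?_)))
        · rw [hω]
          exact Submodule.subset_span ⟨i, show wM i ≤ wM i from le_rfl, rfl⟩
        · rw [hη]
          exact Submodule.subset_span ⟨j, show q - wM i ≤ wN j by omega, rfl⟩
    rw [h1, span_image_span]
    congr 1
    ext z
    constructor
    · rintro ⟨ij, h, rfl⟩
      exact ⟨_, ⟨ij.1, ij.2, not_lt.1 h, rfl⟩, rfl⟩
    · rintro ⟨_, ⟨i, j, h, rfl⟩, rfl⟩
      exact ⟨(i, j), not_lt.2 h, rfl⟩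
  · exact (linearIndependent_inclB_tmul (M.signBasis u).linearIndependent
      (N.signBasis v).linearIndependent).comp
      (Subtype.val : PairCol (M.dSign τ σ) (N.dSign τ σ) ε → _) Subtype.val_injective
  · rw [span_pairGenB_univ, map_pairBsign M N σ (M.signBasis u).span_eq (N.signBasis v).span_eq]
    refine le_antisymm (Submodule.span_le.2 ?_) (Submodule.span_le.2 ?_)
    · rintro _ ⟨c, rfl⟩
      have h1 := pairProj_signBasis (u := u) (v := v) ε c.1.1 c.1.2
      rw [if_pos c.2] at h1
      have h2 := Submodule.smul_mem _ (2⁻¹ : σ.fieldRange) (Submodule.subset_span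
        (R := σ.fieldRange) (s := {z | ∃ s ∈ Set.range (M.signBasis u),
          ∃ s' ∈ Set.range (N.signBasis v),
          z = M.pairProj N σ ε (M.inclB τ σ s ⊗ₜ N.inclB τ σ s')})
        ⟨_, ⟨c.1.1, rfl⟩, _, ⟨c.1.2, rfl⟩, rfl⟩)
      rw [h1] at h2
      have h3 : ∀ z : M.BC τ σ ⊗[ℂ] N.BC τ σ, (2⁻¹ : σ.fieldRange) • (2 : ℂ) • z = z := fun z => by
        change (2⁻¹ : ℂ) • (2 : ℂ) • z = z
        rw [smul_smul, inv_mul_cancel₀ two_ne_zero, one_smul]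
      rwa [h3] at h2
    · rintro _ ⟨_, ⟨c, rfl⟩, _, ⟨c', rfl⟩, rfl⟩
      rw [pairProj_signBasis]
      split_ifs with h
      · exact Submodule.smul_mem _ (2 : σ.fieldRange) (Submodule.subset_span ⟨⟨(c, c'), h⟩, rfl⟩)
      · rw [zero_smul]
        exact Submodule.zero_mem _
  · intro c
    rw [TensorProduct.congr_tmul, signBasis_apply, signBasis_apply, hX, hY, TensorProduct.sum_tmul,
      Fintype.sum_prod_type]
    refine Finset.sum_congr rfl fun i _ => ?_
    rw [TensorProduct.tmul_sum]
    refine Finset.sum_congr rfl fun j _ => ?_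
    rw [TensorProduct.smul_tmul_smul]
    rfl

end Bases

end Realization
end YoshidaPeriods

/-! ### Generators obtained from spanning sets -/

namespace YoshidaPeriods

theorem mem_span_image_of_semilinear {R S V W : Type*} [Semiring R] [Semiring S] [AddCommMonoid V]
    [AddCommMonoid W] [Module R V] [Module S W] {f : R →+* S} (φ : V →ₛₗ[f] W) {s : Set V} {x : V}
    (hx : x ∈ Submodule.span R s) : φ x ∈ Submodule.span S (φ '' s) := by
  induction hx using Submodule.span_induction with
  | mem x hx => exact Submodule.subset_span ⟨x, hx, rfl⟩
  | zero => rw [map_zero]; exact Submodule.zero_mem _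
  | add x y _ _ hx hy => rw [map_add]; exact Submodule.add_mem _ hx hy
  | smul r x _ hx => rw [LinearMap.map_smulₛₗ]; exact Submodule.smul_mem _ _ hx

theorem span_range_of_isBaseChange {K : Subfield ℂ} {V V' : Type*} [AddCommGroup V]
    [AddCommGroup V'] [Module K V] [Module ℂ V'] {f : V →ₗ[K] V'} (hf : IsBaseChange ℂ f) :
    Submodule.span ℂ (Set.range f) = ⊤ := by
  rw [eq_top_iff, ← (hf.basis (Module.Basis.ofVectorSpace K V)).span_eq]
  refine Submodule.span_mono ?_
  rintro _ ⟨i, rfl⟩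
  exact ⟨_, (hf.basis_apply _ i).symm⟩

namespace Realization

section Generators

variable {F : Type uF} {E : Type uE} [Field F] [CharZero F] [Field E] [CharZero E]
variable (M : Realization.{uF, uE, uB, uD} F E) {τ : F →+* ℂ} (σ : E →+* ℂ)

/-- The inclusion of a component of `T_{τ, σ}(M)`. -/
def embT (a : Orbit τ) : BaseChange (pairingField σ a) M.HdR →ₗ[periodField τ σ] M.T τ σ := by
  classical
  exact LinearMap.single (periodField τ σ) (fun a : Orbit τ => BaseChange (pairingField σ a) M.HdR) a

/-- The inclusion of a component of `T_{τ, σ}(M) ⊗ ℂ`. -/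
def embTC (a : Orbit τ) : BaseChange (pairing σ a.1) M.HdR →ₗ[ℂ] M.TC τ σ := by
  classical
  exact LinearMap.single ℂ (fun a : Orbit τ => BaseChange (pairing σ a.1) M.HdR) a

/-- The inclusion of a component of `B_σ(M_τ)`. -/
def embB (a : Orbit τ) : BaseChange σ.rangeRestrictField (M.HB a.1) →ₗ[σ.fieldRange] M.B τ σ := by
  classical
  exact LinearMap.single σ.fieldRange
    (fun a : Orbit τ => BaseChange σ.rangeRestrictField (M.HB a.1)) a

/-- The inclusion of a component of `B_σ(M_τ) ⊗ ℂ`. -/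
def embBC (a : Orbit τ) : BaseChange σ (M.HB a.1) →ₗ[ℂ] M.BC τ σ := by
  classical
  exact LinearMap.single ℂ (fun a : Orbit τ => BaseChange σ (M.HB a.1)) a

/-- The component of index `a` of an element of `T_{τ, σ}(M) ⊗ ℂ`. -/
def evalTC (a : Orbit τ) : M.TC τ σ →ₗ[ℂ] BaseChange (pairing σ a.1) M.HdR :=
  (LinearMap.proj a : (∀ a : Orbit τ, BaseChange (pairing σ a.1) M.HdR) →ₗ[ℂ] _)

/-- The component of index `a` of an element of `B_σ(M_τ) ⊗ ℂ`. -/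
def evalBC (a : Orbit τ) : M.BC τ σ →ₗ[ℂ] BaseChange σ (M.HB a.1) :=
  (LinearMap.proj a : (∀ a : Orbit τ, BaseChange σ (M.HB a.1)) →ₗ[ℂ] _)

theorem embT_incl (a : Orbit τ) (x : M.HdR) : M.embT σ a (BaseChange.incl _ x) = M.genT σ a x := rfl

theorem embTC_incl (a : Orbit τ) (x : M.HdR) :
    M.embTC σ a (BaseChange.incl _ x) = M.genTC σ a x := rfl

theorem evalTC_embTC_same (a : Orbit τ) : M.evalTC σ a ∘ₗ M.embTC σ a = LinearMap.id := by
  classical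
  exact LinearMap.proj_comp_single_same ℂ
    (fun a : Orbit τ => BaseChange (pairing σ a.1) M.HdR) a

theorem evalTC_embTC_of_ne {a b : Orbit τ} (h : a ≠ b) : M.evalTC σ a ∘ₗ M.embTC σ b = 0 := by
  classical
  exact LinearMap.proj_comp_single_ne ℂ
    (fun a : Orbit τ => BaseChange (pairing σ a.1) M.HdR) a b h

theorem I0_genBC_eq (a : Orbit τ) (u : M.HB a.1) :
    M.I0 τ σ (M.genBC σ a u) = M.embTC σ a (M.comparison a.1 σ (BaseChange.incl _ u)) := by
  classical
  funext b
  change M.comparison b.1 σ (M.genBC σ a u b) = (Pi.single a _ :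
    ∀ a : Orbit τ, BaseChange (pairing σ a.1) M.HdR) b
  by_cases h : b = a
  · subst h
    rw [genBC_same, Pi.single_eq_same]
  · rw [genBC_of_ne M σ h, Pi.single_eq_of_ne h, map_zero]

theorem genT_mem_span {s : Set M.HdR} {x : M.HdR} (hx : x ∈ Submodule.span (E ⊗[ℚ] F) s)
    (a : Orbit τ) :
    M.genT σ a x ∈ Submodule.span (periodField τ σ) {z | ∃ a, ∃ x ∈ s, z = M.genT (τ := τ) σ a x} := by
  rw [← embT_incl]
  have h1 := mem_span_image_of_semilinear (BaseChange.incl (pairingField σ a)) hx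
  have h2 := mem_span_image_of_semilinear (M.embT σ a) h1
  refine Submodule.span_mono ?_ h2
  rintro _ ⟨_, ⟨y, hy, rfl⟩, rfl⟩
  exact ⟨a, y, hy, rfl⟩

theorem genTC_mem_span {s : Set M.HdR} {x : M.HdR} (hx : x ∈ Submodule.span (E ⊗[ℚ] F) s)
    (a : Orbit τ) :
    M.genTC σ a x ∈ Submodule.span ℂ {z | ∃ a, ∃ x ∈ s, z = M.genTC (τ := τ) σ a x} := by
  rw [← embTC_incl]
  have h1 := mem_span_image_of_semilinear (BaseChange.incl (pairing σ a.1)) hx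
  have h2 := mem_span_image_of_semilinear (M.embTC σ a) h1
  refine Submodule.span_mono ?_ h2
  rintro _ ⟨_, ⟨y, hy, rfl⟩, rfl⟩
  exact ⟨a, y, hy, rfl⟩

theorem span_genT_of_span {s : Set M.HdR} (hs : Submodule.span (E ⊗[ℚ] F) s = ⊤) :
    Submodule.span (periodField τ σ) {z | ∃ a, ∃ x ∈ s, z = M.genT (τ := τ) σ a x} = ⊤ := by
  rw [eq_top_iff, ← M.span_genT σ, Submodule.span_le]
  rintro _ ⟨a, x, rfl⟩
  exact M.genT_mem_span σ (hs ▸ Submodule.mem_top) a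

theorem TCFil_eq_span_of_span {s : Set M.HdR} {p : ℤ} (hs : M.Fil p = Submodule.span (E ⊗[ℚ] F) s) :
    M.TCFil τ σ p = Submodule.span ℂ {z | ∃ a, ∃ x ∈ s, z = M.genTC (τ := τ) σ a x} := by
  rw [TCFil_eq_span]
  refine le_antisymm (Submodule.span_le.2 ?_) (Submodule.span_mono ?_)
  · rintro _ ⟨a, x, hx, rfl⟩
    exact M.genTC_mem_span σ (hs ▸ hx) a
  · rintro _ ⟨a, x, hx, rfl⟩
    exact ⟨a, x, hs ▸ Submodule.subset_span hx, rfl⟩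

theorem span_genB_of_span {s : ∀ a : Orbit τ, Set (M.HB a.1)}
    (hs : ∀ a, Submodule.span E (s a) = ⊤) :
    Submodule.span σ.fieldRange {z | ∃ a, ∃ x ∈ s a, z = M.genB σ a x} = ⊤ := by
  rw [eq_top_iff, ← M.span_genB σ, Submodule.span_le]
  rintro _ ⟨a, x, rfl⟩
  have h1 := mem_span_image_of_semilinear (BaseChange.incl σ.rangeRestrictField)
    (show x ∈ Submodule.span E (s a) from hs a ▸ Submodule.mem_top)
  have h2 := mem_span_image_of_semilinear (M.embB σ a) h1
  refine Submodule.span_mono ?_ h2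
  rintro _ ⟨_, ⟨y, hy, rfl⟩, rfl⟩
  exact ⟨a, y, hy, rfl⟩

/-- The rational vectors span the complex space, and they are themselves spanned by vectors
supported at one embedding. For tensor products this reduces identities of maps to pure tensors. -/
theorem BC_hom_ext {V : Type*} [AddCommGroup V] [Module ℂ V] {s : ∀ a : Orbit τ, Set (M.HB a.1)}
    (hs : ∀ a, Submodule.span E (s a) = ⊤) {φ ψ : M.BC τ σ →ₗ[ℂ] V}
    (h : ∀ a, ∀ x ∈ s a, φ (M.genBC σ a x) = ψ (M.genBC σ a x)) : φ = ψ := by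
  have h1 : Submodule.span ℂ {z | ∃ a, ∃ x ∈ s a, z = M.genBC σ a x} = ⊤ := by
    have h2 : Submodule.span ℂ (M.inclB τ σ '' (⊤ : Submodule σ.fieldRange (M.B τ σ))) = ⊤ := by
      rw [Submodule.top_coe, Set.image_univ]
      exact span_range_of_isBaseChange (M.isBaseChange_inclB τ σ)
    rw [← M.span_genB_of_span σ hs, span_image_span] at h2
    rw [← h2]
    congr 1
    ext z
    constructor
    · rintro ⟨a, x, hx, rfl⟩
      exact ⟨_, ⟨a, x, hx, rfl⟩, M.inclB_genB σ a x⟩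
    · rintro ⟨_, ⟨a, x, hx, rfl⟩, rfl⟩
      exact ⟨a, x, hx, M.inclB_genB σ a x⟩
  refine LinearMap.ext_on h1 ?_
  rintro _ ⟨a, x, hx, rfl⟩
  exact h a x hx

/-- The complexification of a sign eigenspace in terms of generators. -/
theorem map_Bsign {s : ∀ a : Orbit τ, Set (M.HB a.1)} (hs : ∀ a, Submodule.span E (s a) = ⊤)
    (ε : ℤˣ) : (M.Bsign τ σ ε).map (M.inclB τ σ) = Submodule.span σ.fieldRange
      {z | ∃ a, ∃ x ∈ s a,
        z = M.genBC σ a x + ((ε : ℤ) : ℂ) • M.involutionC τ σ (M.genBC σ a x)} := by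
  rw [Bsign_eq_map, ← M.span_genB_of_span σ hs, Submodule.map_span, Submodule.map_span]
  have key : ∀ a x, M.inclB τ σ ((LinearMap.id + ((ε : ℤ) : σ.fieldRange) • M.involution τ σ :
      Module.End σ.fieldRange _) (M.genB σ a x)) =
      M.genBC σ a x + ((ε : ℤ) : ℂ) • M.involutionC τ σ (M.genBC σ a x) := by
    intro a x
    rw [LinearMap.add_apply, LinearMap.id_apply, LinearMap.smul_apply, map_add, map_smul,
      ← involutionC_inclB, inclB_genB]
    rfl
  congr 1
  ext z
  constructor
  · rintro ⟨_, ⟨_, ⟨a, x, hx, rfl⟩, rfl⟩, rfl⟩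
    exact ⟨a, x, hx, key a x⟩
  · rintro ⟨a, x, hx, rfl⟩
    exact ⟨_, ⟨_, ⟨a, x, hx, rfl⟩, rfl⟩, key a x⟩

end Generators

/-- `M'` is obtained from `M` by extension of scalars along `g`. -/
structure Pullback {F : Type uF} {E : Type uE} {G : Type uG} [Field F] [CharZero F] [Field E]
    [CharZero E] [Field G] [CharZero G] (M : Realization.{uF, uE, uB, uD} F E)
    (M' : Realization.{uG, uE, uB', uD'} G E) (g : F →+* G) (σ : E →+* ℂ) where
  incl : M.HdR → M'.HdR
  span_incl : Submodule.span (E ⊗[ℚ] G) (Set.range incl) = ⊤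
  Fil_eq : ∀ p, M'.Fil p = Submodule.span (E ⊗[ℚ] G) (incl '' (M.Fil p : Set M.HdR))
  equivB : ∀ υ, M'.HB υ ≃ₗ[E] M.HB (υ.comp g)
  equivB_Finf : ∀ υ υ' h h' u, equivB υ' (M'.Finf υ υ' h u) =
    M.Finf (υ.comp g) (υ'.comp g) h' (equivB υ u)
  equivT : ∀ υ, BaseChange (pairing σ υ) M'.HdR ≃ₗ[ℂ] BaseChange (pairing σ (υ.comp g)) M.HdR
  equivT_incl : ∀ υ x, equivT υ (BaseChange.incl _ (incl x)) = BaseChange.incl _ x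
  equivT_comparison : ∀ υ u, equivT υ (M'.comparison υ σ (BaseChange.incl _ u)) =
    M.comparison (υ.comp g) σ (BaseChange.incl _ (equivB υ u))

/-! ### The identity and an extension of scalars, treated uniformly -/

section Pullbacks

variable {F : Type uF} {E : Type uE} {G : Type uG} [Field F] [CharZero F] [Field E] [CharZero E]
  [Field G] [CharZero G]

/-- Extension of scalars along the identity. -/
def Pullback.id (M : Realization.{uF, uE, uB, uD} F E) (σ : E →+* ℂ) :
    Pullback M M (RingHom.id F) σ where
  incl x := x
  span_incl := by rw [Set.range_id', Submodule.span_univ]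
  Fil_eq p := by rw [Set.image_id', Submodule.span_eq]
  equivB υ := LinearEquiv.refl E (M.HB υ)
  equivB_Finf _ _ _ _ _ := rfl
  equivT υ := LinearEquiv.refl ℂ (BaseChange (pairing σ υ) M.HdR)
  equivT_incl _ _ := rfl
  equivT_comparison _ _ := rfl

/-- Extension of scalars along `g`. -/
def Pullback.extend (M : Realization.{uF, uE, uB, uD} F E) (g : F →+* G) (σ : E →+* ℂ) :
    Pullback M (M.extend g) g σ where
  incl := BaseChange.incl (idTensor g)
  span_incl := BaseChange.span_range_incl _
  Fil_eq _ := rfl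
  equivB υ := LinearEquiv.refl E (M.HB (υ.comp g))
  equivB_Finf _ _ _ _ _ := rfl
  equivT υ := (BaseChange.trans (idTensor g) (pairing σ υ) (pairing σ (υ.comp g))
    (pairing_idTensor g σ υ)).symm
  equivT_incl _ x := BaseChange.trans_symm_incl _ _ _ _ x
  equivT_comparison _ _ := LinearEquiv.symm_apply_apply _ _

end Pullbacks

end Realization
end YoshidaPeriods

/-! ### The maps from tensor products of scalar extensions -/

namespace YoshidaPeriods

variable {F : Type uF} {E : Type uE} {G : Type uG} [Field F] [CharZero F] [Field E] [CharZero E]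
  [Field G] [CharZero G]

/-- The restriction to `F` of an element of `{υ₀, ρυ₀}`. -/
abbrev Orbit.restrict {τ : F →+* ℂ} {υ₀ : G →+* ℂ} (g : F →+* G)
    (h : υ₀.comp g = τ ∨ υ₀.comp g = ComplexEmbedding.conjugate τ) (υ : Orbit υ₀) : Orbit τ :=
  ⟨υ.1.comp g, by
    rcases υ with ⟨υ, rfl | rfl⟩
    · exact h
    · rcases h with h | h
      · exact Or.inr (congrArg ComplexEmbedding.conjugate h)
      · exact Or.inl ((congrArg ComplexEmbedding.conjugate h).trans (star_star τ))⟩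

namespace Realization

variable {M N : Realization.{uF, uE, uB, uD} F E} {M' N' : Realization.{uG, uE, uB', uD'} G E}
  {g₁ g₂ : F →+* G} {τ : F →+* ℂ} {σ : E →+* ℂ} {υ₀ : G →+* ℂ}

section Tensor

variable (M' N')

/-- `x ⊗ y`, as an element of the de Rham realization of `M' ⊗ N'`. -/
def tmulHdR (x : M'.HdR) (y : N'.HdR) : (M'.tensor N').HdR := x ⊗ₜ[E ⊗[ℚ] G] y

/-- `u ⊗ v`, as an element of a Betti realization of `M' ⊗ N'`. -/
def tmulHB (υ : G →+* ℂ) (u : M'.HB υ) (v : N'.HB υ) : (M'.tensor N').HB υ := u ⊗ₜ[E] v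

/-- The components of the de Rham realization of `M' ⊗ N'`. -/
def tensorEquivT (σ : E →+* ℂ) (υ : G →+* ℂ) : BaseChange (pairing σ υ) (M'.tensor N').HdR ≃ₗ[ℂ]
    BaseChange (pairing σ υ) M'.HdR ⊗[ℂ] BaseChange (pairing σ υ) N'.HdR :=
  BaseChange.tensorEquiv (V := M'.HdR) (W := N'.HdR) (pairing σ υ)

/-- The components of the Betti realizations of `M' ⊗ N'`. -/
def tensorEquivB (σ : E →+* ℂ) (υ : G →+* ℂ) : BaseChange σ ((M'.tensor N').HB υ) ≃ₗ[ℂ]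
    BaseChange σ (M'.HB υ) ⊗[ℂ] BaseChange σ (N'.HB υ) :=
  BaseChange.tensorEquiv (V := M'.HB υ) (W := N'.HB υ) σ

theorem tensorEquivT_incl (υ : G →+* ℂ) (x : M'.HdR) (y : N'.HdR) :
    M'.tensorEquivT N' σ υ (BaseChange.incl _ (M'.tmulHdR N' x y)) =
      BaseChange.incl _ x ⊗ₜ BaseChange.incl _ y :=
  BaseChange.tensorEquiv_incl (pairing σ υ) x y

theorem tensorEquivB_incl (υ : G →+* ℂ) (u : M'.HB υ) (v : N'.HB υ) :
    M'.tensorEquivB N' σ υ (BaseChange.incl _ (M'.tmulHB N' υ u v)) =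
      BaseChange.incl _ u ⊗ₜ BaseChange.incl _ v :=
  BaseChange.tensorEquiv_incl σ u v

theorem tensor_span_tmul {s : Set M'.HdR} {s' : Set N'.HdR}
    (hs : Submodule.span (E ⊗[ℚ] G) s = ⊤) (hs' : Submodule.span (E ⊗[ℚ] G) s' = ⊤) :
    Submodule.span (E ⊗[ℚ] G) {z : (M'.tensor N').HdR | ∃ x ∈ s, ∃ y ∈ s', z = M'.tmulHdR N' x y} = ⊤ := by
  refine Eq.trans ?_ (TensorProduct.map₂_mk_top_top_eq_top (R := E ⊗[ℚ] G) (M := M'.HdR)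
    (N := N'.HdR))
  rw [← hs, ← hs', Submodule.map₂_span_span]
  congr 1
  ext z
  constructor
  · rintro ⟨x, hx, y, hy, rfl⟩
    exact ⟨x, hx, y, hy, rfl⟩
  · rintro ⟨x, hx, y, hy, rfl⟩
    exact ⟨x, hx, y, hy, rfl⟩

theorem tensor_Fil_eq_span {s : ℤ → Set M'.HdR} {s' : ℤ → Set N'.HdR}
    (hs : ∀ p, M'.Fil p = Submodule.span (E ⊗[ℚ] G) (s p))
    (hs' : ∀ p, N'.Fil p = Submodule.span (E ⊗[ℚ] G) (s' p)) (q : ℤ) :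
    (M'.tensor N').Fil q = Submodule.span (E ⊗[ℚ] G)
      {z : (M'.tensor N').HdR | ∃ m n : ℤ, m + n = q ∧ ∃ x ∈ s m, ∃ y ∈ s' n,
        z = M'.tmulHdR N' x y} := by
  suffices h : (⨆ (m : ℤ) (n : ℤ) (_ : m + n = q),
      Submodule.map₂ (TensorProduct.mk (E ⊗[ℚ] G) M'.HdR N'.HdR) (M'.Fil m) (N'.Fil n)) =
      Submodule.span (E ⊗[ℚ] G) {z : M'.HdR ⊗[E ⊗[ℚ] G] N'.HdR | ∃ m n : ℤ, m + n = q ∧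
        ∃ x ∈ s m, ∃ y ∈ s' n, z = x ⊗ₜ y} from h
  refine le_antisymm (iSup_le fun m => iSup_le fun n => iSup_le fun h => ?_)
    (Submodule.span_le.2 ?_)
  · rw [hs, hs', Submodule.map₂_span_span]
    refine Submodule.span_mono ?_
    rintro _ ⟨x, hx, y, hy, rfl⟩
    exact ⟨m, n, h, x, hx, y, hy, rfl⟩
  · rintro _ ⟨m, n, h, x, hx, y, hy, rfl⟩
    refine Submodule.mem_iSup_of_mem m (Submodule.mem_iSup_of_mem n
      (Submodule.mem_iSup_of_mem h (Submodule.apply_mem_map₂ _ ?_ ?_)))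
    · rw [hs]
      exact Submodule.subset_span hx
    · rw [hs']
      exact Submodule.subset_span hy

theorem tensor_span_HB (υ : Orbit υ₀) : Submodule.span E
    {z : (M'.tensor N').HB υ.1 | ∃ (u : M'.HB υ.1) (v : N'.HB υ.1), z = M'.tmulHB N' υ.1 u v} = ⊤ := by
  refine Eq.trans ?_ (TensorProduct.span_tmul_eq_top E (M'.HB υ.1) (N'.HB υ.1))
  congr 1
  ext z
  constructor
  · rintro ⟨u, v, rfl⟩
    exact ⟨u, v, rfl⟩
  · rintro ⟨u, v, rfl⟩
    exact ⟨u, v, rfl⟩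

theorem tensor_comparison (υ : G →+* ℂ) (u : M'.HB υ) (v : N'.HB υ) :
    M'.tensorEquivT N' σ υ
      ((M'.tensor N').comparison υ σ (BaseChange.incl σ (M'.tmulHB N' υ u v))) =
      M'.comparison υ σ (BaseChange.incl σ u) ⊗ₜ N'.comparison υ σ (BaseChange.incl σ v) := by
  change M'.tensorEquivT N' σ υ ((M'.tensorEquivT N' σ υ).symm
    (TensorProduct.congr (M'.comparison υ σ) (N'.comparison υ σ)
      (M'.tensorEquivB N' σ υ (BaseChange.incl σ (M'.tmulHB N' υ u v))))) = _
  rw [LinearEquiv.apply_symm_apply, tensorEquivB_incl, TensorProduct.congr_tmul]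

theorem tensor_involutionC (υ : Orbit υ₀) (u : M'.HB υ.1) (v : N'.HB υ.1) :
    (M'.tensor N').involutionC υ₀ σ ((M'.tensor N').genBC σ υ (M'.tmulHB N' υ.1 u v)) =
      (M'.tensor N').genBC σ υ.conj
        (M'.tmulHB N' υ.conj.1 (M'.Finf υ.1 υ.conj.1 rfl u) (N'.Finf υ.1 υ.conj.1 rfl v)) :=
  involutionC_genBC _ σ (a := υ) (b := υ.conj) rfl _

end Tensor

namespace Pullback

section

variable (A : Pullback M M' g₁ σ) (B : Pullback N N' g₂ σ)
variable (h₁ : υ₀.comp g₁ = τ ∨ υ₀.comp g₁ = ComplexEmbedding.conjugate τ)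
  (h₂ : υ₀.comp g₂ = τ ∨ υ₀.comp g₂ = ComplexEmbedding.conjugate τ)

/-- The inclusion of a component of `T_{υ₀, σ}(M' ⊗ N') ⊗ ℂ` into the tensor product of
`T_{τ, σ}(M) ⊗ ℂ` and `T_{τ, σ}(N) ⊗ ℂ`. -/
def compT (υ : Orbit υ₀) : BaseChange (pairing σ υ.1) (M'.tensor N').HdR →ₗ[ℂ]
    M.TC τ σ ⊗[ℂ] N.TC τ σ :=
  TensorProduct.map (M.embTC σ (υ.restrict g₁ h₁) ∘ₗ (A.equivT υ.1).toLinearMap)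
    (N.embTC σ (υ.restrict g₂ h₂) ∘ₗ (B.equivT υ.1).toLinearMap) ∘ₗ
      (M'.tensorEquivT N' σ υ.1).toLinearMap

/-- The inclusion of a component of `B_σ(M' ⊗ N') ⊗ ℂ` into the tensor product of
`B_σ(M) ⊗ ℂ` and `B_σ(N) ⊗ ℂ`. -/
def compB (υ : Orbit υ₀) : BaseChange σ ((M'.tensor N').HB υ.1) →ₗ[ℂ]
    M.BC τ σ ⊗[ℂ] N.BC τ σ :=
  TensorProduct.map (M.embBC σ (υ.restrict g₁ h₁) ∘ₗ BaseChange.map σ (A.equivB υ.1).toLinearMap)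
    (N.embBC σ (υ.restrict g₂ h₂) ∘ₗ BaseChange.map σ (B.equivB υ.1).toLinearMap) ∘ₗ
      (M'.tensorEquivB N' σ υ.1).toLinearMap

variable [Fintype (Orbit υ₀)]

/-- The sum of the maps `compT`. -/
def sumT : (M'.tensor N').TC υ₀ σ →ₗ[ℂ] M.TC τ σ ⊗[ℂ] N.TC τ σ :=
  ∑ υ, A.compT B h₁ h₂ υ ∘ₗ (M'.tensor N').evalTC σ υ

/-- The sum of the maps `compB`. -/
def sumB : (M'.tensor N').BC υ₀ σ →ₗ[ℂ] M.BC τ σ ⊗[ℂ] N.BC τ σ :=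
  ∑ υ, A.compB B h₁ h₂ υ ∘ₗ (M'.tensor N').evalBC σ υ

theorem sumT_embTC (υ : Orbit υ₀) (t : BaseChange (pairing σ υ.1) (M'.tensor N').HdR) :
    A.sumT B h₁ h₂ ((M'.tensor N').embTC σ υ t) = A.compT B h₁ h₂ υ t := by
  rw [sumT, LinearMap.sum_apply, Finset.sum_eq_single υ]
  · rw [LinearMap.comp_apply]
    exact congrArg _ (LinearMap.congr_fun (evalTC_embTC_same (M'.tensor N') σ υ) t)
  · intro υ' _ h
    rw [LinearMap.comp_apply]
    exact (congrArg _ (LinearMap.congr_fun (evalTC_embTC_of_ne (M'.tensor N') σ h) t)).trans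
      (map_zero _)
  · exact fun h => absurd (Finset.mem_univ _) h

theorem sumT_gen (υ : Orbit υ₀) (x : M.HdR) (y : N.HdR) :
    A.sumT B h₁ h₂ ((M'.tensor N').genTC σ υ (M'.tmulHdR N' (A.incl x) (B.incl y))) =
      M.genTC σ (υ.restrict g₁ h₁) x ⊗ₜ N.genTC σ (υ.restrict g₂ h₂) y := by
  rw [← embTC_incl, sumT_embTC, compT, LinearMap.comp_apply, LinearEquiv.coe_coe,
    tensorEquivT_incl, TensorProduct.map_tmul, LinearMap.comp_apply, LinearMap.comp_apply, LinearEquiv.coe_coe,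
    LinearEquiv.coe_coe, A.equivT_incl, B.equivT_incl]
  rfl

theorem sumB_gen (υ : Orbit υ₀) (u : M'.HB υ.1) (v : N'.HB υ.1) :
    A.sumB B h₁ h₂ ((M'.tensor N').genBC σ υ (M'.tmulHB N' υ.1 u v)) =
      M.genBC σ (υ.restrict g₁ h₁) (A.equivB υ.1 u) ⊗ₜ
        N.genBC σ (υ.restrict g₂ h₂) (B.equivB υ.1 v) := by
  rw [sumB, LinearMap.sum_apply, Finset.sum_eq_single υ]
  · rw [LinearMap.comp_apply]
    refine (congrArg _ (genBC_same (M'.tensor N') σ υ _)).trans ?_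
    rw [compB, LinearMap.comp_apply, LinearEquiv.coe_coe, tensorEquivB_incl,
      TensorProduct.map_tmul, LinearMap.comp_apply, LinearMap.comp_apply, BaseChange.map_incl,
      BaseChange.map_incl]
    rfl
  · intro υ' _ h
    rw [LinearMap.comp_apply]
    exact (congrArg _ (genBC_of_ne (M'.tensor N') σ h _)).trans (map_zero _)
  · exact fun h => absurd (Finset.mem_univ _) h

theorem pairI0_sumB : (M.pairI0 N σ τ).toLinearMap ∘ₗ A.sumB B h₁ h₂ =
    A.sumT B h₁ h₂ ∘ₗ ((M'.tensor N').I0 υ₀ σ).toLinearMap := by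
  refine BC_hom_ext _ σ (fun υ => tensor_span_HB M' N' υ) ?_
  rintro υ _ ⟨u, v, rfl⟩
  rw [LinearMap.comp_apply, LinearMap.comp_apply, LinearEquiv.coe_coe, LinearEquiv.coe_coe,
    sumB_gen, TensorProduct.congr_tmul, I0_genBC_eq, I0_genBC_eq, I0_genBC_eq, sumT_embTC, compT,
    LinearMap.comp_apply, LinearEquiv.coe_coe, tensor_comparison, TensorProduct.map_tmul,
    LinearMap.comp_apply, LinearMap.comp_apply, LinearEquiv.coe_coe, LinearEquiv.coe_coe,
    A.equivT_comparison, B.equivT_comparison]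

/-- Restriction of embeddings commutes with complex conjugation, so applying F_∞ to a pure tensor of
M' ⊗ N' is the same as applying it to both factors. -/
theorem pairInvolution_sumB : M.pairInvolution N σ τ ∘ₗ A.sumB B h₁ h₂ =
    A.sumB B h₁ h₂ ∘ₗ (M'.tensor N').involutionC υ₀ σ := by
  refine BC_hom_ext _ σ (fun υ => tensor_span_HB M' N' υ) ?_
  rintro υ _ ⟨u, v, rfl⟩
  rw [LinearMap.comp_apply, LinearMap.comp_apply, tensor_involutionC, sumB_gen, sumB_gen,
    TensorProduct.map_tmul, A.equivB_Finf υ.1 υ.conj.1 rfl rfl, B.equivB_Finf υ.1 υ.conj.1 rfl rfl,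
    M.involutionC_genBC σ (a := υ.restrict g₁ h₁) (b := υ.conj.restrict g₁ h₁) rfl,
    N.involutionC_genBC σ (a := υ.restrict g₂ h₂) (b := υ.conj.restrict g₂ h₂) rfl]

/-- Different embeddings of `G` in the orbit restrict to different indices in the first factor, so
evaluation at the pair attached to `υ` isolates the component of `z` at `υ`. -/
theorem sumT_injective (hinj : Function.Injective (Orbit.restrict g₁ h₁)) :
    Function.Injective (A.sumT B h₁ h₂) := by
  rw [← LinearMap.ker_eq_bot, LinearMap.ker_eq_bot']
  intro z hz
  funext υ
  have h3 : TensorProduct.map (M.evalTC σ (υ.restrict g₁ h₁)) (N.evalTC σ (υ.restrict g₂ h₂))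
      (A.sumT B h₁ h₂ z) = TensorProduct.congr (A.equivT υ.1) (B.equivT υ.1)
        (M'.tensorEquivT N' σ υ.1 (z υ)) := by
    rw [sumT, LinearMap.sum_apply, map_sum, Finset.sum_eq_single υ]
    · rw [LinearMap.comp_apply, compT, LinearMap.comp_apply, ← LinearMap.comp_apply,
        ← TensorProduct.map_comp, ← LinearMap.comp_assoc, ← LinearMap.comp_assoc,
        evalTC_embTC_same, evalTC_embTC_same]
      rfl
    · intro υ' _ h
      rw [LinearMap.comp_apply, compT, LinearMap.comp_apply, ← LinearMap.comp_apply,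
        ← TensorProduct.map_comp, ← LinearMap.comp_assoc,
        evalTC_embTC_of_ne M σ (hinj.ne h.symm), LinearMap.zero_comp, TensorProduct.map_zero_left]
      rfl
    · exact fun h => absurd (Finset.mem_univ _) h
  rw [hz, map_zero] at h3
  exact (LinearEquiv.map_eq_zero_iff _).1 ((LinearEquiv.map_eq_zero_iff _).1 h3.symm)

/-- Injectivity is transferred from the de Rham side through the commutative square with the
comparison isomorphisms. -/
theorem sumB_injective (hinj : Function.Injective (Orbit.restrict g₁ h₁)) :
    Function.Injective (A.sumB B h₁ h₂) := by
  have h3 : Function.Injective (A.sumT B h₁ h₂ ∘ₗ ((M'.tensor N').I0 υ₀ σ).toLinearMap) :=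
    (A.sumT_injective B h₁ h₂ hinj).comp (LinearEquiv.injective _)
  rw [← pairI0_sumB] at h3
  exact Function.Injective.of_comp h3

end

end Pullback
end Realization
end YoshidaPeriods

/-! ### Period matrices of M' ⊗ N' as bases of parts of T^{M,N} -/

namespace YoshidaPeriods

/-- The period fields attached to `υ₀` and to `τ` are equal, but not by definition. The equality is
applied to spans in a complex space, where no basis depends on the field. -/
theorem span_subfield_eq_of_eq {K K' : Subfield ℂ} (h : K = K') {V : Type*} [AddCommGroup V]
    [Module ℂ V] {s t : Set V} (hst : Submodule.span K s = Submodule.span K t) :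
    Submodule.span K' s = Submodule.span K' t := by
  subst h
  exact hst

theorem linearIndependent_coe_basis {k V ι : Type*} [Field k] [AddCommGroup V] [Module k V]
    {P : Submodule k V} (b : Module.Basis ι k P) : LinearIndependent k fun i => (b i : V) :=
  b.linearIndependent.map' P.subtype (LinearMap.ker_eq_bot.2 P.injective_subtype)

theorem span_coe_basis {k V ι : Type*} [Field k] [AddCommGroup V] [Module k V]
    {P : Submodule k V} (b : Module.Basis ι k P) :
    Submodule.span k (Set.range fun i => (b i : V)) = P := by
  have h := congrArg (Submodule.map P.subtype) b.span_eq
  rw [Submodule.map_span, ← Set.range_comp, Submodule.map_top, Submodule.range_subtype] at h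
  exact h

namespace Realization

variable {F : Type uF} {E : Type uE} {G : Type uG} [Field F] [CharZero F] [Field E] [CharZero E]
  [Field G] [CharZero G]
variable {M N : Realization.{uF, uE, uB, uD} F E} {M' N' : Realization.{uG, uE, uB', uD'} G E}
  {g₁ g₂ : F →+* G} {τ : F →+* ℂ} {σ : E →+* ℂ} {υ₀ : G →+* ℂ}

namespace Pullback

variable (A : Pullback M M' g₁ σ) (B : Pullback N N' g₂ σ)
variable (h₁ : υ₀.comp g₁ = τ ∨ υ₀.comp g₁ = ComplexEmbedding.conjugate τ)
  (h₂ : υ₀.comp g₂ = τ ∨ υ₀.comp g₂ = ComplexEmbedding.conjugate τ)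

/-- The indices of the components of `T^{M, N}` to which `M' ⊗ N'` contributes. -/
def components : Set (Orbit τ × Orbit τ) :=
  Set.range fun υ : Orbit υ₀ => (υ.restrict g₁ h₁, υ.restrict g₂ h₂)

section

variable [Fintype (Orbit υ₀)]

theorem span_sumT (s : Set ((M'.tensor N').T υ₀ σ)) (hs : Submodule.span (periodField υ₀ σ) s = ⊤) :
    Submodule.span (periodField υ₀ σ)
      ((fun t => A.sumT B h₁ h₂ ((M'.tensor N').inclT υ₀ σ t)) '' s) =
      Submodule.span (periodField υ₀ σ) (M.pairGenT N σ (components h₁ h₂)) := by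
  let f : (M'.tensor N').T υ₀ σ →ₗ[periodField υ₀ σ] M.TC τ σ ⊗[ℂ] N.TC τ σ :=
    (A.sumT B h₁ h₂).restrictScalars (periodField υ₀ σ) ∘ₗ (M'.tensor N').inclT υ₀ σ
  change Submodule.span (periodField υ₀ σ) (f '' s) = _
  rw [← Submodule.map_span, hs, ← span_genT_of_span (M'.tensor N') σ
    (tensor_span_tmul M' N' A.span_incl B.span_incl), Submodule.map_span]
  have key : ∀ (υ : Orbit υ₀) x y, f ((M'.tensor N').genT σ υ (M'.tmulHdR N' (A.incl x) (B.incl y))) =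
      M.genTC σ (υ.restrict g₁ h₁) x ⊗ₜ N.genTC σ (υ.restrict g₂ h₂) y := by
    intro υ x y
    rw [← A.sumT_gen B h₁ h₂, ← inclT_genT]
    rfl
  congr 1
  ext z
  constructor
  · rintro ⟨_, ⟨υ, _, ⟨_, ⟨x, rfl⟩, _, ⟨y, rfl⟩, rfl⟩, rfl⟩, rfl⟩
    exact ⟨_, ⟨υ, rfl⟩, x, y, key υ x y⟩
  · rintro ⟨_, ⟨υ, rfl⟩, x, y, rfl⟩
    exact ⟨_, ⟨υ, _, ⟨_, ⟨x, rfl⟩, _, ⟨y, rfl⟩, rfl⟩, rfl⟩, key υ x y⟩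

theorem map_TCFil (q : ℤ) : ((M'.tensor N').TCFil υ₀ σ q).map (A.sumT B h₁ h₂) =
    Submodule.span ℂ (M.pairGenFil N σ (components h₁ h₂) q) := by
  rw [TCFil_eq_span_of_span (M'.tensor N') σ (tensor_Fil_eq_span M' N' A.Fil_eq B.Fil_eq q),
    Submodule.map_span]
  congr 1
  ext z
  constructor
  · rintro ⟨_, ⟨υ, _, ⟨m, n, h, _, ⟨x, hx, rfl⟩, _, ⟨y, hy, rfl⟩, rfl⟩, rfl⟩, rfl⟩
    exact ⟨_, ⟨υ, rfl⟩, m, n, h, x, hx, y, hy, A.sumT_gen B h₁ h₂ υ x y⟩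
  · rintro ⟨_, ⟨υ, rfl⟩, m, n, h, x, hx, y, hy, rfl⟩
    exact ⟨_, ⟨υ, _, ⟨m, n, h, _, ⟨x, hx, rfl⟩, _, ⟨y, hy, rfl⟩, rfl⟩, rfl⟩,
      A.sumT_gen B h₁ h₂ υ x y⟩

theorem map_Bsign (ε : ℤˣ) : ((M'.tensor N').Bsign υ₀ σ ε).map
    ((A.sumB B h₁ h₂).restrictScalars σ.fieldRange ∘ₗ (M'.tensor N').inclB υ₀ σ) =
      Submodule.span σ.fieldRange (M.pairGenB N σ (components h₁ h₂) ε) := by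
  rw [Submodule.map_comp, Realization.map_Bsign _ σ (fun υ => tensor_span_HB M' N' υ),
    Submodule.map_span]
  have key : ∀ (υ : Orbit υ₀) u v, A.sumB B h₁ h₂ ((M'.tensor N').genBC σ υ (M'.tmulHB N' υ.1 u v) +
      ((ε : ℤ) : ℂ) • (M'.tensor N').involutionC υ₀ σ
        ((M'.tensor N').genBC σ υ (M'.tmulHB N' υ.1 u v))) =
      M.pairProj N σ ε (M.genBC σ (υ.restrict g₁ h₁) (A.equivB υ.1 u) ⊗ₜ
        N.genBC σ (υ.restrict g₂ h₂) (B.equivB υ.1 v)) := by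
    intro υ u v
    have h3 := LinearMap.congr_fun (A.pairInvolution_sumB B h₁ h₂)
      ((M'.tensor N').genBC σ υ (M'.tmulHB N' υ.1 u v))
    rw [LinearMap.comp_apply, LinearMap.comp_apply] at h3
    rw [map_add, map_smul, ← h3, sumB_gen]
    rfl
  congr 1
  ext z
  constructor
  · rintro ⟨_, ⟨υ, _, ⟨u, v, rfl⟩, rfl⟩, rfl⟩
    exact ⟨_, ⟨υ, rfl⟩, _, _, key υ u v⟩
  · rintro ⟨_, ⟨υ, rfl⟩, u, v, rfl⟩
    refine ⟨_, ⟨υ, _, ⟨(A.equivB υ.1).symm u, (B.equivB υ.1).symm v, rfl⟩, rfl⟩, ?_⟩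
    refine (key υ _ _).trans ?_
    rw [LinearEquiv.apply_symm_apply, LinearEquiv.apply_symm_apply]

theorem linearIndependent_sumT (hinj : Function.Injective (Orbit.restrict g₁ h₁)) {I : Type*}
    {x : I → (M'.tensor N').T υ₀ σ} (hx : LinearIndependent (periodField υ₀ σ) x) :
    LinearIndependent ℂ fun i => A.sumT B h₁ h₂ ((M'.tensor N').inclT υ₀ σ (x i)) := by
  have h3 : LinearIndependent ℂ fun i => (M'.tensor N').inclT υ₀ σ (x i) :=
    linearIndependent_of_isBaseChange ((M'.tensor N').isBaseChange_inclT υ₀ σ) hx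
  have h4 := h3.map' (A.sumT B h₁ h₂) (LinearMap.ker_eq_bot.2 (A.sumT_injective B h₁ h₂ hinj))
  exact h4

theorem linearIndependent_sumB (hinj : Function.Injective (Orbit.restrict g₁ h₁)) {I : Type*}
    {x : I → (M'.tensor N').B υ₀ σ} (hx : LinearIndependent σ.fieldRange x) :
    LinearIndependent ℂ fun i => A.sumB B h₁ h₂ ((M'.tensor N').inclB υ₀ σ (x i)) := by
  have h3 : LinearIndependent ℂ fun i => (M'.tensor N').inclB υ₀ σ (x i) :=
    linearIndependent_of_isBaseChange ((M'.tensor N').isBaseChange_inclB υ₀ σ) hx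
  have h4 := h3.map' (A.sumB B h₁ h₂) (LinearMap.ker_eq_bot.2 (A.sumB_injective B h₁ h₂ hinj))
  exact h4

theorem isPairBasis (hinj : Function.Injective (Orbit.restrict g₁ h₁))
    (hK : periodField υ₀ σ = periodField τ σ)
    {u : ∀ ε : ℤˣ, Module.Basis (Fin ((M'.tensor N').dSign υ₀ σ ε)) σ.fieldRange
      ((M'.tensor N').Bsign υ₀ σ ε)}
    {ω : Module.Basis (Fin ((M'.tensor N').dStar υ₀ σ)) (periodField υ₀ σ) ((M'.tensor N').T υ₀ σ)}
    (hω : IsAdapted ((M'.tensor N').TFil υ₀ σ) ω) {X : (M'.tensor N').PMatrix υ₀ σ}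
    (hX : ∀ ε j, (M'.tensor N').I0 υ₀ σ
      ((M'.tensor N').inclB υ₀ σ (u ε j : (M'.tensor N').B υ₀ σ)) =
        ∑ i, X i ⟨ε, j⟩ • (M'.tensor N').inclT υ₀ σ (ω i))
    (ε : ℤˣ) (q : ℤ) :
    M.IsPairBasis N σ (components h₁ h₂) ε q
      (fun i : Fin ((M'.tensor N').dStar υ₀ σ) =>
        (i : ℕ) + (M'.tensor N').filDim υ₀ σ q < (M'.tensor N').dStar υ₀ σ)
      (fun i => A.sumT B h₁ h₂ ((M'.tensor N').inclT υ₀ σ (ω i)))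
      (fun j : Fin ((M'.tensor N').dSign υ₀ σ ε) =>
        A.sumB B h₁ h₂ ((M'.tensor N').inclB υ₀ σ (u ε j : (M'.tensor N').B υ₀ σ)))
      (Matrix.of fun i j => X i ⟨ε, j⟩) := by
  refine ⟨?_, ?_, ?_, ?_, ?_, ?_⟩
  · exact A.linearIndependent_sumT B h₁ h₂ hinj ω.linearIndependent
  · refine span_subfield_eq_of_eq hK ?_
    rw [← A.span_sumT B h₁ h₂ _ ω.span_eq, ← Set.range_comp]
    rfl
  · rw [← A.map_TCFil B h₁ h₂, ← span_image_TFil, hω q, span_image_span, Submodule.map_span,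
      ← Set.image_comp, ← Set.image_comp]
    congr 2
    ext i
    exact not_lt
  · exact A.linearIndependent_sumB B h₁ h₂ hinj (linearIndependent_coe_basis (u ε))
  · have h3 := span_coe_basis (u ε)
    rw [← A.map_Bsign B h₁ h₂]
    refine Eq.trans ?_ (congrArg (Submodule.map ((A.sumB B h₁ h₂).restrictScalars σ.fieldRange ∘ₗ
      (M'.tensor N').inclB υ₀ σ)) h3)
    rw [Submodule.map_span, ← Set.range_comp]
    rfl
  · intro j
    have h3 := LinearMap.congr_fun (A.pairI0_sumB B h₁ h₂)
      ((M'.tensor N').inclB υ₀ σ (u ε j : (M'.tensor N').B υ₀ σ))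
    rw [LinearMap.comp_apply, LinearMap.comp_apply, LinearEquiv.coe_coe, LinearEquiv.coe_coe, hX,
      map_sum] at h3
    rw [h3]
    exact Finset.sum_congr rfl fun i _ => map_smul _ _ _

end

/-- A period of `M' ⊗ N'` gives a basis of a part of `T^{M, N}`, provided that its number of
columns is right. -/
theorem exists_isPairBasis (A : Pullback M M' g₁ σ) (B : Pullback N N' g₂ σ)
    (h₁ : υ₀.comp g₁ = τ ∨ υ₀.comp g₁ = ComplexEmbedding.conjugate τ)
    (h₂ : υ₀.comp g₂ = τ ∨ υ₀.comp g₂ = ComplexEmbedding.conjugate τ)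
    (hinj : Function.Injective (Orbit.restrict g₁ h₁))
    (hK : periodField υ₀ σ = periodField τ σ) {ε : ℤˣ} {c : ℂ}
    (hc : (M'.tensor N').IsPeriod υ₀ σ ε c) (q : ℤ) :
    ∃ (d n r : ℕ) (ω : Fin d → M.TC τ σ ⊗[ℂ] N.TC τ σ) (u : Fin n → M.BC τ σ ⊗[ℂ] N.BC τ σ)
      (Z : Matrix (Fin d) (Fin n) ℂ),
      M.IsPairBasis N σ (components h₁ h₂) ε q (fun i : Fin d => (i : ℕ) < r) ω u Z ∧ r ≤ d ∧
      (r = n → ∃ e : {i : Fin d // (i : ℕ) < r} ≃ Fin n, c = (Z.submatrix Subtype.val e).det) := by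
  classical
  have : Fintype (Orbit υ₀) := Fintype.ofFinite _
  obtain ⟨X, ⟨u, ω, hω, hX⟩, rfl⟩ := hc
  -- Nothing is known in advance about the dimension for M' ⊗ N'; the basis that comes with the
  -- period matrix supplies finiteness.
  have : FiniteDimensional (periodField υ₀ σ) ((M'.tensor N').T υ₀ σ) := Module.Finite.of_basis ω
  have hb := A.isPairBasis B h₁ h₂ hinj hK ((isAdapted_iff _ υ₀ σ ω).1 hω) hX ε q
  refine ⟨(M'.tensor N').dStar υ₀ σ, (M'.tensor N').dSign υ₀ σ ε,
    (M'.tensor N').dStar υ₀ σ - (M'.tensor N').filDim υ₀ σ q,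
    fun i => A.sumT B h₁ h₂ ((M'.tensor N').inclT υ₀ σ (ω i)),
    fun j => A.sumB B h₁ h₂ ((M'.tensor N').inclB υ₀ σ (u ε j : (M'.tensor N').B υ₀ σ)),
    Matrix.of fun i j => X i ⟨ε, j⟩, ?_, Nat.sub_le _ _, ?_⟩
  · have : (fun i : Fin ((M'.tensor N').dStar υ₀ σ) =>
        (i : ℕ) < (M'.tensor N').dStar υ₀ σ - (M'.tensor N').filDim υ₀ σ q) =
        fun i : Fin ((M'.tensor N').dStar υ₀ σ) =>
          (i : ℕ) + (M'.tensor N').filDim υ₀ σ q < (M'.tensor N').dStar υ₀ σ := by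
      funext i
      exact propext (by omega)
    rw [this]
    exact hb
  · intro hn
    have hle : (M'.tensor N').dSign υ₀ σ ε ≤ (M'.tensor N').dStar υ₀ σ := by omega
    let e : {i : Fin ((M'.tensor N').dStar υ₀ σ) //
        (i : ℕ) < (M'.tensor N').dStar υ₀ σ - (M'.tensor N').filDim υ₀ σ q} ≃
        Fin ((M'.tensor N').dSign υ₀ σ ε) :=
      { toFun := fun i => ⟨i.1, hn ▸ i.2⟩
        invFun := fun j => ⟨⟨j, j.2.trans_le hle⟩, hn.symm ▸ j.2⟩
        left_inv := fun i => rfl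
        right_inv := fun j => rfl }
    refine ⟨e, ?_⟩
    rw [← Matrix.det_submatrix_equiv_self e.symm]
    congr 1
    ext i j
    -- The default value zero in the definition of the period is never taken, as there are at least
    -- as many rows as columns of sign `ε`.
    rw [Matrix.of_apply, dif_pos (i.2.trans_le hle)]
    rfl

end Pullback

end Realization
end YoshidaPeriods

/-! ### The pair period as a single determinant -/

namespace YoshidaPeriods

theorem card_fin_lt {d r : ℕ} (h : r ≤ d) : Fintype.card {i : Fin d // (i : ℕ) < r} = r := by
  let e : {i : Fin d // (i : ℕ) < r} ≃ Fin r :=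
    { toFun := fun i => ⟨i.1, i.2⟩
      invFun := fun j => ⟨⟨j, j.2.trans_le h⟩, j.2⟩
      left_inv := fun i => rfl
      right_inv := fun j => rfl }
  rw [Fintype.card_congr e, Fintype.card_fin]

/-- The elements of a disjoint union that satisfy a property given on each part. -/
def subtypeSumElim {I₁ I₂ : Type*} (low₁ : I₁ → Prop) (low₂ : I₂ → Prop) :
    {i // Sum.elim low₁ low₂ i} ≃ {i // low₁ i} ⊕ {i // low₂ i} :=
  Equiv.subtypeSum

theorem det_fromBlocks_submatrix {I₁ J₁ I₂ J₂ : Type*} [Fintype I₁] [Fintype I₂] [DecidableEq I₁]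
    [DecidableEq I₂] {low₁ : I₁ → Prop} {low₂ : I₂ → Prop} [DecidablePred low₁]
    [DecidablePred low₂] [DecidablePred (Sum.elim low₁ low₂)]
    (Z₁ : Matrix I₁ J₁ ℂ) (Z₂ : Matrix I₂ J₂ ℂ)
    (e₁ : {i // low₁ i} ≃ J₁) (e₂ : {i // low₂ i} ≃ J₂) :
    ((Matrix.fromBlocks Z₁ 0 0 Z₂).submatrix
      (Subtype.val : {i // Sum.elim low₁ low₂ i} → I₁ ⊕ I₂)
      ((subtypeSumElim low₁ low₂).trans (Equiv.sumCongr e₁ e₂))).det =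
      (Z₁.submatrix Subtype.val e₁).det * (Z₂.submatrix Subtype.val e₂).det := by
  refine (Matrix.det_submatrix_equiv_self
    (subtypeSumElim low₁ low₂).symm _).symm.trans ?_
  refine Eq.trans (congrArg Matrix.det (Matrix.ext ?_))
    (Matrix.det_fromBlocks_zero₂₁ (Z₁.submatrix Subtype.val e₁) 0 (Z₂.submatrix Subtype.val e₂))
  rintro (i | i) (j | j)
  · rfl
  · rfl
  · rfl
  · rfl

/-- The field generated by the images of τ and ρτ is stable under complex conjugation. Hence the two
motives in the complex case have periods over the same field. -/
theorem conjField_subtype {F : Type uF} [Field F] (τ : F →+* ℂ) :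
    conjField (conjField τ).subtype = conjField τ := by
  have h1 : (conjField τ).subtype.fieldRange = conjField τ := Subfield.fieldRange_subtype _
  have h2 : (ComplexEmbedding.conjugate (conjField τ).subtype).fieldRange ≤ conjField τ := by
    have h3 : conjField τ ≤ (conjField τ).comap (starRingEnd ℂ) := by
      refine sup_le ?_ ?_
      · rintro _ ⟨x, rfl⟩
        exact (le_sup_right : _ ≤ conjField τ) ⟨x, rfl⟩
      · rintro _ ⟨x, rfl⟩
        refine (le_sup_left : _ ≤ conjField τ) ⟨x, ?_⟩
        exact (Complex.conj_conj (τ x)).symm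
    rintro _ ⟨x, rfl⟩
    exact h3 x.2
  change (conjField τ).subtype.fieldRange ⊔ _ = _
  rw [h1, sup_eq_left]
  exact h2

theorem restrict_injective {F : Type uF} {G : Type uG} [Field F] [Field G] {τ : F →+* ℂ}
    {υ₀ : G →+* ℂ} (g : F →+* G) (h : υ₀.comp g = τ)
    (hτ : ¬ ComplexEmbedding.IsReal τ) :
    Function.Injective (Orbit.restrict g (Or.inl h : υ₀.comp g = τ ∨ _)) := by
  rintro ⟨υ, rfl | rfl⟩ ⟨υ', rfl | rfl⟩ he
  · rfl
  · exfalso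
    apply hτ
    have := congrArg Subtype.val he
    change υ.comp g = ComplexEmbedding.conjugate (υ.comp g) at this
    rw [h] at this
    exact this.symm
  · exfalso
    apply hτ
    have := congrArg Subtype.val he
    change ComplexEmbedding.conjugate (υ'.comp g) = υ'.comp g at this
    rw [h] at this
    exact this
  · rfl

namespace Realization

variable {F : Type uF} {E : Type uE} [Field F] [CharZero F] [Field E] [CharZero E]
variable {M N : Realization.{uF, uE, uB, uD} F E} {τ : F →+* ℂ} {σ : E →+* ℂ}

namespace IsPairBasis

variable {ε : ℤˣ} {q : ℤ} {P : Set (Orbit τ × Orbit τ)}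

/-- Injectivity gives at least as many low rows as columns in each part, and for the union the
numbers agree, so both inequalities are equalities. -/
theorem exists_merge (hq : M.FilCondition N τ σ ε q) {P₁ P₂ : Set (Orbit τ × Orbit τ)}
    (hd : Disjoint P₁ P₂) (hP : P₁ ∪ P₂ = Set.univ) {d₁ n₁ r₁ d₂ n₂ r₂ : ℕ}
    {ω₁ : Fin d₁ → M.TC τ σ ⊗[ℂ] N.TC τ σ} {u₁ : Fin n₁ → M.BC τ σ ⊗[ℂ] N.BC τ σ}
    {Z₁ : Matrix (Fin d₁) (Fin n₁) ℂ}
    {ω₂ : Fin d₂ → M.TC τ σ ⊗[ℂ] N.TC τ σ} {u₂ : Fin n₂ → M.BC τ σ ⊗[ℂ] N.BC τ σ}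
    {Z₂ : Matrix (Fin d₂) (Fin n₂) ℂ}
    (h₁ : M.IsPairBasis N σ P₁ ε q (fun i : Fin d₁ => (i : ℕ) < r₁) ω₁ u₁ Z₁) (hr₁ : r₁ ≤ d₁)
    (h₂ : M.IsPairBasis N σ P₂ ε q (fun i : Fin d₂ => (i : ℕ) < r₂) ω₂ u₂ Z₂) (hr₂ : r₂ ≤ d₂) :
    r₁ = n₁ ∧ r₂ = n₂ := by
  classical
  have h := h₁.merge hd h₂
  rw [hP] at h
  have h3 := h.card_eq hq
  have h4 := h₁.card_le hq
  have h5 := h₂.card_le hq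
  rw [card_fin_lt hr₁, Fintype.card_fin] at h4
  rw [card_fin_lt hr₂, Fintype.card_fin] at h5
  rw [Fintype.card_congr (subtypeSumElim _ _), Fintype.card_sum, Fintype.card_sum, Fintype.card_fin,
    Fintype.card_fin, card_fin_lt hr₁, card_fin_lt hr₂] at h3
  omega

end IsPairBasis

section Components

variable {F : Type uF} [Field F] {τ : F →+* ℂ}

theorem components_id_of_isReal (hτ : ComplexEmbedding.IsReal τ) :
    Pullback.components (Or.inl rfl : τ.comp (RingHom.id F) = τ ∨ _)
      (Or.inl rfl : τ.comp (RingHom.id F) = τ ∨ _) = Set.univ := by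
  have hs : ∀ a : Orbit τ, a = ⟨τ, Or.inl rfl⟩ := by
    rintro ⟨a, rfl | rfl⟩
    · rfl
    · exact Subtype.ext hτ
  refine Set.eq_univ_of_forall fun p => ⟨⟨τ, Or.inl rfl⟩, ?_⟩
  exact Prod.ext ((hs _).trans (hs _).symm) ((hs _).trans (hs _).symm)

theorem mem_components_id (p : Orbit τ × Orbit τ) :
    p ∈ Pullback.components (Or.inl rfl : τ.comp (RingHom.id F) = τ ∨ _)
      (Or.inl rfl : τ.comp (RingHom.id F) = τ ∨ _) ↔ p.1 = p.2 := by
  constructor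
  · rintro ⟨υ, rfl⟩
    rfl
  · intro h
    exact ⟨p.1, Prod.ext rfl h⟩

/-- The embedding `υ₀` contributes the pair (τ, ρτ) and its conjugate the pair (ρτ, τ). -/
theorem mem_components_swap {G : Type uG} [Field G] {g₁ g₂ : F →+* G} {υ₀ : G →+* ℂ}
    (h₁ : υ₀.comp g₁ = τ) (h₂ : υ₀.comp g₂ = ComplexEmbedding.conjugate τ)
    (hτ : ¬ ComplexEmbedding.IsReal τ) (p : Orbit τ × Orbit τ) :
    p ∈ Pullback.components (Or.inl h₁ : υ₀.comp g₁ = τ ∨ _)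
      (Or.inr h₂ : υ₀.comp g₂ = τ ∨ _) ↔ p.1 ≠ p.2 := by
  have hττ : ComplexEmbedding.conjugate (ComplexEmbedding.conjugate τ) = τ := star_star τ
  constructor
  · rintro ⟨⟨υ, rfl | rfl⟩, rfl⟩ h
    · have := congrArg Subtype.val h
      change υ.comp g₁ = υ.comp g₂ at this
      rw [h₁, h₂] at this
      exact hτ this.symm
    · have := congrArg Subtype.val h
      change ComplexEmbedding.conjugate (υ₀.comp g₁) = ComplexEmbedding.conjugate (υ₀.comp g₂) at this
      rw [h₁, h₂, hττ] at this
      exact hτ this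
  · obtain ⟨⟨a, ha⟩, ⟨b, hb⟩⟩ := p
    intro h
    have hab : a ≠ b := fun h' => h (Subtype.ext h')
    rcases ha with rfl | rfl <;> rcases hb with rfl | rfl
    · exact absurd rfl hab
    · exact ⟨⟨υ₀, Or.inl rfl⟩, Prod.ext (Subtype.ext h₁) (Subtype.ext h₂)⟩
    · refine ⟨⟨ComplexEmbedding.conjugate υ₀, Or.inr rfl⟩, Prod.ext (Subtype.ext ?_)
        (Subtype.ext ?_)⟩
      · exact congrArg ComplexEmbedding.conjugate h₁
      · exact (congrArg ComplexEmbedding.conjugate h₂).trans hττ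
    · exact absurd rfl hab

end Components

variable {ε : ℤˣ} {q : ℤ}

theorem IsPairPeriod.exists_isPairBasis {c : ℂ} (hc : M.IsPairPeriod N τ σ ε c)
    (hq : M.FilCondition N τ σ ε q) :
    ∃ (I J : Type) (_ : Fintype I) (_ : DecidableEq I) (low : I → Prop) (_ : DecidablePred low)
      (ω : I → M.TC τ σ ⊗[ℂ] N.TC τ σ) (u : J → M.BC τ σ ⊗[ℂ] N.BC τ σ) (Z : Matrix I J ℂ)
      (e : {i // low i} ≃ J), M.IsPairBasis N σ Set.univ ε q low ω u Z ∧
        c = (Z.submatrix (Subtype.val : {i // low i} → I) e).det := by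
  classical
  rcases hc with ⟨hτ, hc⟩ | ⟨hτ, c₁, c₂, rfl, hc₁, hc₂⟩
  · have hinj : Function.Injective
        (Orbit.restrict (RingHom.id F) (Or.inl rfl : τ.comp (RingHom.id F) = τ ∨ _)) :=
      fun _ _ h => h
    obtain ⟨d, n, r, ω, u, Z, h, hr, he⟩ := (Pullback.id M σ).exists_isPairBasis (Pullback.id N σ)
      (Or.inl rfl) (Or.inl rfl) hinj rfl hc q
    rw [components_id_of_isReal hτ] at h
    have h3 := h.card_eq hq
    rw [card_fin_lt hr, Fintype.card_fin] at h3
    obtain ⟨e, rfl⟩ := he h3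
    exact ⟨_, _, _, _, _, _, ω, u, Z, e, h, rfl⟩
  · have hinj : Function.Injective
        (Orbit.restrict (RingHom.id F) (Or.inl rfl : τ.comp (RingHom.id F) = τ ∨ _)) :=
      fun _ _ h => h
    obtain ⟨d₁, n₁, r₁, ω₁, u₁, Z₁, hb₁, hr₁, he₁⟩ :=
      (Pullback.id M σ).exists_isPairBasis (Pullback.id N σ)
      (Or.inl rfl) (Or.inl rfl) hinj rfl hc₁ q
    have hg₁ : (conjField τ).subtype.comp
      (Orbit.toConjField (⟨τ, Or.inl rfl⟩ : Orbit τ)) = τ := rfl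
    have hg₂ : (conjField τ).subtype.comp
      (Orbit.toConjField (⟨ComplexEmbedding.conjugate τ, Or.inr rfl⟩ : Orbit τ)) =
        ComplexEmbedding.conjugate τ := rfl
    have hK : periodField (conjField τ).subtype σ = periodField τ σ :=
      congrArg (σ.fieldRange ⊔ ·) (conjField_subtype τ)
    obtain ⟨d₂, n₂, r₂, ω₂, u₂, Z₂, hb₂, hr₂, he₂⟩ :=
      (Pullback.extend M _ σ).exists_isPairBasis (Pullback.extend N _ σ)
      (Or.inl hg₁) (Or.inr hg₂) (restrict_injective _ hg₁ hτ) hK hc₂ q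
    have hd : Disjoint (Pullback.components (Or.inl rfl : τ.comp (RingHom.id F) = τ ∨ _)
        (Or.inl rfl : τ.comp (RingHom.id F) = τ ∨ _))
        (Pullback.components (Or.inl hg₁) (Or.inr hg₂)) :=
      Set.disjoint_left.2 fun p h h' =>
        (mem_components_swap hg₁ hg₂ hτ p).1 h' ((mem_components_id p).1 h)
    have hP : (Pullback.components (Or.inl rfl : τ.comp (RingHom.id F) = τ ∨ _)
        (Or.inl rfl : τ.comp (RingHom.id F) = τ ∨ _)) ∪
        (Pullback.components (Or.inl hg₁) (Or.inr hg₂)) = Set.univ :=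
      Set.eq_univ_of_forall fun p => by
        by_cases h : p.1 = p.2
        · exact Or.inl ((mem_components_id p).2 h)
        · exact Or.inr ((mem_components_swap hg₁ hg₂ hτ p).2 h)
    -- Only now are the numbers of rows in the two periods known to be those determined by Fil^q.
    obtain ⟨h3, h4⟩ := IsPairBasis.exists_merge hq hd hP hb₁ hr₁ hb₂ hr₂
    obtain ⟨e₁, rfl⟩ := he₁ h3
    obtain ⟨e₂, rfl⟩ := he₂ h4
    have hb := hb₁.merge hd hb₂
    rw [hP] at hb
    refine ⟨_, _, inferInstance, inferInstance, _, Classical.decPred _, _, _, _,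
      (subtypeSumElim _ _).trans (Equiv.sumCongr e₁ e₂), hb, ?_⟩
    exact (det_fromBlocks_submatrix Z₁ Z₂ e₁ e₂).symm

end Realization
end YoshidaPeriods

/-! ### Row weights of a motive and the final comparison -/

namespace YoshidaPeriods

theorem IsJumps.exists_eq_jump {ρ : ℤ → ℕ} {d t : ℕ} {jump : Fin t → ℤ} {s : Fin t → ℕ}
    {w : Fin d → ℤ} (hj : IsJumps ρ jump s) (h : IsStep ρ d) (hw : IsRowWeight ρ w) (μ : Fin t) :
    ∃ i, w i = jump μ := by
  have h1 := (hj.mem_range (jump μ)).1 ⟨μ, rfl⟩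
  have h2 := h.antitone (show jump μ ≤ jump μ + 1 by omega)
  have h3 := h.le (jump μ)
  -- This is the first row of the block of `μ`; it exists because `ρ` drops at the jump and is
  -- therefore positive there.
  let i : Fin d := ⟨d - ρ (jump μ), by omega⟩
  have hi : (i : ℕ) = d - ρ (jump μ) := rfl
  have h4 := (hw i (jump μ)).2 (by omega)
  have h5 : ¬ jump μ + 1 ≤ w i := fun h6 => by
    have := (hw i _).1 h6
    omega
  exact ⟨i, by omega⟩

namespace PureMotive

variable {F : Type uF} {E : Type uE} [Field F] [NumberField F] [Field E] [NumberField E]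
variable (M N : PureMotive.{uF, uE, uB, uD} F E) (τ : F →+* ℂ) (σ : E →+* ℂ)

theorem exists_isPeriodMatrix : ∃ X : M.PMatrix τ σ, M.IsPeriodMatrix τ σ X := by
  obtain ⟨ω, hω⟩ := exists_isAdapted (M.dStar τ σ) (V := M.T τ σ) rfl (M.TFil_antitone τ σ)
  let b := (M.isBaseChange_inclT τ σ).basis ω
  let u : ∀ ε : ℤˣ, Module.Basis (Fin (M.dSign τ σ ε)) σ.fieldRange (M.Bsign τ σ ε) :=
    fun ε => Module.finBasisOfFinrankEq _ _ rfl
  refine ⟨Matrix.of fun i c => b.repr (M.I0 τ σ (M.inclB τ σ (u c.1 c.2 : M.B τ σ))) i, u, ω, (M.isAdapted_iff τ σ ω).2 hω, fun ε j => ?_⟩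
  refine (b.sum_repr _).symm.trans (Finset.sum_congr rfl fun i _ => ?_)
  congr 1
  exact IsBaseChange.basis_apply _ _ _

theorem exists_rowWeight : ∃ w : Fin (M.dStar τ σ) → ℤ,
    IsGrading (M.grDim τ σ) (M.jump τ σ) w ∧ IsRowWeight (M.filDim τ σ) w ∧
    (∀ μ, ∃ i, w i = M.jump τ σ μ) ∧
    ∀ i x, M.HasRowWeight τ σ i x ↔ x = w i := by
  have hj := M.isJumps_filDim τ σ
  have h := M.isStep_filDim τ σ
  obtain ⟨w, h1, h2, h3⟩ := hj.exists_grading h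
  exact ⟨w, h1, h2, hj.exists_eq_jump h h2, h3⟩

theorem countRows_eq {w : Fin (M.dStar τ σ) → ℤ} (hw : ∀ i x, M.HasRowWeight τ σ i x ↔ x = w i)
    (k q : ℤ) : M.countRows τ σ k q = Nat.card {i // k + w i < q} :=
  Nat.card_congr (Equiv.subtypeEquivRight fun i => by
    simp only [hw, exists_eq_left])

end PureMotive

end YoshidaPeriods

theorem proposition4p1 {F : Type uF} {E : Type uE}
    [Field F] [NumberField F] [Field E] [NumberField E]
    (M N : PureMotive.{uF, uE, uB, uD} F E) (hM : M.MiddleScalar) (hN : N.MiddleScalar)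
    (τ : F →+* ℂ) (σ : E →+* ℂ) (ε : ℤˣ) (q : ℤ)
    (hq : M.toRealization.FilCondition N.toRealization τ σ ε q) :
    ∃ (φ : MvPolynomial (Fin (M.dStar τ σ) × ((δ : ℤˣ) × Fin (M.dSign τ σ δ))) ℚ)
      (ψ : MvPolynomial (Fin (N.dStar τ σ) × ((δ : ℤˣ) × Fin (N.dSign τ σ δ))) ℚ),
      IsCharacterizedByType (M.grDim τ σ)
        (fun μ => N.countRows τ σ (M.jump τ σ μ) q) (fun δ => N.dSign τ σ (ε * δ)) φ ∧
      IsCharacterizedByType (N.grDim τ σ)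
        (fun ν => M.countRows τ σ (N.jump τ σ ν) q) (fun δ => M.dSign τ σ (ε * δ)) ψ ∧
      ∀ (c : ℂ) (X : M.PMatrix τ σ) (Y : N.PMatrix τ σ),
        M.toRealization.IsPairPeriod N.toRealization τ σ ε c →
        M.IsPeriodMatrix τ σ X → N.IsPeriodMatrix τ σ Y →
        SimUpTo (periodField τ σ) c (evalMatrix φ X * evalMatrix ψ Y) := by
  classical
  obtain ⟨w, hgw, hrw, hjw, hcw⟩ := M.exists_rowWeight τ σ
  obtain ⟨w', hgw', hrw', hjw', hcw'⟩ := N.exists_rowWeight τ σ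
  have key : ∀ (X : M.PMatrix τ σ) (Y : N.PMatrix τ σ), M.IsPeriodMatrix τ σ X →
      N.IsPeriodMatrix τ σ Y →
        ∃ (ω : _ → M.TC τ σ ⊗[ℂ] N.TC τ σ) (u : _ → M.BC τ σ ⊗[ℂ] N.BC τ σ),
        M.IsPairBasis N.toRealization σ Set.univ ε q
        (fun ij : Fin (M.dStar τ σ) × Fin (N.dStar τ σ) => w ij.1 + w' ij.2 < q) ω u
        (Matrix.of fun (r : Fin (M.dStar τ σ) × Fin (N.dStar τ σ))
          (c : PairCol (M.dSign τ σ) (N.dSign τ σ) ε) => X r.1 c.1.1 * Y r.2 c.1.2) := by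
    rintro X Y ⟨u, ω, hω, hX⟩ ⟨v, η, hη, hY⟩
    exact ⟨_, _, Realization.isPairBasis_tensor
      (((M.isAdapted_iff τ σ ω).1 hω).eq_span_weight hrw)
      (((N.isAdapted_iff τ σ η).1 hη).eq_span_weight hrw') hX hY ε q⟩
  -- One pair of period matrices is needed in advance: it shows that the minor is square and not
  -- identically zero, before `φ` and `ψ` are chosen.
  obtain ⟨X₁, hX₁⟩ := M.exists_isPeriodMatrix τ σ
  obtain ⟨Y₁, hY₁⟩ := N.exists_isPeriodMatrix τ σ
  obtain ⟨ω₁, u₁, hb₁⟩ := key X₁ Y₁ hX₁ hY₁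
  have hcard : Fintype.card (LowRow w w' q) =
    Fintype.card (PairCol (M.dSign τ σ) (N.dSign τ σ) ε) := hb₁.card_eq hq
  have hcard' : Fintype.card (LowRow w' w q) =
      Fintype.card (PairCol (N.dSign τ σ) (M.dSign τ σ) ε) := by
    rw [Fintype.card_congr swapRow, hcard, Fintype.card_congr swapCol]
  let g : LowRow w w' q ≃ PairCol (M.dSign τ σ) (N.dSign τ σ) ε := Fintype.equivOfCardEq hcard
  have h₁ : pairDet g X₁ Y₁ ≠ 0 := hb₁.det_ne_zero hq g
  obtain ⟨φ, ψ, r, hr, hφ, hψ, h⟩ := exists_pairDet_factorization hgw hgw'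
    (M.dSign_add τ σ 1).symm (N.dSign_add τ σ 1).symm g X₁ Y₁ h₁
    (isAdmissible_of_card_eq (M.isHodge τ σ hM) (N.isHodge τ σ hN) (M.isJumps_filDim τ σ)
      hrw hrw' hjw hcard)
    (isAdmissible_of_card_eq (N.isHodge τ σ hN) (M.isHodge τ σ hM) (N.isJumps_filDim τ σ)
      hrw' hrw hjw' hcard')
  simp only [← N.countRows_eq τ σ hcw'] at hφ
  simp only [← M.countRows_eq τ σ hcw] at hψ
  refine ⟨φ, ψ, hφ, hψ, fun c X Y hc hX hY => ?_⟩
  obtain ⟨ω, u, hb⟩ := key X Y hX hY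
  obtain ⟨I, J, _, _, low, _, ω', u', Z, e, hb', rfl⟩ := hc.exists_isPairBasis hq
  obtain ⟨a, haK, ha0, ha⟩ := hb.simUpTo hb' g e
  -- The constant `r` relating the product of the two polynomials to the minor is a nonzero
  -- rational, so it lies in every subfield of `ℂ`.
  refine ⟨a * (r : ℂ)⁻¹, mul_mem haK (inv_mem (SubfieldClass.ratCast_mem _ r)), mul_ne_zero ha0
    (inv_ne_zero (Rat.cast_ne_zero.2 hr)), ?_⟩
  rw [ha, h]
  change pairDet g X Y * a = _
  field_simp

end
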